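/- Let $K\ge 1$. A state vector $\theta=(\theta_1,\dots,\theta_K)'\sim\mathcal N(\mu^0,V^0)$, with $V^0$ positive definite, is unknown and persistent. There are $K$ sources; an observation of source $k$ is $X_k=\langle c_k,\theta\rangle+\epsilon_k$ with $\epsilon_k\sim\mathcal N(0,\sigma_k^2)$, $\sigma_k>0$, the errors being independent of $\theta$ and independent across observations and sources. Let $C$ be the matrix with rows $c_k'$, and assume that $C$ is invertible and that all entries of the first row of $C^{-1}$ are nonzero. For a division $q=(q_1,\dots,q_K)\in\mathbb Z_+^K$ let $f(q)$ be the posterior variance of $\theta_1$ after $q_k$ observations of each source $k$ (it does not depend on $\mu^0$), extended to $(\mathbb Z_+\cup\{\infty\})^K$ by limits. Assume that every source always has strictly positive marginal value: $f(q_k+1,q_{-k})<f(q)$ for every $q\in(\mathbb Z_+\cup\{\infty\})^K$ and every $k$ with $q_k<\infty$ (for fixed $V^0$ and $\sigma_1,\dots,\sigma_K$ this holds for generic $C$). A division $q$ with $\sum_k q_k=t$ is called $t$-optimal if it minimizes $f$ among all divisions of $t$ observations. Let $$\lambda_i=\frac{|[C^{-1}]_{1i}|\,\sigma_i}{\sum_{j=1}^K|[C^{-1}]_{1j}|\,\sigma_j}.$$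 In each period $t=1,2,\dots$ the decision maker chooses one source, as a measurable function of the realizations observed so far, observes it, and then chooses an action $a_t$ from a set $A_t$, as a measurable function of the realizations observed so far. A decision problem is given by action sets (measurable spaces) $A_1,A_2,\dots$ and an arbitrary measurable payoff function $U(a_1,a_2,\dots;\theta_1)$. A strategy is optimal if its payoff is integrable and no strategy has a larger expected payoff. Let $d(t)$ be the (random) vector of the numbers of observations of each source in the first $t$ periods. Suppose that $\lambda_i/\lambda_j$ is irrational for all $i\neq j$. Then there is a set $\mathcal A$ of times with natural density $1$, depending only on $(V^0,C,\sigma_1,\dots,\sigma_K)$, such that for every $t\in\mathcal A$ the $t$-optimal division $n(t)$ is unique, and such that for every $\mu^0$ and every decision problem that has an optimal strategy there is an optimal strategy with $d(t)=n(t)$ almost surely for every $t\in\mathcal A$. In particular, this strategy induces a deterministic division at such times. -/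

import Mathlib

open MeasureTheory ProbabilityTheory Filter Topology

noncomputable section

/-- An informational environment with `K` states and `K` sources: the prior covariance matrix
`V` of the state vector `θ`, the coefficient matrix `C` (its `k`-th row is the coefficient vector
of source `k`) and the standard deviations `σ k` of the observation errors. -/
structure Environment (K : ℕ) where
  V : Matrix (Fin K) (Fin K) ℝ
  C : Matrix (Fin K) (Fin K) ℝ
  σ : Fin K → ℝ
  posDef_V : V.PosDef
  σ_pos : ∀ k, 0 < σ k

/-- A sample point: the state vector `θ`, and the errors `ε (k, n)` of the potential
observations `n = 0, 1, 2, …` of every source `k`. -/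
abbrev Sample (K : ℕ) : Type := EuclideanSpace ℝ (Fin K) × (Fin K × ℕ → ℝ)

namespace Environment

variable {K : ℕ}

/-- The law of the sample point: `θ ∼ N(μ, V)`, and, independently, independent errors
`ε (k, n) ∼ N(0, σ k ^ 2)`. -/
def law (E : Environment K) (μ : EuclideanSpace ℝ (Fin K)) : Measure (Sample K) :=
  (multivariateGaussian μ E.V).prod
    (Measure.infinitePi fun p : Fin K × ℕ => gaussianReal 0 (Real.toNNReal (E.σ p.1 ^ 2)))

/-- The `n`-th potential observation `⟨c_k, θ⟩ + ε (k, n)` of source `k`. -/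
def signal (E : Environment K) (k : Fin K) (n : ℕ) (ω : Sample K) : ℝ :=
  ∑ j, E.C k j * ω.1 j + ω.2 (k, n)

/-- The σ-algebra generated by `q k` observations of each source `k`. -/
@[reducible] def obsAlgebra (E : Environment K) (q : Fin K → ℕ) : MeasurableSpace (Sample K) :=
  MeasurableSpace.comap (fun ω (p : Σ k, Fin (q k)) => E.signal p.1 p.2 ω) inferInstance

/-- The posterior variance of the payoff-relevant state (coordinate `0`), under the prior
`N(μ, V)`, after `q k` observations of each source `k`. The conditional variance of a Gaussian
vector is almost surely constant; the integral picks out this constant. -/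
def posteriorVarianceAt [NeZero K] (E : Environment K) (μ : EuclideanSpace ℝ (Fin K))
    (q : Fin K → ℕ) : ℝ :=
  ∫ ω, (Var[fun ω : Sample K => ω.1 0; E.law μ | E.obsAlgebra q]) ω ∂(E.law μ)

/-- The posterior variance function `f` of the environment. It does not depend on the prior mean
(see `posteriorVarianceAt_eq`), which is therefore taken to be `0`. -/
def posteriorVariance [NeZero K] (E : Environment K) (q : Fin K → ℕ) : ℝ :=
  E.posteriorVarianceAt 0 q

theorem measurable_signal (E : Environment K) (k : Fin K) (n : ℕ) :
    Measurable (E.signal k n) := by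
  unfold signal; fun_prop

instance (E : Environment K) (μ : EuclideanSpace ℝ (Fin K)) : IsProbabilityMeasure (E.law μ) := by
  unfold law; infer_instance

theorem obsAlgebra_le (E : Environment K) (q : Fin K → ℕ) :
    E.obsAlgebra q ≤ (inferInstance : MeasurableSpace (Sample K)) := by
  unfold obsAlgebra
  exact Measurable.comap_le (measurable_pi_lambda _ fun p => E.measurable_signal p.1 p.2)

/-- Translation of the state vector. -/
def shift (a : EuclideanSpace ℝ (Fin K)) (ω : Sample K) : Sample K := (a + ω.1, ω.2)

theorem measurable_shift (a : EuclideanSpace ℝ (Fin K)) : Measurable (shift a) := by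
  unfold shift; fun_prop

theorem law_eq_map (E : Environment K) (μ : EuclideanSpace ℝ (Fin K)) :
    E.law μ = (E.law 0).map (shift μ) := by
  have h1 : multivariateGaussian μ E.V = (multivariateGaussian 0 E.V).map (fun x => μ + x) := by
    unfold multivariateGaussian
    rw [Measure.map_map (by fun_prop) (by fun_prop)]
    congr 1
    ext x
    simp
  unfold law
  rw [h1]
  conv_lhs => rw [← Measure.map_id (μ := Measure.infinitePi fun p : Fin K × ℕ =>
    gaussianReal 0 (Real.toNNReal (E.σ p.1 ^ 2)))]
  rw [Measure.map_prod_map _ _ (by fun_prop) measurable_id]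
  rfl

theorem comap_shift_obsAlgebra (E : Environment K) (a : EuclideanSpace ℝ (Fin K))
    (q : Fin K → ℕ) : (E.obsAlgebra q).comap (shift a) = E.obsAlgebra q := by
  let F : Sample K → (Σ k, Fin (q k)) → ℝ := fun ω p => E.signal p.1 p.2 ω
  let c : (Σ k, Fin (q k)) → ℝ := fun p => ∑ j, E.C p.1 j * a j
  have hF : F ∘ shift a = fun ω => c + F ω := by
    ext ω p
    simp only [F, c, shift, signal, Function.comp, Pi.add_apply, PiLp.add_apply, mul_add,
      Finset.sum_add_distrib]
    ring
  have hF' : F = (fun x => -c + x) ∘ (F ∘ shift a) := by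
    rw [hF]; ext ω p; simp
  have e1 : (E.obsAlgebra q).comap (shift a) = MeasurableSpace.comap (F ∘ shift a) inferInstance :=
    MeasurableSpace.comap_comp
  have e2 : E.obsAlgebra q = MeasurableSpace.comap F inferInstance := rfl
  rw [e1, e2]
  apply le_antisymm
  · rw [hF]
    change MeasurableSpace.comap ((fun x => c + x) ∘ F) _ ≤ _
    rw [← MeasurableSpace.comap_comp]
    exact MeasurableSpace.comap_mono (Measurable.comap_le (by fun_prop))
  · conv_lhs => rw [hF', ← MeasurableSpace.comap_comp]
    exact MeasurableSpace.comap_mono (Measurable.comap_le (by fun_prop))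

theorem memLp_state [NeZero K] (E : Environment K) (μ : EuclideanSpace ℝ (Fin K)) :
    MemLp (fun ω : Sample K => ω.1 0) 2 (E.law μ) := by
  have h : MemLp (fun x : EuclideanSpace ℝ (Fin K) => x 0) 2 (multivariateGaussian μ E.V) :=
    IsGaussian.memLp_dual _ (EuclideanSpace.proj (0 : Fin K)) 2 (by simp)
  exact h.comp_measurePreserving measurePreserving_fst

/-- The posterior variance does not depend on the prior mean. -/
theorem posteriorVarianceAt_eq [NeZero K] (E : Environment K) (μ : EuclideanSpace ℝ (Fin K))
    (q : Fin K → ℕ) : E.posteriorVarianceAt μ q = E.posteriorVariance q := by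
  have hm := E.obsAlgebra_le q
  have key : ∀ ν, E.posteriorVarianceAt ν q = ∫ ω, (ω.1 0 -
      ((E.law ν)[fun ω : Sample K => ω.1 0 | E.obsAlgebra q]) ω) ^ 2 ∂(E.law ν) := by
    intro ν
    unfold posteriorVarianceAt condVar
    rw [integral_condExp hm]
    rfl
  unfold posteriorVariance
  rw [key, key]
  set g := (E.law μ)[fun ω : Sample K => ω.1 0 | E.obsAlgebra q] with hg
  have hgm : StronglyMeasurable[E.obsAlgebra q] g := stronglyMeasurable_condExp
  have hS := measurable_shift μ
  have hXi : ∀ ν, Integrable (fun ω : Sample K => ω.1 0) (E.law ν) := fun ν =>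
    (E.memLp_state ν).integrable (by norm_num)
  have hgi : Integrable (fun ω => g (shift μ ω)) (E.law 0) := by
    refine Integrable.comp_measurable (g := g) ?_ hS
    rw [← law_eq_map]; exact integrable_condExp
  have hcond : (fun ω => g (shift μ ω) - μ 0) =ᵐ[E.law 0]
      (E.law 0)[fun ω : Sample K => ω.1 0 | E.obsAlgebra q] := by
    refine ae_eq_condExp_of_forall_setIntegral_eq hm (hXi 0)
      (fun s _ _ => (hgi.sub (integrable_const _)).integrableOn) ?_ ?_
    · intro s hs _
      rw [← comap_shift_obsAlgebra E μ q] at hs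
      obtain ⟨t, ht, rfl⟩ := hs
      have h1 : ∫ ω in t, g ω ∂(E.law μ) = ∫ ω in t, ω.1 0 ∂(E.law μ) :=
        setIntegral_condExp hm (hXi μ) ht
      have htm := hm t ht
      rw [E.law_eq_map μ, setIntegral_map htm _ hS.aemeasurable,
        setIntegral_map htm _ hS.aemeasurable] at h1
      · have h2 : ∀ ω : Sample K, (shift μ ω).1 0 = μ 0 + ω.1 0 := fun ω => by simp [shift]
        simp only [h2] at h1
        rw [integral_add (integrable_const _) (hXi 0).integrableOn] at h1
        rw [integral_sub hgi.integrableOn (integrable_const _)]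
        linarith
      · exact Measurable.aestronglyMeasurable (by fun_prop)
      · exact (hgm.mono hm).aestronglyMeasurable
    · have h3 : StronglyMeasurable[E.obsAlgebra q] (g ∘ shift μ) := by
        refine hgm.comp_measurable ?_
        rw [measurable_iff_comap_le, comap_shift_obsAlgebra]
      exact (h3.sub stronglyMeasurable_const).aestronglyMeasurable
  have h4 : Measurable fun ω : Sample K => (ω.1 0 - g ω) ^ 2 :=
    ((by fun_prop : Measurable fun ω : Sample K => ω.1 0).sub (hgm.mono hm).measurable).pow_const 2
  rw [show ∫ ω, (ω.1 0 - g ω) ^ 2 ∂(E.law μ) = ∫ ω, ((shift μ ω).1 0 - g (shift μ ω)) ^ 2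
      ∂(E.law 0) from by
    rw [E.law_eq_map μ]; exact integral_map hS.aemeasurable h4.aestronglyMeasurable]
  refine integral_congr_ae ?_
  filter_upwards [hcond] with ω hω
  rw [← hω]
  simp only [shift, PiLp.add_apply]
  ring

/-- The posterior variance function extended to divisions with infinite entries. It is nonincreasing
in every entry, so its limit at an infinite division is an infimum over finite divisions. -/
def extPosteriorVariance [NeZero K] (E : Environment K) (q : Fin K → ℕ∞) : ℝ :=
  ⨅ p : {p : Fin K → ℕ // ∀ k, (p k : ℕ∞) ≤ q k}, E.posteriorVariance p

/-- No redundant sources: `C` is invertible and the first row of `C⁻¹` has nonzero entries. -/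
def NonRedundant [NeZero K] (E : Environment K) : Prop :=
  IsUnit E.C ∧ ∀ i, E.C⁻¹ 0 i ≠ 0

/-- Every source has strictly positive marginal value: at every division, finite or infinite,
one more observation of a source observed finitely often lowers the posterior variance. -/
def PositiveMarginalValue [NeZero K] (E : Environment K) : Prop :=
  ∀ (q : Fin K → ℕ∞) (k : Fin K), q k ≠ ⊤ →
    E.extPosteriorVariance (Function.update q k (q k + 1)) < E.extPosteriorVariance q

/-- The limiting frequency `λ i` of source `i`. -/
def freq [NeZero K] (E : Environment K) (i : Fin K) : ℝ :=
  |E.C⁻¹ 0 i| * E.σ i / ∑ j, |E.C⁻¹ 0 j| * E.σ j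

/-- `q` is a `t`-optimal division: it minimizes the posterior variance among all divisions of
`t` observations. -/
def IsTOptimal [NeZero K] (E : Environment K) (t : ℕ) (q : Fin K → ℕ) : Prop :=
  ∑ k, q k = t ∧ ∀ p : Fin K → ℕ, ∑ k, p k = t → E.posteriorVariance q ≤ E.posteriorVariance p

end Environment

/-- A strategy for the action sets `𝒜 0, 𝒜 1, …`. In period `t = 0, 1, …` the decision maker chooses
a source as a measurable function of the `t` realizations observed so far, observes it, and then
chooses an action as a measurable function of the `t + 1` realizations observed so far. (The sources
chosen so far are determined by the realizations.) -/
structure Strategy (K : ℕ) (𝒜 : ℕ → Type*) [∀ t, MeasurableSpace (𝒜 t)] where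
  source : ∀ t : ℕ, (Fin t → ℝ) → Fin K
  measurable_source : ∀ t, Measurable (source t)
  action : ∀ t : ℕ, (Fin (t + 1) → ℝ) → 𝒜 t
  measurable_action : ∀ t, Measurable (action t)

namespace Strategy

variable {K : ℕ} {𝒜 : ℕ → Type*} [∀ t, MeasurableSpace (𝒜 t)]

/-- The first `t` realizations observed under the strategy. If source `k` is chosen in period `t`,
the potential observation number `t` of source `k` is observed. -/
def history (s : Strategy K 𝒜) (E : Environment K) (ω : Sample K) : ∀ t : ℕ, Fin t → ℝ
  | 0 => Fin.elim0
  | t + 1 => Fin.snoc (α := fun _ => ℝ) (history s E ω t)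
      (E.signal (s.source t (history s E ω t)) t ω)

/-- The division `d(t)`: how often each source was chosen in the first `t` periods. -/
def division (s : Strategy K 𝒜) (E : Environment K) (ω : Sample K) (t : ℕ) (k : Fin K) : ℕ :=
  ((Finset.range t).filter fun r => s.source r (s.history E ω r) = k).card

/-- The payoff `U (a₀, a₁, …; θ₁)` realized at a sample point. -/
def payoff [NeZero K] (s : Strategy K 𝒜) (E : Environment K) (U : (∀ t, 𝒜 t) → ℝ → ℝ)
    (ω : Sample K) : ℝ :=
  U (fun t => s.action t (s.history E ω (t + 1))) (ω.1 0)

/-- The expected payoff, as an extended real number: the expectation of the positive part minus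
that of the negative part, with the convention `∞ - ∞ = -∞`. -/
def expectedPayoff [NeZero K] (s : Strategy K 𝒜) (E : Environment K)
    (μ : EuclideanSpace ℝ (Fin K)) (U : (∀ t, 𝒜 t) → ℝ → ℝ) : EReal :=
  ((∫⁻ ω, ENNReal.ofReal (s.payoff E U ω) ∂(E.law μ) : ENNReal) : EReal) -
    ((∫⁻ ω, ENNReal.ofReal (-s.payoff E U ω) ∂(E.law μ) : ENNReal) : EReal)

/-- An optimal strategy: its payoff is integrable, and no strategy has a larger expected payoff. -/
def IsOptimal [NeZero K] (s : Strategy K 𝒜) (E : Environment K)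
    (μ : EuclideanSpace ℝ (Fin K)) (U : (∀ t, 𝒜 t) → ℝ → ℝ) : Prop :=
  Integrable (s.payoff E U) (E.law μ) ∧
    ∀ s' : Strategy K 𝒜, s'.expectedPayoff E μ U ≤ s.expectedPayoff E μ U

end Strategy

/-- The set `A` of positive integers has natural density `d` (elements `0` are ignored). -/
def HasNaturalDensity (A : Set ℕ) (d : ℝ) : Prop :=
  Tendsto (fun N : ℕ => ((A ∩ Set.Icc 1 N).ncard : ℝ) / N) atTop (𝓝 d)

end

set_option linter.unusedSectionVars false

noncomputable section

/-! The proof has a static and a dynamic half.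

Static half. One more observation of source `k` lowers the posterior variance by `marginal E q k`.
In the coordinates given by the signals, the covariances `loading` of the signals with the
payoff-relevant state solve a linear system with `q k / σ k ^ 2` added on the diagonal. Hence, near
a balanced division of level `y`, the reciprocal of the marginal value is, up to a common factor,
the square of the rank `(q k + offset k) / λ k`, with an error of smaller order than `y`
(`tendsto_invMarginal_sub`). So marginal values are ordered like ranks as soon as the ranks differ
by a fixed `ε`. The ranks of a source form an arithmetic progression of step `1 / λ k`, and the
greedy division collects the `t` least ranks. If these lie at least `ε` below all others and `t` is
large, an exchange of an observation outside the greedy division for a missing one inside lowers the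
variance, and such exchanges lead from any division of `t` observations to the greedy one
(`exists_isGoodTime`, `clamp_le`). A time without a gap is a near coincidence of two progressions.
As the ratio of their steps is irrational, for small `ε` the near coincidences of a given pair are
more than `Q` apart (`exists_gap_cover`). So the good times have density one and, the number of
pairs being fixed, eventually bounded gaps.

The exchanges also work for divisions of boundedly more than `t` observations. Therefore every
division can be replaced by one that is no worse, so that one more observation in the original is
one more in the replacement, and the replacement is greedy at all good times (`exists_reduction`).

Dynamic half. The decision maker observes according to the replaced divisions and simulates the
realizations of a given optimal strategy. Having the lower posterior variance, and using independent
Gaussian randomizations, one can do this so that the simulated realizations and the payoff-relevant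
state have their original joint law (`measurePreserving_randomize`, `map_mimicError`,
`lintegral_mimicState`). The expected payoff, averaged over the randomizations, is thus the optimal
one. Since no fixed randomization does better, almost every one attains it
(`exists_isOptimal_mimicStrategy`). -/

/-! ### Divisions ordered by scores -/

section Combinatorics

variable {ι L : Type*} [Fintype ι] [DecidableEq ι] [Nonempty ι] [LinearOrder L]

/-- A source whose next observation has the least score. -/
def minScore (score : ι → ℕ → L) (q : ι → ℕ) : ι :=
  (Finset.exists_min_image Finset.univ (fun k => score k (q k)) Finset.univ_nonempty).choose

theorem minScore_le (score : ι → ℕ → L) (q : ι → ℕ) (k : ι) :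
    score (minScore score q) (q (minScore score q)) ≤ score k (q k) :=
  (Finset.exists_min_image Finset.univ (fun k => score k (q k))
    Finset.univ_nonempty).choose_spec.2 k (Finset.mem_univ k)

/-- The division consisting of the `s` observations of least scores. -/
def greedy (score : ι → ℕ → L) : ℕ → ι → ℕ
  | 0 => 0
  | s + 1 => greedy score s + Pi.single (minScore score (greedy score s)) 1

theorem sum_add_single (q : ι → ℕ) (k : ι) :
    ∑ i, (q + Pi.single k 1 : ι → ℕ) i = ∑ i, q i + 1 := by
  simp [Finset.sum_add_distrib]

theorem sum_greedy (score : ι → ℕ → L) (s : ℕ) : ∑ k, greedy score s k = s := by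
  induction s with
  | zero => simp [greedy]
  | succ s ih => rw [greedy, sum_add_single, ih]

theorem greedy_mono (score : ι → ℕ → L) : Monotone (greedy score) :=
  monotone_nat_of_le_succ fun s k => by simp [greedy]

/-- Counts rise by one at a time, so each observation in a greedy division was chosen at some step;
scores can be compared at that step. -/
theorem exists_greedy_eq (score : ι → ℕ → L) {s m : ℕ} {j : ι} (h : m < greedy score s j) :
    ∃ s' < s, greedy score s' j = m ∧ minScore score (greedy score s') = j := by
  induction s with
  | zero => simp [greedy] at h
  | succ s ih =>
    by_cases h' : m < greedy score s j
    · obtain ⟨s', h1, h2⟩ := ih h'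
      exact ⟨s', by omega, h2⟩
    · refine ⟨s, by omega, ?_⟩
      by_cases hj : minScore score (greedy score s) = j
      · refine ⟨?_, hj⟩
        simp [greedy, hj] at h
        omega
      · exfalso
        simp [greedy, Ne.symm hj] at h
        omega

/-- Greedy divisions are initial segments in the order of scores: when observation `m` of `j` was
chosen, all observations of smaller score had been chosen. Injectivity across sources settles equal
scores. -/
theorem lt_greedy_of_score_le {score : ι → ℕ → L} (hmono : ∀ k, StrictMono (score k))
    (hinj : ∀ k l m m', score k m = score l m' → k = l) {s m m' : ℕ} {j k : ι}
    (h : m < greedy score s j) (hle : score k m' ≤ score j m) : m' < greedy score s k := by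
  obtain ⟨s', h1, h2, h3⟩ := exists_greedy_eq score h
  have h4 := minScore_le score (greedy score s') k
  rw [h3, h2] at h4
  have h5 : m' ≤ greedy score s' k := (hmono k).le_iff_le.1 (hle.trans h4)
  have h6 : greedy score s' k ≤ greedy score s k := greedy_mono score h1.le k
  rcases h5.lt_or_eq with h7 | h7
  · exact h7.trans_le h6
  · have h8 : score k m' = score j m := le_antisymm hle (h7 ▸ h4)
    have h9 := hinj _ _ _ _ h8
    subst h9
    rwa [(hmono k).injective h8]

/-- Every entry of `q`, truncated from above by `hi` and then from below by `lo`. -/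
def clamp (lo hi q : ι → ℕ) : ι → ℕ := fun k => max (min (q k) (hi k)) (lo k)

theorem clamp_mono {lo lo' hi hi' q q' : ι → ℕ} (h1 : lo ≤ lo') (h2 : hi ≤ hi') (h3 : q ≤ q') :
    clamp lo hi q ≤ clamp lo' hi' q' := fun k =>
  max_le_max (min_le_min (h3 k) (h2 k)) (h1 k)

/-- `t` is a time at which replacing an observation beyond `greedy score t` by the observation of
least score lowers `f`, for divisions of less than `t + B` observations. -/
def IsGoodTime (score : ι → ℕ → L) (f : (ι → ℕ) → ℝ) (B t : ℕ) : Prop :=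
  ∀ (q : ι → ℕ) (i : ι), ∑ k, q k < t + B → greedy score t i ≤ q i →
    q (minScore score q) < greedy score t (minScore score q) →
    f (q + Pi.single (minScore score q) 1) < f (q + Pi.single i 1)

theorem exists_sub_single {q : ι → ℕ} {i : ι} (h : 0 < q i) :
    ∃ q' : ι → ℕ, q = q' + Pi.single i 1 := by
  refine ⟨q - Pi.single i 1, ?_⟩
  ext k
  by_cases hk : k = i
  · subst hk; simp; omega
  · simp [hk]

/-- Clamping between greedy divisions does not raise `f`. -/
theorem clamp_le {score : ι → ℕ → L} (hmono : ∀ k, StrictMono (score k))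
    (hinj : ∀ k l m m', score k m = score l m' → k = l) {f : (ι → ℕ) → ℝ} {s u r : ℕ}
    (hsu : s ≤ u)
    (hgood : ∀ (q : ι → ℕ) (i : ι), ∑ k, q k < r → greedy score u i ≤ q i →
      q (minScore score q) < greedy score s (minScore score q) →
      f (q + Pi.single (minScore score q) 1) < f (q + Pi.single i 1)) :
    ∀ q : ι → ℕ, ∑ k, q k = r → ∑ k, clamp (greedy score s) (greedy score u) q k = r →
      f (clamp (greedy score s) (greedy score u) q) ≤ f q ∧
      (q ≠ clamp (greedy score s) (greedy score u) q →
        f (clamp (greedy score s) (greedy score u) q) < f q) := by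
  have hle : ∀ k, greedy score s k ≤ greedy score u k := fun k => greedy_mono score hsu k
  set lo := greedy score s with hlo
  set hi := greedy score u with hhi
  -- Induction on the number of observations of `q` in excess of its clamp; truncated subtraction
  -- ignores the sources that fall short.
  suffices H : ∀ (n : ℕ) (q : ι → ℕ), ∑ k, (q k - clamp lo hi q k) = n → ∑ k, q k = r →
      ∑ k, clamp lo hi q k = r → f (clamp lo hi q) ≤ f q ∧
      (q ≠ clamp lo hi q → f (clamp lo hi q) < f q) from fun q => H _ q rfl
  intro n
  induction n using Nat.strong_induction_on with
  | _ n ih =>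
    intro q hn hq hc
    by_cases hqc : q = clamp lo hi q
    · exact ⟨by rw [← hqc], fun h => absurd hqc h⟩
    suffices h : f (clamp lo hi q) < f q from ⟨h.le, fun _ => h⟩
    have h1 : ∃ i, clamp lo hi q i < q i := by
      by_contra! h
      refine hqc (funext fun k => ?_)
      have := (Finset.sum_eq_sum_iff_of_le fun i _ => h i).1 (hq.trans hc.symm)
      exact this k (Finset.mem_univ k)
    have h2 : ∃ j, q j < clamp lo hi q j := by
      by_contra! h
      refine hqc (funext fun k => ?_)
      have := (Finset.sum_eq_sum_iff_of_le fun i _ => h i).1 (hc.trans hq.symm)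
      exact (this k (Finset.mem_univ k)).symm
    obtain ⟨i, hi1⟩ := h1
    obtain ⟨j, hj1⟩ := h2
    have hi2 : hi i < q i := by
      simp only [clamp] at hi1; omega
    have hj2 : q j < lo j := by
      simp only [clamp] at hj1; omega
    -- One observation is moved from `i`, which exceeds `hi`, to the source `m` of least score. This
    -- need not be `j`, but it also falls short of `lo`, since `lo` is an initial segment in the
    -- order of scores.
    obtain ⟨q', rfl⟩ := exists_sub_single (q := q) (i := i) (by omega)
    rw [Pi.add_apply, Pi.single_eq_same] at hi2
    have hij : j ≠ i := by
      rintro rfl; exact absurd (hi1.trans hj1) (lt_irrefl _)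
    have hj3 : q' j < lo j := by
      simpa [Pi.single_apply, hij] using hj2
    have hi3 : hi i ≤ q' i := by omega
    set m := minScore score q' with hm
    have hm1 : q' m < lo m := lt_greedy_of_score_le hmono hinj hj3 (minScore_le score q' j)
    have hsum : ∑ k, q' k + 1 = r := by rw [← hq, sum_add_single]
    have hlt := hgood q' i (by omega) hi3 hm1
    have hmi : m ≠ i := by
      intro h; rw [h] at hm1; have := hle i; omega
    -- After the exchange `i` is still at or above `hi` and `m` at or below `lo`, so the clamp is
    -- unchanged while the excess drops.
    have hcl : clamp lo hi (q' + Pi.single m 1) = clamp lo hi (q' + Pi.single i 1) := by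
      ext k
      simp only [clamp, Pi.add_apply, Pi.single_apply]
      by_cases hk : k = m
      · have := hle k
        subst hk; simp only [if_true, if_neg hmi]; omega
      · by_cases hk' : k = i
        · subst hk'; simp only [if_true, if_neg hk]; omega
        · simp [hk, hk']
    have hless : ∑ k, ((q' + Pi.single m 1 : ι → ℕ) k - clamp lo hi (q' + Pi.single m 1) k) < n := by
      rw [← hn, hcl]
      refine Finset.sum_lt_sum (fun k _ => ?_) ⟨i, Finset.mem_univ i, ?_⟩
      · by_cases hk : k = m
        · have := hle k
          subst hk
          simp only [clamp, Pi.add_apply, Pi.single_apply, if_true, if_neg hmi]; omega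
        · simp only [Pi.add_apply, Pi.single_apply, if_neg hk]; omega
      · simp only [clamp, Pi.add_apply, Pi.single_apply, if_true, if_neg hmi.symm] at hi1 ⊢; omega
    have := (ih _ hless (q' + Pi.single m 1) rfl (by rw [sum_add_single, hsum])
      (by rw [hcl, hc])).1
    rw [hcl] at this
    exact this.trans_lt hlt

theorem sum_clamp_self (score : ι → ℕ → L) (t : ℕ) (q : ι → ℕ) :
    clamp (greedy score t) (greedy score t) q = greedy score t := by
  ext k; simp [clamp]

/-- At a good time the greedy division is the unique minimizer of `f`. -/
theorem IsGoodTime.greedy_lt {score : ι → ℕ → L} (hmono : ∀ k, StrictMono (score k))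
    (hinj : ∀ k l m m', score k m = score l m' → k = l) {f : (ι → ℕ) → ℝ} {B t : ℕ}
    (h : IsGoodTime score f B t) {q : ι → ℕ} (hq : ∑ k, q k = t) (hne : q ≠ greedy score t) :
    f (greedy score t) < f q := by
  have := (clamp_le hmono hinj le_rfl (f := f) (fun q i h1 h2 h3 =>
    h q i (by omega) h2 h3) q hq (by rw [sum_clamp_self, sum_greedy])).2
  rw [sum_clamp_self] at this
  exact this hne

/-- A chain of divisions from `greedy score t₁` to `greedy score t₂`. -/
def clampChain (score : ι → ℕ → L) (t₁ t₂ l : ℕ) (q : ι → ℕ) : ι → ℕ :=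
  -- By the truncated subtraction and the minimum, the upper bound rises during the first `t₂ - t₁`
  -- steps and the lower bound during the next `t₂ - t₁`.
  clamp (greedy score (t₁ + (l - (t₂ - t₁)))) (greedy score (min (t₁ + l) t₂)) q

theorem clampChain_mono (score : ι → ℕ → L) (t₁ t₂ : ℕ) {l l' : ℕ} {q q' : ι → ℕ} (hl : l ≤ l')
    (hq : q ≤ q') : clampChain score t₁ t₂ l q ≤ clampChain score t₁ t₂ l' q' :=
  clamp_mono (greedy_mono score (by omega)) (greedy_mono score (by omega)) hq

theorem clampChain_zero (score : ι → ℕ → L) {t₁ t₂ : ℕ} (h : t₁ ≤ t₂) (q : ι → ℕ) :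
    clampChain score t₁ t₂ 0 q = greedy score t₁ := by
  simp [clampChain, h, sum_clamp_self]

theorem clampChain_last (score : ι → ℕ → L) {t₁ t₂ : ℕ} (h : t₁ ≤ t₂) (q : ι → ℕ) :
    clampChain score t₁ t₂ (2 * (t₂ - t₁)) q = greedy score t₂ := by
  have h1 : t₁ + (2 * (t₂ - t₁) - (t₂ - t₁)) = t₂ := by omega
  have h2 : min (t₁ + 2 * (t₂ - t₁)) t₂ = t₂ := by omega
  rw [clampChain, h1, h2, sum_clamp_self]

/-- Each step moves only one of the two bounds, and by a single observation. -/
theorem sum_clampChain_succ (score : ι → ℕ → L) (t₁ t₂ l : ℕ) (q : ι → ℕ) :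
    ∑ k, clampChain score t₁ t₂ (l + 1) q k ≤ ∑ k, clampChain score t₁ t₂ l q k + 1 := by
  rcases lt_or_ge l (t₂ - t₁) with h | h
  · have h1 : l + 1 - (t₂ - t₁) = l - (t₂ - t₁) := by omega
    have h2 : min (t₁ + (l + 1)) t₂ = min (t₁ + l) t₂ + 1 := by omega
    rw [← sum_add_single _ (minScore score (greedy score (min (t₁ + l) t₂)))]
    refine Finset.sum_le_sum fun k _ => ?_
    rw [clampChain, clampChain, h1, h2, greedy]
    simp only [clamp, Pi.add_apply]
    omega
  · have h1 : t₁ + (l + 1 - (t₂ - t₁)) = t₁ + (l - (t₂ - t₁)) + 1 := by omega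
    have h2 : min (t₁ + (l + 1)) t₂ = min (t₁ + l) t₂ := by omega
    rw [← sum_add_single _ (minScore score (greedy score (t₁ + (l - (t₂ - t₁)))))]
    refine Finset.sum_le_sum fun k _ => ?_
    rw [clampChain, clampChain, h1, h2, greedy]
    simp only [clamp, Pi.add_apply]
    omega

/-- The member of the chain which is a division of `r` observations. -/
def chainDivision (score : ι → ℕ → L) (t₁ t₂ r : ℕ) (q : ι → ℕ) : ι → ℕ :=
  clampChain score t₁ t₂ (sInf {l | r ≤ ∑ k, clampChain score t₁ t₂ l q k}) q

/-- Discrete intermediate values: the totals lead from `t₁` to `t₂` in increments of at most one, so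
the first total to reach `r` equals `r`. -/
theorem sum_chainDivision (score : ι → ℕ → L) {t₁ t₂ r : ℕ} (h1 : t₁ ≤ r) (h2 : r ≤ t₂)
    (q : ι → ℕ) : ∑ k, chainDivision score t₁ t₂ r q k = r := by
  unfold chainDivision
  set S := {l | r ≤ ∑ k, clampChain score t₁ t₂ l q k} with hS
  have hne : S.Nonempty := ⟨2 * (t₂ - t₁), by
    change r ≤ _; rwa [clampChain_last score (h1.trans h2), sum_greedy]⟩
  have hmem : r ≤ ∑ k, clampChain score t₁ t₂ (sInf S) q k := Nat.sInf_mem hne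
  refine le_antisymm ?_ hmem
  rcases Nat.eq_zero_or_pos (sInf S) with h0 | h0
  · rw [h0, clampChain_zero score (h1.trans h2), sum_greedy]; exact h1
  · have h3 : sInf S - 1 ∉ S := Nat.notMem_of_lt_sInf (by omega)
    have h4 := sum_clampChain_succ score t₁ t₂ (sInf S - 1) q
    rw [Nat.sub_add_cancel h0] at h4
    have h5 : ¬ r ≤ ∑ k, clampChain score t₁ t₂ (sInf S - 1) q k := h3
    omega

theorem eq_of_le_of_sum_le {p q : ι → ℕ} (h : p ≤ q) (hs : ∑ k, q k ≤ ∑ k, p k) : p = q := by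
  have h1 := Finset.sum_le_sum fun k (_ : k ∈ Finset.univ) => h k
  exact funext fun k => (Finset.sum_eq_sum_iff_of_le fun i _ => h i).1 (le_antisymm h1 hs) k
    (Finset.mem_univ k)

theorem exists_eq_add_single {p q : ι → ℕ} (h : p ≤ q) (hs : ∑ k, q k = ∑ k, p k + 1) :
    ∃ j, q = p + Pi.single j 1 := by
  have h1 : ∃ j, p j < q j := by
    by_contra! h'
    have := Finset.sum_le_sum fun k (_ : k ∈ Finset.univ) => h' k
    omega
  obtain ⟨j, hj⟩ := h1
  refine ⟨j, (eq_of_le_of_sum_le (fun k => ?_) ?_).symm⟩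
  · by_cases hk : k = j
    · subst hk; simp; omega
    · simpa [Pi.single_apply, hk] using h k
  · simp [Finset.sum_add_distrib, hs]

/-- As the totals are `r` and `r + 1`, this inclusion means that the new replacement is the old one
with one more observation: the replacement can be carried out sequentially. -/
theorem chainDivision_le (score : ι → ℕ → L) {t₁ t₂ r : ℕ} (h1 : t₁ ≤ r) (h2 : r + 1 ≤ t₂)
    (q : ι → ℕ) (k : ι) :
    chainDivision score t₁ t₂ r q ≤ chainDivision score t₁ t₂ (r + 1) (q + Pi.single k 1) := by
  have hs := sum_chainDivision score h1 (by omega : r ≤ t₂) q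
  have hs' := sum_chainDivision score (by omega : t₁ ≤ r + 1) h2 (q + Pi.single k 1)
  have hq : q ≤ q + Pi.single k 1 := fun i => by simp
  unfold chainDivision at *
  set l := sInf {l | r ≤ ∑ k, clampChain score t₁ t₂ l q k}
  set l' := sInf {l | r + 1 ≤ ∑ i, clampChain score t₁ t₂ l (q + Pi.single k 1) i}
  rcases le_total l l' with h | h
  · exact clampChain_mono score t₁ t₂ h hq
  -- Here `l' ≤ l`. Adding one observation to `q` adds at most one to its clamp at `l`, so the total
  -- there is at most `r + 1`, which is already the total at `l'`; the two clamps coincide.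
  · have h3 : clampChain score t₁ t₂ l (q + Pi.single k 1) ≤
        clampChain score t₁ t₂ l q + Pi.single k 1 := by
      intro i
      simp only [clampChain, clamp, Pi.add_apply]
      omega
    have h4 := Finset.sum_le_sum fun i (_ : i ∈ Finset.univ) => h3 i
    rw [sum_add_single, hs] at h4
    have h5 := eq_of_le_of_sum_le (clampChain_mono score t₁ t₂ h (le_refl (q + Pi.single k 1)))
      (by omega)
    rw [h5]
    exact clampChain_mono score t₁ t₂ le_rfl hq

theorem chainDivision_left (score : ι → ℕ → L) {t₁ t₂ : ℕ} (h : t₁ ≤ t₂) (q : ι → ℕ) :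
    chainDivision score t₁ t₂ t₁ q = greedy score t₁ := by
  have h1 := sum_chainDivision score le_rfl h q
  refine (eq_of_le_of_sum_le ?_ (by rw [h1, sum_greedy])).symm
  rw [← clampChain_zero score h q]
  exact clampChain_mono score t₁ t₂ (by omega) le_rfl

theorem chainDivision_right (score : ι → ℕ → L) {t₁ t₂ : ℕ} (h : t₁ ≤ t₂) (q : ι → ℕ) :
    chainDivision score t₁ t₂ t₂ q = greedy score t₂ := by
  have h1 := sum_chainDivision score h le_rfl q
  refine eq_of_le_of_sum_le ?_ (by rw [h1, sum_greedy])
  rw [← clampChain_last score h q]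
  refine clampChain_mono score t₁ t₂ (Nat.sInf_le ?_) le_rfl
  simp [clampChain_last score h, sum_greedy]

/-- If the times of `A` are good and their gaps are at most `B`, then every division can be replaced
by one which is at least as good, in such a way that successive divisions go to successive
divisions and that all divisions at times of `A` go to the greedy one. -/
theorem exists_reduction {score : ι → ℕ → L} (hmono : ∀ k, StrictMono (score k))
    (hinj : ∀ k l m m', score k m = score l m' → k = l) {f : (ι → ℕ) → ℝ} {B : ℕ} {A : Set ℕ}
    (h0 : 0 ∈ A) (hpos : ∃ t ∈ A, 0 < t) (hgood : ∀ t ∈ A, IsGoodTime score f B t)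
    (hgap : ∀ t ∈ A, t ≠ 0 → ∃ t' ∈ A, t < t' ∧ t' ≤ t + B) :
    ∃ G : ℕ → (ι → ℕ) → ι → ℕ,
      (∀ r q, ∑ k, q k = r → f (G r q) ≤ f q) ∧
      (∀ r q k, ∃ j, G (r + 1) (q + Pi.single k 1) = G r q + Pi.single j 1) ∧
      ∀ t ∈ A, ∀ q, G t q = greedy score t := by
  classical
  have hunb : ∀ r, ∃ t ∈ A, r < t := by
    intro r
    induction r with
    | zero => exact hpos
    | succ r ih =>
      obtain ⟨t, ht, hr⟩ := ih
      obtain ⟨t', ht', h1, -⟩ := hgap t ht (by omega)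
      exact ⟨t', ht', by omega⟩
  -- `t₁ r` is the last time of `A` up to `r`, and `t₂ r` the first one after `r`.
  let t₁ : ℕ → ℕ := Nat.findGreatest (· ∈ A)
  let t₂ : ℕ → ℕ := fun r => Nat.find (hunb r)
  have e1 : ∀ r, t₁ r ∈ A := fun r => Nat.findGreatest_spec (P := (· ∈ A)) (Nat.zero_le r) h0
  have e2 : ∀ r, t₁ r ≤ r := fun r => Nat.findGreatest_le r
  have e3 : ∀ r, t₂ r ∈ A := fun r => (Nat.find_spec (hunb r)).1
  have e4 : ∀ r, r < t₂ r := fun r => (Nat.find_spec (hunb r)).2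
  have e5 : ∀ r t, t ∈ A → r < t → t₂ r ≤ t := fun r t h h' => Nat.find_min' (hunb r) ⟨h, h'⟩
  have e6 : ∀ r t, t ∈ A → t ≤ r → t ≤ t₁ r := fun r t h h' => Nat.le_findGreatest h' h
  have hA : ∀ t ∈ A, ∀ q, chainDivision score (t₁ t) (t₂ t) t q = greedy score t := by
    intro t ht q
    have : t₁ t = t := le_antisymm (e2 t) (e6 t t ht le_rfl)
    conv_lhs => rw [this]
    exact chainDivision_left score (e4 t).le q
  refine ⟨fun r q => chainDivision score (t₁ r) (t₂ r) r q, ?_, ?_, hA⟩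
  · intro r q hq
    have hle : t₁ r ≤ t₂ r := (e2 r).trans (e4 r).le
    have hs := sum_chainDivision score (e2 r) (e4 r).le q
    simp only [chainDivision] at hs ⊢
    set l := sInf {l | r ≤ ∑ k, clampChain score (t₁ r) (t₂ r) l q k}
    simp only [clampChain] at hs ⊢
    rcases Nat.lt_or_ge (2 * (t₂ r - t₁ r)) l with hl | hl
    · exfalso
      have := Nat.notMem_of_lt_sInf hl
      refine this (?_ : r ≤ _)
      rw [clampChain_last score hle, sum_greedy]
      exact (e4 r).le
    refine (clamp_le hmono hinj (by omega) ?_ q hq hs).1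
    intro p i h1 h2 h3
    -- In the first phase of the chain the lower bound belongs to `t₁ r`, and goodness of `t₁ r`
    -- applies because fewer than `t₁ r + B` observations are involved. In the second phase the
    -- upper bound belongs to `t₂ r`, and goodness of `t₂ r` applies.
    rcases le_total l (t₂ r - t₁ r) with hl' | hl'
    · have h5 : t₁ r + (l - (t₂ r - t₁ r)) = t₁ r := by omega
      rw [h5] at h3
      refine hgood _ (e1 r) p i ?_ ((greedy_mono score (by omega) i).trans h2) h3
      -- The gap after time `0` may be large, but there the lower bound is zero and no source falls
      -- short of it.
      have h6 : t₁ r ≠ 0 := by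
        intro h; rw [h] at h3; simp [greedy] at h3
      obtain ⟨t', ht', h7, h8⟩ := hgap _ (e1 r) h6
      have : r < t' := by
        by_contra! h9
        have := e6 r t' ht' h9
        omega
      omega
    · have h5 : min (t₁ r + l) (t₂ r) = t₂ r := by omega
      rw [h5] at h2
      have := e4 r
      exact hgood _ (e3 r) p i (by omega) h2 (h3.trans_le (greedy_mono score (by omega) _))
  · intro r q k
    -- If `r + 1` is in `A`, the interval ending there and the interval starting there both give the
    -- greedy division.
    have key : chainDivision score (t₁ (r + 1)) (t₂ (r + 1)) (r + 1) (q + Pi.single k 1) =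
        chainDivision score (t₁ r) (t₂ r) (r + 1) (q + Pi.single k 1) := by
      by_cases h : r + 1 ∈ A
      · have h1 : t₂ r = r + 1 := le_antisymm (e5 r _ h (by omega)) (e4 r)
        rw [hA _ h, h1, chainDivision_right score (by have := e2 r; omega)]
      · have h1 : t₁ (r + 1) = t₁ r := by
          have := e2 (r + 1)
          have h3 : t₁ (r + 1) ≠ r + 1 := fun h4 => h (h4 ▸ e1 (r + 1))
          exact le_antisymm (e6 r _ (e1 _) (by omega)) (e6 _ _ (e1 r) (by have := e2 r; omega))
        have h2 : t₂ (r + 1) = t₂ r := by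
          have := e4 r
          have h3 : t₂ r ≠ r + 1 := fun h4 => h (h4 ▸ e3 r)
          exact le_antisymm (e5 _ _ (e3 r) (by omega)) (e5 _ _ (e3 _) (by have := e4 (r + 1); omega))
        rw [h1, h2]
    simp only [key]
    refine exists_eq_add_single (chainDivision_le score (e2 r) (e4 r) q k) ?_
    rw [sum_chainDivision score (e2 r) (e4 r).le,
      sum_chainDivision score ((e2 r).trans (by omega)) (e4 r)]

end Combinatorics

/-! ### Natural density of sets with sparse complement. -/

section Density

/-- Distinct elements of `S` are more than `Q` apart. -/
def IsSeparatedBy (Q : ℕ) (S : Set ℕ) : Prop := ∀ s ∈ S, ∀ s' ∈ S, s < s' → s + Q < s'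

/-- A block of `Q + 1` consecutive integers contains at most one element. -/
theorem IsSeparatedBy.ncard_le {Q : ℕ} {S : Set ℕ} (h : IsSeparatedBy Q S) (N : ℕ) :
    (S ∩ Set.Icc 1 N).ncard ≤ N / (Q + 1) + 1 := by
  have h1 : ((Finset.range (N / (Q + 1) + 1) : Finset ℕ) : Set ℕ).ncard = N / (Q + 1) + 1 := by
    rw [Set.ncard_coe_finset, Finset.card_range]
  rw [← h1]
  refine Set.ncard_le_ncard_of_injOn (fun s => s / (Q + 1)) ?_ ?_ (Finset.finite_toSet _)
  · rintro s ⟨-, hs⟩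
    simp only [Finset.coe_range, Set.mem_Iio]
    exact Nat.lt_succ_of_le (Nat.div_le_div_right hs.2)
  · have key : ∀ s ∈ S, ∀ s' ∈ S, s < s' → s / (Q + 1) ≠ s' / (Q + 1) := by
      intro s hs s' hs' hlt heq
      have h2 := h s hs s' hs' hlt
      have h3 := Nat.div_add_mod s (Q + 1)
      have h4 := Nat.div_add_mod s' (Q + 1)
      have h5 := Nat.mod_lt s' (by omega : Q + 1 > 0)
      rw [heq] at h3
      omega
    rintro s ⟨hs, -⟩ s' ⟨hs', -⟩ heq
    rcases lt_trichotomy s s' with h2 | h2 | h2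
    · exact absurd heq (key s hs s' hs' h2)
    · exact h2
    · exact absurd heq.symm (key s' hs' s hs h2)

variable {ι : Type*} [Fintype ι]

/-- A set of times has density one if, for every `Q`, its late complement is covered by a bounded
number of sets with gaps larger than `Q`. -/
theorem hasNaturalDensity_one_of_cover {A : Set ℕ}
    (h : ∀ Q : ℕ, ∃ (T : ℕ) (S : ι → Set ℕ), (∀ i, IsSeparatedBy Q (S i)) ∧
      ∀ t, T ≤ t → t ∉ A → ∃ i, t ∈ S i) : HasNaturalDensity A 1 := by
  unfold HasNaturalDensity
  set c := Fintype.card ι with hc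
  have hcard : ∀ N : ℕ, (A ∩ Set.Icc 1 N).ncard + (Set.Icc 1 N \ A).ncard = N := by
    intro N
    have h1 := Set.ncard_inter_add_ncard_sdiff_eq_ncard (Set.Icc 1 N) A (Set.finite_Icc 1 N)
    rw [Set.inter_comm] at h1
    rw [h1, ← Finset.coe_Icc, Set.ncard_coe_finset]; simp
  rw [Metric.tendsto_atTop]
  intro ε hε
  -- The choice of `Q` bounds the contribution `c * N / (Q + 1)` of the separated sets by `ε * N /
  -- 2`; the choice of `N₀` does the same for the constant `T + c`.
  obtain ⟨Q, hQ⟩ := exists_nat_gt (2 * (c : ℝ) / ε)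
  obtain ⟨T, S, hS, hcov⟩ := h Q
  obtain ⟨N₀, hN₀⟩ := exists_nat_gt (2 * ((T : ℝ) + c) / ε)
  refine ⟨N₀ + 1, fun N hN => ?_⟩
  have hNpos : (0 : ℝ) < N := by
    have : 0 < N := by omega
    exact_mod_cast this
  have h1 : (Set.Icc 1 N \ A).ncard ≤ T + c * (N / (Q + 1) + 1) := by
    have hsub : Set.Icc 1 N \ A ⊆ (Finset.range T : Set ℕ) ∪ ⋃ i, (S i ∩ Set.Icc 1 N) := by
      rintro t ⟨ht, htA⟩
      rcases lt_or_ge t T with h2 | h2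
      · left; simpa using h2
      · right
        obtain ⟨i, hi⟩ := hcov t h2 htA
        exact Set.mem_iUnion.2 ⟨i, hi, ht⟩
    have hfin : ∀ i, (S i ∩ Set.Icc 1 N).Finite := fun i => (Set.finite_Icc 1 N).inter_of_right _
    refine (Set.ncard_le_ncard hsub
      ((Finset.finite_toSet _).union (Set.finite_iUnion hfin))).trans ?_
    refine (Set.ncard_union_le _ _).trans ?_
    rw [Set.ncard_coe_finset, Finset.card_range]
    gcongr
    calc (⋃ i, (S i ∩ Set.Icc 1 N)).ncard ≤ ∑ i, (S i ∩ Set.Icc 1 N).ncard :=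
          Set.ncard_iUnion_le_of_fintype _
      _ ≤ ∑ _i : ι, (N / (Q + 1) + 1) := Finset.sum_le_sum fun i _ => (hS i).ncard_le N
      _ = c * (N / (Q + 1) + 1) := by simp [hc]
  have h2 : ((Set.Icc 1 N \ A).ncard : ℝ) ≤ T + c * (N / (Q + 1) + 1) := by
    calc ((Set.Icc 1 N \ A).ncard : ℝ) ≤ ((T + c * (N / (Q + 1) + 1) : ℕ) : ℝ) := by
          exact_mod_cast h1
      _ ≤ T + c * (N / (Q + 1) + 1) := by
          push_cast
          have : ((N / (Q + 1) : ℕ) : ℝ) ≤ (N : ℝ) / (Q + 1) := by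
            have := Nat.cast_div_le (α := ℝ) (m := N) (n := Q + 1)
            push_cast at this; exact this
          gcongr
  have h3 : ((A ∩ Set.Icc 1 N).ncard : ℝ) + ((Set.Icc 1 N \ A).ncard : ℝ) = N := by
    exact_mod_cast hcard N
  have h4 : ((A ∩ Set.Icc 1 N).ncard : ℝ) / N - 1 = -(((Set.Icc 1 N \ A).ncard : ℝ) / N) := by
    field_simp; linarith
  rw [Real.dist_eq, h4, abs_neg, abs_of_nonneg (by positivity), div_lt_iff₀ hNpos]
  have hQ' : 2 * (c : ℝ) < ε * (Q + 1) := by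
    rw [div_lt_iff₀ hε] at hQ; nlinarith
  have hN₀' : 2 * ((T : ℝ) + c) < ε * N := by
    rw [div_lt_iff₀ hε] at hN₀
    have : (N₀ : ℝ) ≤ N := by exact_mod_cast (by omega : N₀ ≤ N)
    nlinarith
  have h5 : (c : ℝ) * (N / (Q + 1)) ≤ ε * N / 2 := by
    have hQ1 : (0 : ℝ) < (Q : ℝ) + 1 := by positivity
    rw [mul_div_assoc', div_le_iff₀ hQ1]
    nlinarith
  nlinarith

/-- If the late complement of `A` is covered by `Q` sets with gaps larger than `Q`, then `A`
has late gaps at most `Q + 1`. -/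
theorem exists_mem_of_cover {A : Set ℕ} {T : ℕ} {S : ι → Set ℕ}
    (hS : ∀ i, IsSeparatedBy (Fintype.card ι) (S i)) (hcov : ∀ t, T ≤ t → t ∉ A → ∃ i, t ∈ S i)
    {t : ℕ} (ht : T ≤ t) : ∃ t' ∈ A, t < t' ∧ t' ≤ t + (Fintype.card ι + 1) := by
  by_contra! hcon
  have h1 : ∀ t' ∈ Finset.Icc (t + 1) (t + (Fintype.card ι + 1)), ∃ i, t' ∈ S i := by
    intro t' ht'
    rw [Finset.mem_Icc] at ht'
    refine hcov t' (by omega) fun h => ?_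
    have := hcon t' h (by omega)
    omega
  have : Nonempty ι := ⟨(h1 (t + 1) (by simp)).choose⟩
  choose! g hg using h1
  -- Of `card ι + 1` consecutive times outside `A`, two would lie in the same set, at distance at
  -- most `card ι`.
  obtain ⟨x, hx, y, hy, hne, hxy⟩ := Finset.exists_ne_map_eq_of_card_lt_of_maps_to
    (s := Finset.Icc (t + 1) (t + (Fintype.card ι + 1))) (t := Finset.univ) (f := g)
    (by simp) (fun _ _ => Finset.mem_univ _)
  have hx' := hg x hx
  have hy' := hg y hy
  rw [← hxy] at hy'
  rw [Finset.mem_Icc] at hx hy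
  rcases lt_or_gt_of_ne hne with h | h
  · have := hS _ x hx' y hy' h; omega
  · have := hS _ y hy' x hx' h; omega

end Density

/-! ### Ranks of observations, and the times at which they have a gap. -/

section Scores

variable {ι : Type*} [Fintype ι] [LinearOrder ι] [Nonempty ι]

/-- The rank of observation number `m` of source `k`, for sources of frequencies `a` and
offsets `b`. -/
def obsRank (a b : ι → ℝ) (k : ι) (m : ℕ) : ℝ := (m + b k) / a k

/-- Ranks with ties broken by the order of the sources. -/
def lexRank (a b : ι → ℝ) (k : ι) (m : ℕ) : ℝ ×ₗ ι := toLex (obsRank a b k m, k)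

theorem obsRank_le_of_lexRank_le {a b : ι → ℝ} {k l : ι} {m m' : ℕ}
    (h : lexRank a b k m ≤ lexRank a b l m') : obsRank a b k m ≤ obsRank a b l m' := by
  rw [lexRank, lexRank, Prod.Lex.toLex_le_toLex] at h
  rcases h with h | h
  · exact h.le
  · exact h.1.le

theorem lexRank_injective (a b : ι → ℝ) (k l : ι) (m m' : ℕ)
    (h : lexRank a b k m = lexRank a b l m') : k = l :=
  congrArg (fun x => (ofLex x).2) h

variable {a b : ι → ℝ}

theorem obsRank_strictMono (ha : ∀ k, 0 < a k) (k : ι) : StrictMono (obsRank a b k) :=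
    fun m m' h => by
  unfold obsRank
  have : (m : ℝ) < m' := by exact_mod_cast h
  have := ha k
  gcongr

theorem lexRank_strictMono (ha : ∀ k, 0 < a k) (k : ι) : StrictMono (lexRank a b k) :=
    fun m m' h => by
  rw [lexRank, lexRank, Prod.Lex.toLex_lt_toLex]
  exact Or.inl (obsRank_strictMono ha k h)

/-- At time `t`, the observations of the greedy division precede all others by at least `ε`. -/
def HasGap (a b : ι → ℝ) (ε : ℝ) (t : ℕ) : Prop :=
  ∀ (k l : ι) (m m' : ℕ), greedy (lexRank a b) t k ≤ m → m' < greedy (lexRank a b) t l →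
    obsRank a b l m' + ε ≤ obsRank a b k m

theorem greedy_add_le {L : Type*} [LinearOrder L] (score : ι → ℕ → L) (s d : ℕ) (k : ι) :
    greedy score (s + d) k ≤ greedy score s k + d := by
  induction d with
  | zero => simp
  | succ d ih =>
    rw [← add_assoc, greedy, Pi.add_apply]
    have : (Pi.single (minScore score (greedy score (s + d))) 1 : ι → ℕ) k ≤ 1 := by
      rw [Pi.single_apply]; split_ifs <;> omega
    omega

/-- When observation `m` of `l` was chosen, its score was at most the next score of `k`, and next
scores never fall. -/
theorem score_le_of_lt_greedy {L : Type*} [LinearOrder L] {score : ι → ℕ → L}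
    (hmono : ∀ k, StrictMono (score k)) {s m : ℕ} {l : ι} (h : m < greedy score s l) (k : ι) :
    score l m ≤ score k (greedy score s k) := by
  obtain ⟨s', h1, h2, h3⟩ := exists_greedy_eq score h
  have h4 := minScore_le score (greedy score s') k
  rw [h3, h2] at h4
  exact h4.trans ((hmono k).monotone (greedy_mono score h1.le k))

/-- If the frequency ratios are irrational, then the times without a gap are covered by boundedly
many sets with large gaps. -/
theorem exists_gap_cover (ha : ∀ k, 0 < a k) (hirr : ∀ i j, i ≠ j → Irrational (a i / a j))
    (Q : ℕ) : ∃ ε > 0, ∃ S : ι × ι → Set ℕ, (∀ i, IsSeparatedBy Q (S i)) ∧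
      ∀ t, 1 ≤ t → ¬ HasGap a b ε t → ∃ i, t ∈ S i := by
  -- An irrational number has a positive distance from all fractions of denominator at most `Q`.
  have h1 : ∀ᶠ ε : ℝ in 𝓝[>] 0, ∀ i j, i ≠ j → ∀ h ≤ Q, ∀ g : ℤ,
      ε * a i ≤ dist (a i / a j) (g / h) := by
    refine nhdsWithin_le_nhds ?_
    refine eventually_all.2 fun i => eventually_all.2 fun j => ?_
    by_cases hij : i = j
    · simp [hij]
    have h2 := (hirr i j hij).eventually_forall_le_dist_cast_div_of_denom_le Q
    have h3 : Tendsto (fun ε : ℝ => ε * a i) (𝓝 0) (𝓝 0) := by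
      have : Continuous fun ε : ℝ => ε * a i := by fun_prop
      simpa using this.tendsto 0
    exact (h3.eventually h2).mono fun ε h _ => h
  -- Ranks of one source are at least `1 / a i` apart, so ranks closer than `ε` belong to different
  -- sources.
  have h2 : ∀ᶠ ε : ℝ in 𝓝[>] 0, ∀ i, ε < 1 / a i :=
    eventually_all.2 fun i => nhdsWithin_le_nhds (eventually_lt_nhds (by have := ha i; positivity))
  obtain ⟨ε, hε1, hε2, hε⟩ := (h1.and (h2.and self_mem_nhdsWithin)).exists
  replace hε : 0 < ε := hε
  have hmono := lexRank_strictMono (b := b) ha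
  set N := greedy (lexRank a b) with hN
  -- The set of the pair `(k, l)`: the observation just added is of `l`, and the next rank of `k` is
  -- less than `ε` above it.
  refine ⟨ε, hε, fun p => {t | ∃ s, t = s + 1 ∧ p.1 ≠ p.2 ∧ minScore (lexRank a b) (N s) = p.2 ∧
    obsRank a b p.2 (N s p.2) ≤ obsRank a b p.1 (N t p.1) ∧
    obsRank a b p.1 (N t p.1) < obsRank a b p.2 (N s p.2) + ε}, ?_, ?_⟩
  · rintro ⟨k, l⟩ _ ⟨s, rfl, hkl, hs1, hs2, hs3⟩ _ ⟨s', rfl, -, -, hs2', hs3'⟩ hlt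
    simp only at *
    by_contra! hle
    obtain ⟨h, hh⟩ : ∃ h, N s' l = N s l + h :=
      Nat.exists_eq_add_of_le (greedy_mono _ (by omega) l)
    obtain ⟨g, hg⟩ : ∃ g, N (s' + 1) k = N (s + 1) k + g :=
      Nat.exists_eq_add_of_le (greedy_mono _ (by omega) k)
    have hpos : 0 < h := by
      have h3 : N (s + 1) l ≤ N s' l := greedy_mono _ (by omega) l
      have h4 : N (s + 1) l = N s l + 1 := by
        rw [hN, greedy, ← hN, hs1]; simp
      omega
    have hhQ : h ≤ Q := by
      have h3 := greedy_add_le (lexRank a b) s (s' - s) l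
      rw [← hN, Nat.add_sub_cancel' (by omega : s ≤ s')] at h3
      omega
    have h5 := hε1 k l hkl h hhQ g
    have hk := ha k
    have hl := ha l
    have hposR : (1 : ℝ) ≤ h := by exact_mod_cast hpos
    rw [hh] at hs2' hs3'
    rw [hg] at hs2' hs3'
    unfold obsRank at hs2 hs3 hs2' hs3'
    -- Between the two times `k` gains `g` and `l` gains `h ≤ Q` observations. The difference of the
    -- two near coincidences puts `g / h` too close to `a k / a l`.
    have e1 : |(g : ℝ) / a k - h / a l| < ε := by
      have e2 : ((N (s + 1) k + g : ℕ) + b k : ℝ) / a k = (N (s + 1) k + b k) / a k + g / a k := by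
        push_cast; ring
      have e3 : ((N s l + h : ℕ) + b l : ℝ) / a l = (N s l + b l) / a l + h / a l := by
        push_cast; ring
      rw [e2, e3] at hs2' hs3'
      rw [abs_lt]; constructor <;> linarith
    have e4 : dist (a k / a l) ((g : ℤ) / (h : ℕ)) = |(g : ℝ) / a k - h / a l| * (a k / h) := by
      rw [Real.dist_eq, abs_sub_comm, Int.cast_natCast]
      conv_rhs => rw [← abs_of_pos (show 0 < a k / h by positivity), ← abs_mul]
      congr 1
      field_simp
    rw [e4] at h5
    have e5 : |(g : ℝ) / a k - h / a l| * (a k / h) < ε * (a k / h) := by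
      have : 0 < a k / h := by positivity
      gcongr
    have e6 : a k / h ≤ a k := div_le_self hk.le hposR
    nlinarith
  · intro t ht hgap
    obtain ⟨s, rfl⟩ := Nat.exists_eq_add_of_le' ht
    unfold HasGap at hgap
    push Not at hgap
    obtain ⟨k, l, m, m', h3, h4, h5⟩ := hgap
    set j := minScore (lexRank a b) (N s) with hj
    have hN1 : N (s + 1) = N s + Pi.single j 1 := rfl
    -- The observation added last has the greatest rank in the division, so a failure of the gap can
    -- be located there.
    have h6 : obsRank a b l m' ≤ obsRank a b j (N s j) := by
      by_cases h7 : m' < N s l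
      · exact obsRank_le_of_lexRank_le (score_le_of_lt_greedy hmono h7 j)
      · rw [← hN, hN1] at h4
        have hlj : l = j := by
          by_contra hne
          rw [Pi.add_apply, Pi.single_eq_of_ne hne] at h4
          omega
        subst hlj
        rw [Pi.add_apply, Pi.single_eq_same] at h4
        rw [show m' = N s j by omega]
    have h7 : obsRank a b k (N (s + 1) k) ≤ obsRank a b k m := (obsRank_strictMono ha k).monotone h3
    refine ⟨(k, j), s, rfl, ?_, rfl, ?_, by linarith⟩
    · intro hkj
      change k = j at hkj
      rw [hkj] at h7 h5
      rw [hN1, Pi.add_apply, Pi.single_eq_same] at h7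
      have h8 := hε2 j
      have h9 : obsRank a b j (N s j + 1) = obsRank a b j (N s j) + 1 / a j := by
        unfold obsRank; push_cast; ring
      linarith
    · exact (obsRank_le_of_lexRank_le (minScore_le _ (N s) k)).trans
        ((obsRank_strictMono ha k).monotone (greedy_mono _ (by omega) k))

end Scores

/-! ### Posterior covariance matrices and their rank-one updates. -/

namespace Environment

open Matrix

variable {K : ℕ} (E : Environment K)

/-- The posterior precision matrix after `q k` observations of each source `k`. -/
def precision (q : Fin K → ℕ) : Matrix (Fin K) (Fin K) ℝ :=
  E.V⁻¹ + E.Cᵀ * diagonal (fun k => (q k : ℝ) / E.σ k ^ 2) * E.C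

/-- The posterior covariance matrix after `q k` observations of each source `k`. -/
def postCov (q : Fin K → ℕ) : Matrix (Fin K) (Fin K) ℝ := (E.precision q)⁻¹

theorem posDef_precision (q : Fin K → ℕ) : (E.precision q).PosDef := by
  refine E.posDef_V.inv.add_posSemidef ?_
  have h : (diagonal (fun k => (q k : ℝ) / E.σ k ^ 2)).PosSemidef :=
    PosSemidef.diagonal fun k => by positivity
  simpa using h.conjTranspose_mul_mul_same E.C

theorem posDef_postCov (q : Fin K → ℕ) : (E.postCov q).PosDef := (E.posDef_precision q).inv

theorem isUnit_det_precision (q : Fin K → ℕ) : IsUnit (E.precision q).det :=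
  (E.posDef_precision q).det_pos.ne'.isUnit

theorem precision_mul_postCov (q : Fin K → ℕ) : E.precision q * E.postCov q = 1 :=
  mul_nonsing_inv _ (E.isUnit_det_precision q)

theorem transpose_postCov (q : Fin K → ℕ) : (E.postCov q)ᵀ = E.postCov q := by
  simpa using (E.posDef_postCov q).isHermitian.eq

theorem transpose_V : E.Vᵀ = E.V := by
  simpa using E.posDef_V.isHermitian.eq

theorem V_mul_inv : E.V * E.V⁻¹ = 1 := mul_nonsing_inv _ E.posDef_V.det_pos.ne'.isUnit

theorem postCov_zero : E.postCov 0 = E.V := by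
  have : E.precision 0 = E.V⁻¹ := by
    simp [precision]
  rw [postCov, this, nonsing_inv_nonsing_inv _ E.posDef_V.det_pos.ne'.isUnit]

/-- The posterior variance of the noiseless signal of source `j` along the vector `E.C j`. -/
def signalVar (q : Fin K → ℕ) (j : Fin K) : ℝ := E.C j ⬝ᵥ E.postCov q *ᵥ E.C j

theorem signalVar_nonneg (q : Fin K → ℕ) (j : Fin K) : 0 ≤ E.signalVar q j := by
  simpa [signalVar] using (E.posDef_postCov q).posSemidef.dotProduct_mulVec_nonneg (E.C j)

/-- The variance of the next observation of source `j`. -/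
def obsVar (q : Fin K → ℕ) (j : Fin K) : ℝ := E.σ j ^ 2 + E.signalVar q j

theorem obsVar_pos (q : Fin K → ℕ) (j : Fin K) : 0 < E.obsVar q j :=
  add_pos_of_pos_of_nonneg (pow_pos (E.σ_pos j) 2) (E.signalVar_nonneg q j)

theorem precision_add_single (q : Fin K → ℕ) (j : Fin K) :
    E.precision (q + Pi.single j 1) =
      E.precision q + (1 / E.σ j ^ 2) • vecMulVec (E.C j) (E.C j) := by
  unfold precision
  rw [add_assoc]
  congr 1
  ext a b
  rw [Matrix.add_apply, mul_apply, mul_apply, Matrix.smul_apply, vecMulVec_apply]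
  simp only [mul_diagonal, transpose_apply, Pi.add_apply, Nat.cast_add, add_div, mul_add, add_mul,
    Finset.sum_add_distrib, smul_eq_mul]
  congr 1
  rw [Finset.sum_eq_single j]
  · rw [Pi.single_eq_same, Nat.cast_one]; ring
  · intro k _ hk; simp [hk]
  · simp

/-- The update of the posterior covariance matrix. -/
theorem postCov_add_single (q : Fin K → ℕ) (j : Fin K) :
    E.postCov (q + Pi.single j 1) = E.postCov q - (1 / E.obsVar q j) •
      vecMulVec (E.postCov q *ᵥ E.C j) (E.postCov q *ᵥ E.C j) := by
  have hσ := (pow_pos (E.σ_pos j) 2).ne'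
  have hS := (E.obsVar_pos q j).ne'
  conv_lhs => rw [postCov]
  refine inv_eq_right_inv ?_
  rw [precision_add_single, mul_sub, add_mul, add_mul, E.precision_mul_postCov]
  set S := E.postCov q with hS'
  set c := E.C j with hc
  have h1 : E.precision q * vecMulVec (S *ᵥ c) (S *ᵥ c) = vecMulVec c (S *ᵥ c) := by
    rw [mul_vecMulVec, mulVec_mulVec, E.precision_mul_postCov, one_mulVec]
  have h2 : vecMulVec c c * S = vecMulVec c (S *ᵥ c) := by
    rw [vecMulVec_mul, ← mulVec_transpose, E.transpose_postCov]
  have h3 : vecMulVec c c * vecMulVec (S *ᵥ c) (S *ᵥ c) =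
      E.signalVar q j • vecMulVec c (S *ᵥ c) := by
    rw [vecMulVec_mul_vecMulVec]; simp [signalVar, ← hc, ← hS']
  rw [mul_smul_comm, mul_smul_comm, smul_mul_assoc, smul_mul_assoc, h1, h2, h3]
  have h4 : (1 / E.σ j ^ 2) - (1 / E.obsVar q j +
      1 / E.obsVar q j * (1 / E.σ j ^ 2 * E.signalVar q j)) = 0 := by
    have : E.signalVar q j = E.obsVar q j - E.σ j ^ 2 := by unfold obsVar; ring
    rw [this]
    set s := E.σ j ^ 2
    field_simp
    ring
  simp only [smul_smul]
  rw [add_sub_assoc, ← add_smul, ← sub_smul, h4, zero_smul, add_zero]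

variable [NeZero K]

/-- The covariance of the payoff-relevant state with the signal of source `j`. -/
def loading (q : Fin K → ℕ) (j : Fin K) : ℝ := (E.postCov q *ᵥ E.C j) 0

theorem postCov_add_single_zero (q : Fin K → ℕ) (j : Fin K) :
    E.postCov (q + Pi.single j 1) 0 0 =
      E.postCov q 0 0 - E.loading q j ^ 2 / E.obsVar q j := by
  rw [postCov_add_single]
  simp only [Matrix.sub_apply, Matrix.smul_apply, vecMulVec_apply, smul_eq_mul, loading]
  ring

/-- The first row of `C⁻¹`. -/
def coef (k : Fin K) : ℝ := E.C⁻¹ 0 k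

/-- The prior precision in the coordinates of the signals. -/
def signalPrecision : Matrix (Fin K) (Fin K) ℝ := E.C⁻¹ᵀ * E.V⁻¹ * E.C⁻¹

theorem posSemidef_signalPrecision : E.signalPrecision.PosSemidef := by
  simpa [signalPrecision] using E.posDef_V.inv.posSemidef.conjTranspose_mul_mul_same E.C⁻¹

/-- This is `precision * postCov = 1` in the coordinates of the signals, in which observations
contribute a diagonal matrix. The first column gives `loading_equation`, and multiplication by `Cᵀ`
gives `signalCov_equation`. -/
theorem signal_equation (hC : IsUnit E.C) (q : Fin K → ℕ) :
    (diagonal (fun k => (q k : ℝ) / E.σ k ^ 2) + E.signalPrecision) * (E.C * E.postCov q) =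
      E.C⁻¹ᵀ := by
  have hdet : IsUnit E.C.det := (isUnit_iff_isUnit_det _).1 hC
  have h1 : E.C⁻¹ * E.C = 1 := nonsing_inv_mul _ hdet
  have h2 : E.C⁻¹ᵀ * E.Cᵀ = 1 := by rw [← transpose_mul, mul_nonsing_inv _ hdet, transpose_one]
  have h3 : (diagonal (fun k => (q k : ℝ) / E.σ k ^ 2) + E.signalPrecision) * E.C =
      E.C⁻¹ᵀ * E.precision q := by
    rw [precision, signalPrecision, add_mul, mul_add, Matrix.mul_assoc _ E.C⁻¹, h1, Matrix.mul_one,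
      ← Matrix.mul_assoc, ← Matrix.mul_assoc, h2, Matrix.one_mul, add_comm]
  rw [← Matrix.mul_assoc, h3, Matrix.mul_assoc, E.precision_mul_postCov, Matrix.mul_one]

/-- The loadings solve a linear system. -/
theorem loading_equation (hC : IsUnit E.C) (q : Fin K → ℕ) (k : Fin K) :
    (q k : ℝ) / E.σ k ^ 2 * E.loading q k +
      (E.signalPrecision *ᵥ E.loading q) k = E.coef k := by
  have h := congrFun (congrFun (E.signal_equation hC q) k) 0
  have hl : E.loading q = fun k => (E.C * E.postCov q) k 0 := by
    ext k
    rw [loading, mul_apply, mulVec, dotProduct]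
    refine Finset.sum_congr rfl fun i _ => ?_
    rw [mul_comm, ← E.transpose_postCov q, transpose_apply, E.transpose_postCov]
  rw [Matrix.add_mul, Matrix.add_apply, diagonal_mul] at h
  rw [hl, coef]
  exact h

/-- The posterior covariances of the signals. -/
def signalCov (q : Fin K → ℕ) (j k : Fin K) : ℝ := (E.C * E.postCov q * E.Cᵀ) k j

theorem signalCov_self (q : Fin K → ℕ) (j : Fin K) : E.signalCov q j j = E.signalVar q j := by
  simp only [signalCov, signalVar, mul_apply, dotProduct, mulVec, transpose_apply,
    Finset.sum_mul, Finset.mul_sum]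
  rw [Finset.sum_comm]
  exact Finset.sum_congr rfl fun i _ => Finset.sum_congr rfl fun l _ => by ring

theorem signalCov_equation (hC : IsUnit E.C) (q : Fin K → ℕ) (j k : Fin K) :
    (q k : ℝ) / E.σ k ^ 2 * E.signalCov q j k +
      (E.signalPrecision *ᵥ E.signalCov q j) k = if k = j then 1 else 0 := by
  have hdet : IsUnit E.C.det := (isUnit_iff_isUnit_det _).1 hC
  have h2 : E.C⁻¹ᵀ * E.Cᵀ = 1 := by rw [← transpose_mul, mul_nonsing_inv _ hdet, transpose_one]
  have h : _ * (E.C * E.postCov q) * E.Cᵀ = E.C⁻¹ᵀ * E.Cᵀ :=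
    congrArg (· * E.Cᵀ) (E.signal_equation hC q)
  rw [h2, Matrix.mul_assoc] at h
  have h := congrFun (congrFun h k) j
  rw [Matrix.add_mul, Matrix.add_apply, diagonal_mul, Matrix.one_apply] at h
  exact h

theorem postCov_zero_zero_eq (hC : IsUnit E.C) (q : Fin K → ℕ) :
    E.postCov q 0 0 = ∑ k, E.coef k * E.loading q k := by
  have hdet : IsUnit E.C.det := (isUnit_iff_isUnit_det _).1 hC
  have h : E.postCov q = E.C⁻¹ * (E.C * E.postCov q) := by
    rw [← Matrix.mul_assoc, nonsing_inv_mul _ hdet, Matrix.one_mul]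
  have h := congrFun (congrFun h 0) 0
  rw [mul_apply] at h
  rw [h]
  refine Finset.sum_congr rfl fun k _ => ?_
  rw [coef, loading, mul_apply, mulVec, dotProduct]
  congr 1
  refine Finset.sum_congr rfl fun i _ => ?_
  rw [mul_comm]
  congr 1
  rw [← E.transpose_postCov q, transpose_apply, E.transpose_postCov]

end Environment

/-! ### Gaussian computation of the posterior variance. -/

namespace Environment

open Matrix

variable {K : ℕ} (E : Environment K)

section LinearForms

variable {I : Type*} [Fintype I] [DecidableEq I] {g : I → Fin K × ℕ}

/-- A linear form in the state vector and finitely many errors. -/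
def linForm (g : I → Fin K × ℕ) (u : Fin K → ℝ) (η : I → ℝ) (ω : Sample K) : ℝ :=
  ∑ i, u i * ω.1 i + ∑ p, η p * ω.2 (g p)

/-- Finitely many observations involve finitely many errors; forgetting the others leaves a
finite-dimensional Gaussian law. -/
theorem hasLaw_state_errors (μ : EuclideanSpace ℝ (Fin K)) (hg : Function.Injective g) :
    (E.law μ).map (fun ω => (ω.1, fun p => ω.2 (g p))) =
      (multivariateGaussian μ E.V).prod
        (Measure.pi fun p => gaussianReal 0 (Real.toNNReal (E.σ (g p).1 ^ 2))) := by
  rw [← Measure.infinitePi_eq_pi,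
    ← Measure.map_infinitePi_infinitePi_of_inj (P := fun p : Fin K × ℕ =>
      gaussianReal 0 (Real.toNNReal (E.σ p.1 ^ 2))) hg]
  conv_rhs => rw [← Measure.map_id (μ := multivariateGaussian μ E.V)]
  rw [Measure.map_prod_map _ _ measurable_id (by fun_prop)]
  rfl

theorem hasGaussianLaw_state_errors (μ : EuclideanSpace ℝ (Fin K)) (hg : Function.Injective g) :
    HasGaussianLaw (fun ω : Sample K => (ω.1, fun p => ω.2 (g p))) (E.law μ) where
  isGaussian_map := by
    rw [E.hasLaw_state_errors μ hg]
    have h := (iIndepFun_pi (μ := fun p : I => gaussianReal 0 (Real.toNNReal (E.σ (g p).1 ^ 2)))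
      (X := fun _ x => x) (fun _ => aemeasurable_id)).hasGaussianLaw fun p => ?_
    · have h' := h.isGaussian_map
      rw [Measure.map_id'] at h'
      infer_instance
    · constructor
      rw [Measure.pi_map_eval]
      simp only [measure_univ, Finset.prod_const_one, one_smul]
      infer_instance

theorem hasGaussianLaw_errors (μ : EuclideanSpace ℝ (Fin K)) (p : Fin K × ℕ) :
    HasGaussianLaw (fun ω : Sample K => ω.2 p) (E.law μ) :=
  ((E.hasGaussianLaw_state_errors μ (g := fun _ : Unit => p)
    (Function.injective_of_subsingleton _)).snd).eval ()

theorem hasGaussianLaw_state (μ : EuclideanSpace ℝ (Fin K)) (i : Fin K) :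
    HasGaussianLaw (fun ω : Sample K => ω.1 i) (E.law μ) :=
  ((E.hasGaussianLaw_state_errors μ (g := fun _ : Empty => (i, 0))
    (Function.injective_of_subsingleton _)).fst).map_fun (EuclideanSpace.proj i)

theorem covariance_state (μ : EuclideanSpace ℝ (Fin K)) (i j : Fin K) :
    cov[fun ω : Sample K => ω.1 i, fun ω => ω.1 j; E.law μ] = E.V i j := by
  rw [← covariance_eval_multivariateGaussian (μ := μ) E.posDef_V.posSemidef i j]
  have h : (E.law μ).map Prod.fst = multivariateGaussian μ E.V := by
    rw [law, Measure.map_fst_prod]; simp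
  rw [← h, covariance_map_fun]
  all_goals first
    | exact Measurable.aestronglyMeasurable (by fun_prop)
    | fun_prop

theorem covariance_errors (μ : EuclideanSpace ℝ (Fin K)) (p r : Fin K × ℕ) :
    cov[fun ω : Sample K => ω.2 p, fun ω => ω.2 r; E.law μ] =
      if p = r then E.σ p.1 ^ 2 else 0 := by
  have h : (E.law μ).map Prod.snd = Measure.infinitePi fun p : Fin K × ℕ =>
      gaussianReal 0 (Real.toNNReal (E.σ p.1 ^ 2)) := by
    rw [law, Measure.map_snd_prod]; simp
  have h1 : cov[fun ω : Sample K => ω.2 p, fun ω => ω.2 r; E.law μ] =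
      cov[fun e : Fin K × ℕ → ℝ => e p, fun e => e r; (E.law μ).map Prod.snd] := by
    rw [covariance_map_fun]
    all_goals first
      | exact Measurable.aestronglyMeasurable (by fun_prop)
      | fun_prop
  rw [h1, h]
  split_ifs with hpr
  · subst hpr
    rw [covariance_self (measurable_pi_apply p).aemeasurable]
    have h2 := Measure.infinitePi_map_eval (fun p : Fin K × ℕ =>
      gaussianReal 0 (Real.toNNReal (E.σ p.1 ^ 2))) p
    have h3 : Var[fun x => x; (Measure.infinitePi fun p : Fin K × ℕ =>
      gaussianReal 0 (Real.toNNReal (E.σ p.1 ^ 2))).map (fun e => e p)] = E.σ p.1 ^ 2 := by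
      rw [h2, variance_fun_id_gaussianReal, Real.coe_toNNReal _ (by positivity)]
    rw [variance_map (Y := fun e : Fin K × ℕ → ℝ => e p) (X := fun x => x) (by fun_prop)
      (measurable_pi_apply p).aemeasurable] at h3
    exact h3
  · have hi := (iIndepFun_infinitePi (P := fun p : Fin K × ℕ =>
      gaussianReal 0 (Real.toNNReal (E.σ p.1 ^ 2))) (X := fun _ x => x)
      (by fun_prop)).indepFun hpr
    refine hi.covariance_eq_zero ?_ ?_
    · have := (E.hasGaussianLaw_errors μ p).memLp_two
      rw [← h]
      exact (memLp_map_measure_iff (measurable_pi_apply p).aestronglyMeasurable (by fun_prop)).2 this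
    · have := (E.hasGaussianLaw_errors μ r).memLp_two
      rw [← h]
      exact (memLp_map_measure_iff (measurable_pi_apply r).aestronglyMeasurable (by fun_prop)).2 this

theorem covariance_state_errors (μ : EuclideanSpace ℝ (Fin K)) (i : Fin K) (p : Fin K × ℕ) :
    cov[fun ω : Sample K => ω.1 i, fun ω => ω.2 p; E.law μ] = 0 := by
  have h : IndepFun (fun ω : Sample K => ω.1 i) (fun ω => ω.2 p) (E.law μ) := by
    unfold law
    exact indepFun_prod (X := fun x : EuclideanSpace ℝ (Fin K) => x i)
      (Y := fun e : Fin K × ℕ → ℝ => e p) (by fun_prop) (by fun_prop)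
  exact h.covariance_eq_zero (E.hasGaussianLaw_state μ i).memLp_two
    (E.hasGaussianLaw_errors μ p).memLp_two

theorem covariance_linForm (μ : EuclideanSpace ℝ (Fin K)) (hg : Function.Injective g)
    (u u' : Fin K → ℝ) (η η' : I → ℝ) :
    cov[linForm g u η, linForm g u' η'; E.law μ] =
      u ⬝ᵥ E.V *ᵥ u' + ∑ p, η p * η' p * E.σ (g p).1 ^ 2 := by
  have hs := fun i => (E.hasGaussianLaw_state μ i).memLp_two
  have he := fun p => (E.hasGaussianLaw_errors μ p).memLp_two
  have hs1 : ∀ v : Fin K → ℝ, MemLp (fun ω : Sample K => ∑ i, v i * ω.1 i) 2 (E.law μ) :=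
    fun v => memLp_finsetSum _ fun i _ => (hs i).const_mul _
  have he1 : ∀ v : I → ℝ, MemLp (fun ω : Sample K => ∑ p, v p * ω.2 (g p)) 2 (E.law μ) :=
    fun v => memLp_finsetSum _ fun i _ => (he _).const_mul _
  have e1 : ∀ (v : Fin K → ℝ) (ζ : I → ℝ), linForm g v ζ =
      (fun ω : Sample K => ∑ i, v i * ω.1 i) + fun ω => ∑ p, ζ p * ω.2 (g p) := fun _ _ => rfl
  rw [e1, e1, covariance_add_left (hs1 _) (he1 _) ((hs1 _).add (he1 _)),
    covariance_add_right (hs1 _) (hs1 _) (he1 _), covariance_add_right (he1 _) (hs1 _) (he1 _)]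
  have z1 : ∀ (v : Fin K → ℝ) (ζ : I → ℝ), cov[fun ω : Sample K => ∑ i, v i * ω.1 i,
      fun ω => ∑ p, ζ p * ω.2 (g p); E.law μ] = 0 := by
    intro v ζ
    rw [covariance_fun_sum_fun_sum (fun i => (hs i).const_mul _) (fun p => (he _).const_mul _)]
    refine Finset.sum_eq_zero fun i _ => Finset.sum_eq_zero fun p _ => ?_
    rw [covariance_const_mul_left, covariance_const_mul_right, covariance_state_errors]
    simp
  rw [z1, covariance_comm (fun ω : Sample K => ∑ p, η p * ω.2 (g p)), z1,
    covariance_fun_sum_fun_sum (fun i => (hs i).const_mul _) (fun p => (hs _).const_mul _),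
    covariance_fun_sum_fun_sum (fun i => (he _).const_mul _) (fun p => (he _).const_mul _)]
  simp only [covariance_const_mul_left, covariance_const_mul_right, covariance_state,
    covariance_errors, hg.eq_iff]
  rw [add_zero, zero_add]
  congr 1
  · simp only [dotProduct, mulVec, Finset.mul_sum]
    exact Finset.sum_congr rfl fun i _ => Finset.sum_congr rfl fun j _ => by ring
  · refine Finset.sum_congr rfl fun p _ => ?_
    simp [mul_left_comm, mul_assoc]

theorem hasGaussianLaw_linForms {κ : Type*} [Fintype κ] (μ : EuclideanSpace ℝ (Fin K))
    (hg : Function.Injective g) (u : Fin K → ℝ) (η : I → ℝ) (u' : κ → Fin K → ℝ)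
    (η' : κ → I → ℝ) :
    HasGaussianLaw (fun ω => (linForm g u η ω, fun p => linForm g (u' p) (η' p) ω)) (E.law μ) := by
  let F : (Fin K → ℝ) → (I → ℝ) → (EuclideanSpace ℝ (Fin K) × (I → ℝ)) →ₗ[ℝ] ℝ := fun u η =>
    { toFun := fun x => ∑ i, u i * x.1 i + ∑ p, η p * x.2 p
      map_add' := fun x y => by
        simp only [Prod.fst_add, Prod.snd_add, PiLp.add_apply, Pi.add_apply, mul_add,
          Finset.sum_add_distrib]
        ring
      map_smul' := fun c x => by
        simp only [Prod.smul_fst, Prod.smul_snd, PiLp.smul_apply, Pi.smul_apply, smul_eq_mul,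
          RingHom.id_apply, mul_add, Finset.mul_sum]
        congr 1 <;> exact Finset.sum_congr rfl fun i _ => by ring }
  let L : (EuclideanSpace ℝ (Fin K) × (I → ℝ)) →ₗ[ℝ] ℝ × (κ → ℝ) :=
    (F u η).prod (LinearMap.pi fun p => F (u' p) (η' p))
  exact (E.hasGaussianLaw_state_errors μ hg).map_fun (LinearMap.toContinuousLinearMap L)

end LinearForms

section PosteriorVariance

variable [NeZero K]

/-- The index of the potential observation `p`. -/
def obsIndex (q : Fin K → ℕ) (p : Σ k, Fin (q k)) : Fin K × ℕ := (p.1, p.2)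

theorem obsIndex_injective (q : Fin K → ℕ) : Function.Injective (obsIndex q) := by
  rintro ⟨k, n⟩ ⟨k', n'⟩ h
  simp only [obsIndex, Prod.mk.injEq] at h
  obtain ⟨rfl, h⟩ := h
  rw [Fin.val_inj] at h
  rw [h]

theorem signal_eq_linForm (q : Fin K → ℕ) (p : Σ k, Fin (q k)) :
    E.signal p.1 p.2 = linForm (obsIndex q) (E.C p.1) (Pi.single p 1) := by
  ext ω
  simp [signal, linForm, obsIndex, Pi.single_apply]

/-- The coefficient of an observation of source `k` in the posterior mean of the
payoff-relevant state. -/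
def gain (q : Fin K → ℕ) (k : Fin K) : ℝ := E.loading q k / E.σ k ^ 2

/-- The difference between the payoff-relevant state and its posterior mean. -/
def residual (q : Fin K → ℕ) : Sample K → ℝ :=
  linForm (obsIndex q) (E.V⁻¹ *ᵥ fun i => E.postCov q i 0) (fun p => -E.gain q p.1)

/-- The first column of `precision * postCov = 1`. It identifies the coefficients of the state
vector in the residual. -/
theorem residual_vector (q : Fin K → ℕ) (i : Fin K) :
    (E.V⁻¹ *ᵥ fun i => E.postCov q i 0) i =
      (if i = 0 then 1 else 0) - ∑ k, (q k : ℝ) * E.gain q k * E.C k i := by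
  have h := congrFun (congrFun (E.precision_mul_postCov q) i) 0
  rw [precision, Matrix.add_mul, Matrix.add_apply, Matrix.one_apply] at h
  rw [← h]
  have h1 : (E.V⁻¹ * E.postCov q) i 0 = (E.V⁻¹ *ᵥ fun i => E.postCov q i 0) i := rfl
  rw [h1, add_sub_assoc, left_eq_add, sub_eq_zero, Matrix.mul_assoc, Matrix.mul_assoc, mul_apply]
  refine Finset.sum_congr rfl fun k _ => ?_
  have h2 : (E.C * E.postCov q) k 0 = E.loading q k := by
    rw [loading, mul_apply, mulVec, dotProduct]
    refine Finset.sum_congr rfl fun i _ => ?_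
    rw [mul_comm, ← E.transpose_postCov q, transpose_apply, E.transpose_postCov]
  rw [diagonal_mul, h2, transpose_apply, gain]
  ring

theorem state_eq (q : Fin K → ℕ) (ω : Sample K) :
    ω.1 0 = E.residual q ω + ∑ p : Σ k, Fin (q k), E.gain q p.1 * E.signal p.1 p.2 ω := by
  have h : ∑ i, (E.V⁻¹ *ᵥ fun i => E.postCov q i 0) i * ω.1 i =
      ω.1 0 - ∑ p : Σ k, Fin (q k), E.gain q p.1 * ∑ i, E.C p.1 i * ω.1 i := by
    simp only [residual_vector, sub_mul, Finset.sum_sub_distrib]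
    congr 1
    · simp
    · rw [Fintype.sum_sigma]
      simp only [Finset.sum_const, Finset.card_univ, Fintype.card_fin, nsmul_eq_mul,
        Finset.sum_mul, Finset.mul_sum]
      rw [Finset.sum_comm]
      exact Finset.sum_congr rfl fun k _ => Finset.sum_congr rfl fun i _ => by ring
  rw [residual, linForm, h]
  simp only [signal, obsIndex, mul_add, Finset.sum_add_distrib, neg_mul, Finset.sum_neg_distrib]
  ring

theorem V_mulVec_residual_vector (q : Fin K → ℕ) (c : Fin K → ℝ) :
    (E.V⁻¹ *ᵥ fun i => E.postCov q i 0) ⬝ᵥ E.V *ᵥ c = (E.postCov q *ᵥ c) 0 := by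
  rw [dotProduct_mulVec, ← mulVec_transpose, E.transpose_V, mulVec_mulVec, E.V_mul_inv,
    one_mulVec, mulVec]
  congr 1
  ext i
  rw [← E.transpose_postCov q, transpose_apply, E.transpose_postCov]

/-- The orthogonality characterizing the posterior mean: the error of the observation contributes
`-gain * σ ^ 2`, which cancels the `loading`. -/
theorem covariance_residual_signal (q : Fin K → ℕ) (p : Σ k, Fin (q k)) :
    cov[E.residual q, E.signal p.1 p.2; E.law 0] = 0 := by
  rw [signal_eq_linForm, residual, E.covariance_linForm _ (obsIndex_injective q),
    V_mulVec_residual_vector]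
  simp only [Pi.single_apply, mul_ite, mul_one, mul_zero, ite_mul, zero_mul, Finset.sum_ite_eq',
    Finset.mem_univ, if_true]
  have := (pow_pos (E.σ_pos p.1) 2).ne'
  rw [← loading, gain, obsIndex, neg_mul, div_mul_cancel₀ _ this, add_neg_cancel]

/-- For jointly Gaussian variables, vanishing covariances give independence. -/
theorem indepFun_residual (q : Fin K → ℕ) :
    IndepFun (E.residual q) (fun ω (p : Σ k, Fin (q k)) => E.signal p.1 p.2 ω) (E.law 0) := by
  have h := E.hasGaussianLaw_linForms 0 (obsIndex_injective q)
    (E.V⁻¹ *ᵥ fun i => E.postCov q i 0) (fun p => -E.gain q p.1) (fun p => E.C p.1)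
    (fun p => Pi.single p 1)
  simp_rw [← signal_eq_linForm] at h
  change HasGaussianLaw (fun ω => (E.residual q ω, _)) _ at h
  have h2 := (h.map_fun ((ContinuousLinearMap.pi fun _ : Unit => ContinuousLinearMap.fst ℝ ℝ _).prod
    (ContinuousLinearMap.snd ℝ _ _)))
  have h3 := HasGaussianLaw.indepFun_of_covariance_eval (X := fun (_ : Unit) => E.residual q)
    (Y := fun p : Σ k, Fin (q k) => E.signal p.1 p.2) h2
    fun _ p => E.covariance_residual_signal q p
  exact h3.comp (measurable_pi_apply ()) measurable_id

/-- The posterior variance of the payoff-relevant state. -/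
theorem posteriorVariance_eq (q : Fin K → ℕ) : E.posteriorVariance q = E.postCov q 0 0 := by
  have hm := E.obsAlgebra_le q
  have hgl := E.hasGaussianLaw_linForms 0 (obsIndex_injective q)
    (E.V⁻¹ *ᵥ fun i => E.postCov q i 0) (fun p => -E.gain q p.1) (fun p : Fin 0 => E.C p.elim0)
    (fun p => p.elim0)
  have hD2 : MemLp (E.residual q) 2 (E.law 0) := hgl.fst.memLp_two
  have hDm : Measurable (E.residual q) := by unfold residual linForm; fun_prop
  set D := E.residual q with hD
  set Y : Sample K → ℝ := fun ω => ∑ p : Σ k, Fin (q k), E.gain q p.1 * E.signal p.1 p.2 ω with hY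
  have hsig : ∀ k n, MemLp (E.signal k n) 2 (E.law 0) := by
    intro k n
    have h1 := fun i => (E.hasGaussianLaw_state 0 i).memLp_two
    exact (memLp_finsetSum _ fun i _ => (h1 i).const_mul _).add
      (E.hasGaussianLaw_errors 0 (k, n)).memLp_two
  have hY2 : MemLp Y 2 (E.law 0) := memLp_finsetSum _ fun p _ => (hsig _ _).const_mul _
  have hYm : StronglyMeasurable[E.obsAlgebra q] Y := by
    have hF : Measurable[E.obsAlgebra q]
        (fun ω (p : Σ k, Fin (q k)) => E.signal p.1 p.2 ω) := comap_measurable _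
    have hG : Measurable (fun x : (Σ k, Fin (q k)) → ℝ => ∑ p, E.gain q p.1 * x p) := by fun_prop
    exact (hG.comp hF).stronglyMeasurable
  have hDint : ∫ ω, D ω ∂(E.law 0) = 0 := by
    have h1 : ∀ i : Fin K, ∫ ω, ω.1 i ∂(E.law 0) = 0 := by
      intro i
      have h2 : (E.law 0).map Prod.fst = multivariateGaussian 0 E.V := by
        rw [law, Measure.map_fst_prod]; simp
      have h3 : ∫ x : EuclideanSpace ℝ (Fin K), x i ∂((E.law 0).map Prod.fst) = 0 := by
        rw [h2]
        have h4 := (EuclideanSpace.proj i : EuclideanSpace ℝ (Fin K) →L[ℝ] ℝ).integral_comp_comm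
          (IsGaussian.integrable_id (μ := multivariateGaussian 0 E.V))
        simp only [id] at h4
        rw [integral_id_multivariateGaussian] at h4
        simpa using h4
      rwa [integral_map (by fun_prop) (by fun_prop)] at h3
    have h2 : ∀ p : Fin K × ℕ, ∫ ω, ω.2 p ∂(E.law 0) = 0 := by
      intro p
      have h2 : (E.law 0).map Prod.snd = Measure.infinitePi fun p : Fin K × ℕ =>
          gaussianReal 0 (Real.toNNReal (E.σ p.1 ^ 2)) := by
        rw [law, Measure.map_snd_prod]; simp
      have h3 : (E.law 0).map (fun ω => ω.2 p) =
          gaussianReal 0 (Real.toNNReal (E.σ p.1 ^ 2)) := by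
        have h4 := Measure.map_map (μ := E.law 0) (measurable_pi_apply p)
          (measurable_snd (α := EuclideanSpace ℝ (Fin K)) (β := Fin K × ℕ → ℝ))
        rw [h2, Measure.infinitePi_map_eval] at h4
        exact h4.symm
      have h5 : ∫ x, x ∂((E.law 0).map (fun ω => ω.2 p)) = 0 := by
        rw [h3, integral_id_gaussianReal]
      rwa [integral_map (by fun_prop) (by fun_prop)] at h5
    have hi1 := fun i => (E.hasGaussianLaw_state 0 i).integrable
    have hi2 := fun p => (E.hasGaussianLaw_errors 0 p).integrable
    rw [hD]
    unfold residual linForm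
    rw [integral_add (integrable_finsetSum _ fun i _ => (hi1 i).const_mul _)
      (integrable_finsetSum _ fun p _ => (hi2 _).const_mul _),
      integral_finsetSum _ fun i _ => (hi1 i).const_mul _,
      integral_finsetSum _ fun p _ => (hi2 _).const_mul _]
    simp only [integral_const_mul, h1, h2, mul_zero, Finset.sum_const_zero, add_zero]
  -- `Y` is a function of the observations, and the centered residual `D` is independent of them. So
  -- `Y` is the posterior mean, and the posterior variance is the second moment of `D`.
  have hstate : (fun ω : Sample K => ω.1 0) = D + Y := by
    ext ω; exact E.state_eq q ω
  have hindep : Indep (MeasurableSpace.comap D inferInstance) (E.obsAlgebra q) (E.law 0) :=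
    E.indepFun_residual q
  have hcond : (E.law 0)[fun ω : Sample K => ω.1 0 | E.obsAlgebra q] =ᵐ[E.law 0] Y := by
    rw [hstate]
    have h1 := condExp_add (hD2.integrable (by norm_num)) (hY2.integrable (by norm_num))
      (E.obsAlgebra q)
    have h2 := condExp_indep_eq hDm.comap_le hm
      (comap_measurable D).stronglyMeasurable hindep
    have h3 := condExp_of_stronglyMeasurable hm hYm (hY2.integrable (by norm_num))
    filter_upwards [h1, h2] with ω e1 e2
    rw [e1, Pi.add_apply, e2, h3, hDint, zero_add]
  have key : E.posteriorVariance q = ∫ ω, D ω ^ 2 ∂(E.law 0) := by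
    unfold posteriorVariance posteriorVarianceAt condVar
    rw [integral_condExp hm]
    refine integral_congr_ae ?_
    filter_upwards [hcond] with ω e1
    have e2 := congrFun hstate ω
    simp only [Pi.add_apply] at e2
    simp only [Pi.pow_apply, Pi.sub_apply]
    rw [e1, e2]
    ring
  rw [key, ← variance_of_integral_eq_zero hDm.aemeasurable hDint,
    ← covariance_self hDm.aemeasurable]
  -- Since `D` is uncorrelated with `Y`, its variance is its covariance with the state, which is
  -- computed from the linear forms.
  have e3 : E.postCov q 0 0 = cov[D, fun ω : Sample K => ω.1 0; E.law 0] := by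
    have h1 : (fun ω : Sample K => ω.1 0) = linForm (obsIndex q) (Pi.single 0 1) 0 := by
      ext ω; simp [linForm, Pi.single_apply]
    rw [h1, hD, residual, E.covariance_linForm _ (obsIndex_injective q), V_mulVec_residual_vector]
    simp
  rw [e3, hstate, covariance_add_right hD2 hD2 hY2, hY]
  rw [covariance_fun_sum_right (fun p => (hsig _ _).const_mul _) hD2]
  simp [covariance_const_mul_right, hD, E.covariance_residual_signal]

end PosteriorVariance

end Environment

/-! ### Monotonicity of the variance and uniform positivity of marginal values. -/

namespace Environment

open Matrix

variable {K : ℕ} [NeZero K] (E : Environment K)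

theorem postCov_zero_zero_pos (q : Fin K → ℕ) : 0 < E.postCov q 0 0 :=
  (E.posDef_postCov q).diag_pos

theorem postCov_antitone {p q : Fin K → ℕ} (h : p ≤ q) : E.postCov q 0 0 ≤ E.postCov p 0 0 := by
  obtain ⟨d, rfl⟩ : ∃ d, q = p + d := ⟨q - p, (add_tsub_cancel_of_le h).symm⟩
  clear h
  induction hn : ∑ k, d k generalizing d with
  | zero =>
    have : d = 0 := by
      ext k
      exact (Finset.sum_eq_zero_iff.1 hn) k (Finset.mem_univ k)
    simp [this]
  | succ n ih =>
    have h1 : ∃ i, 0 < d i := by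
      by_contra! h
      have := Finset.sum_eq_zero fun k (_ : k ∈ Finset.univ) => Nat.le_zero.1 (h k)
      omega
    obtain ⟨i, hi⟩ := h1
    obtain ⟨d', rfl⟩ := exists_sub_single hi
    rw [← add_assoc, postCov_add_single_zero]
    have h2 : 0 ≤ E.loading (p + d') i ^ 2 / E.obsVar (p + d') i :=
      div_nonneg (sq_nonneg _) (E.obsVar_pos _ _).le
    have h3 := ih d' (by rw [sum_add_single] at hn; omega)
    linarith

theorem bddBelow_posteriorVariance (q : Fin K → ℕ∞) :
    BddBelow (Set.range fun p : {p : Fin K → ℕ // ∀ k, (p k : ℕ∞) ≤ q k} =>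
      E.posteriorVariance p) := by
  refine ⟨0, ?_⟩
  rintro _ ⟨p, rfl⟩
  simp only [posteriorVariance_eq]
  exact (E.postCov_zero_zero_pos _).le

theorem extPosteriorVariance_le {p : Fin K → ℕ} {q : Fin K → ℕ∞} (h : ∀ k, (p k : ℕ∞) ≤ q k) :
    E.extPosteriorVariance q ≤ E.postCov p 0 0 := by
  rw [← posteriorVariance_eq]
  exact ciInf_le (E.bddBelow_posteriorVariance q) ⟨p, h⟩

theorem exists_postCov_lt {q : Fin K → ℕ∞} {c : ℝ} (h : E.extPosteriorVariance q < c) :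
    ∃ p : Fin K → ℕ, (∀ k, (p k : ℕ∞) ≤ q k) ∧ E.postCov p 0 0 < c := by
  have : Nonempty {p : Fin K → ℕ // ∀ k, (p k : ℕ∞) ≤ q k} := ⟨⟨0, fun k => by simp⟩⟩
  obtain ⟨p, hp⟩ := exists_lt_of_ciInf_lt h
  rw [posteriorVariance_eq] at hp
  exact ⟨p.1, p.2, hp⟩

variable {E}

/-- The marginal values of a source at its observation number `m` are bounded away from zero. -/
theorem PositiveMarginalValue.exists_le_sub (h : E.PositiveMarginalValue) (j : Fin K) (m : ℕ) :
    ∃ δ > 0, ∀ q : Fin K → ℕ, q j = m →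
      δ ≤ E.postCov q 0 0 - E.postCov (q + Pi.single j 1) 0 0 := by
  by_contra! hcon
  choose Q hQ1 hQ2 using fun n : ℕ => hcon (1 / ((n : ℝ) + 1)) (by positivity)
  -- By Dickson's lemma the counterexamples have a monotone subsequence. Its limit `L` may have
  -- infinite entries, but `L j = m`, so `j` has positive marginal value at `L`.
  obtain ⟨g, hg⟩ := WellQuasiOrdered.exists_monotone_subseq
    (wellQuasiOrdered_le (α := Fin K → ℕ)) Q
  set u : ℕ → Fin K → ℕ := fun n => Q (g n) with hu
  have hmono : Monotone u := fun m n hmn => hg m n hmn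
  set L : Fin K → ℕ∞ := fun k => ⨆ n, (u n k : ℕ∞) with hL
  have hLj : L j = m := by simp [hL, hu, hQ1]
  have hle : ∀ n k, (u n k : ℕ∞) ≤ L k := fun n k => le_iSup (fun n => (u n k : ℕ∞)) n
  have hlt := h L j (by rw [hLj]; exact ENat.natCast_ne_top m)
  obtain ⟨p, hp1, hp2⟩ := E.exists_postCov_lt hlt
  have h1 : ∀ k, ∃ n, p k ≤ (u n + Pi.single j 1 : Fin K → ℕ) k := by
    intro k
    by_cases hk : k = j
    · subst hk
      refine ⟨0, ?_⟩
      have := hp1 k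
      rw [Function.update_self, hLj] at this
      simp only [Pi.add_apply, Pi.single_eq_same, hu, hQ1]
      exact_mod_cast this
    · by_contra! hc
      have h2 := hp1 k
      rw [Function.update_of_ne hk] at h2
      have h3 : L k ≤ ((p k - 1 : ℕ) : ℕ∞) := by
        refine iSup_le fun n => ?_
        have := hc n
        simp only [Pi.add_apply, Pi.single_eq_of_ne hk] at this
        exact_mod_cast (by omega : u n k ≤ p k - 1)
      have h4 : p k ≤ p k - 1 := by exact_mod_cast h2.trans h3
      have := hc 0
      omega
  choose N hN using h1
  -- For large `n`, `p` lies below `u n + Pi.single j 1`, while the variance at `u n` is at least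
  -- that at `L`. So the marginal values are eventually at least `c`, contradicting their
  -- convergence to zero.
  set c := E.extPosteriorVariance L - E.postCov p 0 0 with hc
  have hcpos : 0 < c := sub_pos.2 hp2
  obtain ⟨n₀, hn₀⟩ := exists_nat_one_div_lt hcpos
  set n := max n₀ (Finset.univ.sup N)
  have h2 : p ≤ u n + Pi.single j 1 := fun k => (hN k).trans
    (add_le_add (hmono ((Finset.le_sup (Finset.mem_univ k)).trans (le_max_right _ _)) k) le_rfl)
  have h3 := E.postCov_antitone h2
  have h4 := E.extPosteriorVariance_le (hle n)
  have h5 := hQ2 (g n)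
  have h6 : 1 / ((g n : ℝ) + 1) ≤ 1 / ((n₀ : ℝ) + 1) := by
    have : n₀ ≤ g n := (le_max_left _ _).trans (StrictMono.le_apply g.strictMono)
    gcongr
  change E.postCov (u n) 0 0 - E.postCov (u n + Pi.single j 1) 0 0 < _ at h5
  linarith

theorem PositiveMarginalValue.exists_le_sub_of_le (h : E.PositiveMarginalValue) (B : ℕ) :
    ∃ δ > 0, ∀ (q : Fin K → ℕ) (j : Fin K), q j ≤ B →
      δ ≤ E.postCov q 0 0 - E.postCov (q + Pi.single j 1) 0 0 := by
  choose δ hδ hδ' using fun x : Fin K × Fin (B + 1) => h.exists_le_sub x.1 x.2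
  obtain ⟨x, -, hx⟩ := Finset.exists_min_image Finset.univ δ ⟨(0, 0), Finset.mem_univ _⟩
  exact ⟨δ x, hδ x, fun q j hq => (hx (j, ⟨q j, by omega⟩) (Finset.mem_univ _)).trans
    (hδ' (j, ⟨q j, by omega⟩) q rfl)⟩

theorem PositiveMarginalValue.loading_ne_zero (h : E.PositiveMarginalValue) (q : Fin K → ℕ)
    (j : Fin K) : E.loading q j ≠ 0 := by
  intro h0
  obtain ⟨δ, hδ, h1⟩ := h.exists_le_sub_of_le (q j)
  have := h1 q j le_rfl
  rw [postCov_add_single_zero, h0] at this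
  simp at this
  linarith

end Environment

/-! ### Marginal values of frequently observed sources: first-order bounds. -/

/-- A bound for the solutions of a linear system with large diagonal. -/
theorem abs_le_of_diagonal_add_posSemidef {ι : Type*} [Fintype ι] [Nonempty ι]
    {P : Matrix ι ι ℝ} (hP : P.PosSemidef) {d g h : ι → ℝ}
    (heq : ∀ k, d k * g k + (P.mulVec g) k = h k) {y : ℝ} (hy : 0 < y) (hd : ∀ k, y ≤ d k)
    (k : ι) : |g k| ≤ (∑ l, |h l|) / y := by
  obtain ⟨m, -, hm⟩ := Finset.exists_max_image Finset.univ (fun l => |g l|) Finset.univ_nonempty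
  refine (hm k (Finset.mem_univ k)).trans ?_
  rw [le_div_iff₀ hy]
  rcases eq_or_lt_of_le (abs_nonneg (g m)) with h0 | h0
  · rw [← h0, zero_mul]
    exact Finset.sum_nonneg fun _ _ => abs_nonneg _
  -- Pairing the system with `g` and dropping the nonnegative form of `P` leaves `y * |g m| ^ 2 ≤ |g
  -- m| * ∑ l, |h l|` at the largest entry.
  have h1 : ∑ l, d l * g l ^ 2 + ∑ l, g l * (P.mulVec g) l = ∑ l, g l * h l := by
    rw [← Finset.sum_add_distrib]
    refine Finset.sum_congr rfl fun l _ => ?_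
    rw [← heq l]; ring
  have h2 : 0 ≤ ∑ l, g l * (P.mulVec g) l := by
    simpa [dotProduct] using hP.dotProduct_mulVec_nonneg g
  have h3 : d m * g m ^ 2 ≤ ∑ l, d l * g l ^ 2 :=
    Finset.single_le_sum (f := fun l => d l * g l ^ 2)
      (fun l _ => mul_nonneg (hy.le.trans (hd l)) (sq_nonneg _)) (Finset.mem_univ m)
  have h4 : ∑ l, g l * h l ≤ |g m| * ∑ l, |h l| := by
    rw [Finset.mul_sum]
    refine Finset.sum_le_sum fun l _ => (le_abs_self _).trans ?_
    rw [abs_mul]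
    exact mul_le_mul_of_nonneg_right (hm l (Finset.mem_univ l)) (abs_nonneg _)
  have h5 : y * |g m| ^ 2 ≤ d m * g m ^ 2 := by
    rw [sq_abs]
    exact mul_le_mul_of_nonneg_right (hd m) (sq_nonneg _)
  nlinarith

namespace Environment

open Matrix

variable {K : ℕ} [NeZero K] {E : Environment K}

theorem NonRedundant.coef_ne_zero (hE : E.NonRedundant) (k : Fin K) : E.coef k ≠ 0 := hE.2 k

/-- The normalizing constant of the limiting frequencies. -/
def freqScale (E : Environment K) : ℝ := ∑ j, |E.coef j| * E.σ j

theorem NonRedundant.freqScale_pos (hE : E.NonRedundant) : 0 < E.freqScale :=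
  Finset.sum_pos (fun k _ => mul_pos (abs_pos.2 (hE.coef_ne_zero k)) (E.σ_pos k))
    Finset.univ_nonempty

theorem NonRedundant.freq_mul (hE : E.NonRedundant) (k : Fin K) :
    E.freq k * E.freqScale = |E.coef k| * E.σ k := by
  rw [freq]
  exact div_mul_cancel₀ _ hE.freqScale_pos.ne'

theorem NonRedundant.freq_pos (hE : E.NonRedundant) (k : Fin K) : 0 < E.freq k :=
  div_pos (mul_pos (abs_pos.2 (hE.coef_ne_zero k)) (E.σ_pos k)) hE.freqScale_pos

theorem NonRedundant.sum_freq (hE : E.NonRedundant) : ∑ k, E.freq k = 1 := by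
  have := hE.freqScale_pos.ne'
  unfold freq
  rw [← Finset.sum_div]
  exact div_self this

/-- The relative correction of the loading of source `k`. -/
def loadingCorr (E : Environment K) (q : Fin K → ℕ) (k : Fin K) : ℝ :=
  (E.signalPrecision *ᵥ E.loading q) k / E.coef k

/-- The relative correction of the variance of an observation of source `k`. -/
def varCorr (E : Environment K) (q : Fin K → ℕ) (k : Fin K) : ℝ := E.signalVar q k / E.σ k ^ 2

theorem varCorr_nonneg (q : Fin K → ℕ) (k : Fin K) : 0 ≤ E.varCorr q k :=
  div_nonneg (E.signalVar_nonneg q k) (sq_nonneg _)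

theorem NonRedundant.count_mul_loading (hE : E.NonRedundant) (q : Fin K → ℕ) (k : Fin K) :
    q k * E.loading q k = E.σ k ^ 2 * E.coef k * (1 - E.loadingCorr q k) := by
  have h := E.loading_equation hE.1 q k
  have hσ := (pow_pos (E.σ_pos k) 2).ne'
  have ha := hE.coef_ne_zero k
  have h1 : (E.signalPrecision *ᵥ E.loading q) k = E.coef k * E.loadingCorr q k := by
    rw [loadingCorr]; field_simp
  rw [h1, div_mul_eq_mul_div] at h
  rw [div_add' _ _ _ hσ, div_eq_iff hσ] at h
  linear_combination h

/-- The marginal value of source `k`. -/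
def marginal (E : Environment K) (q : Fin K → ℕ) (k : Fin K) : ℝ :=
  E.loading q k ^ 2 / E.obsVar q k

/-- An exact identity: apart from the two corrections, the marginal value is a constant common to
all sources divided by the squared level `q k / λ k`. The limiting frequencies come from here. -/
theorem NonRedundant.marginal_mul (hE : E.NonRedundant) (q : Fin K → ℕ) (k : Fin K) :
    E.marginal q k * ((q k / E.freq k) ^ 2 * (1 + E.varCorr q k)) =
      E.freqScale ^ 2 * (1 - E.loadingCorr q k) ^ 2 := by
  have h := hE.count_mul_loading q k
  have hσ := E.σ_pos k
  have hl := hE.freq_pos k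
  have hS := E.obsVar_pos q k
  have h1 : E.obsVar q k = E.σ k ^ 2 * (1 + E.varCorr q k) := by
    rw [obsVar, varCorr]; field_simp
  have h2 : (0 : ℝ) < 1 + E.varCorr q k := by have := varCorr_nonneg (E := E) q k; linarith
  have h3 : E.coef k ^ 2 * E.σ k ^ 2 = E.freq k ^ 2 * E.freqScale ^ 2 := by
    rw [← mul_pow (E.freq k), hE.freq_mul, mul_pow, sq_abs]
  have h4 : (q k * E.loading q k) ^ 2 = E.freq k ^ 2 * E.freqScale ^ 2 * E.σ k ^ 2 *
      (1 - E.loadingCorr q k) ^ 2 := by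
    rw [h, ← h3]; ring
  have h5 : E.marginal q k * ((q k / E.freq k) ^ 2 * (1 + E.varCorr q k)) =
      (q k * E.loading q k) ^ 2 / (E.freq k ^ 2 * E.σ k ^ 2) := by
    rw [marginal, h1]; field_simp
  rw [h5, h4]
  field_simp

/-- The linear systems of the loadings and of the signal covariances have diagonals of order at
least `y`, so their solutions are of order `1 / y`; the other quantities depend linearly on these.
-/
theorem NonRedundant.exists_corr_le (hE : E.NonRedundant) :
    ∃ A > 0, ∀ (q : Fin K → ℕ) (y : ℝ), 0 < y → (∀ k, y ≤ q k / E.freq k) → ∀ k,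
      |E.loading q k| ≤ A / y ∧ |E.loadingCorr q k| ≤ A / y ∧ E.varCorr q k ≤ A / y ∧
      |(E.signalPrecision *ᵥ E.signalCov q k) k| ≤ A / y := by
  obtain ⟨m, -, hm⟩ := Finset.exists_min_image Finset.univ (fun l => E.freq l / E.σ l ^ 2)
    Finset.univ_nonempty
  set c := E.freq m / E.σ m ^ 2 with hc
  have hcpos : 0 < c := div_pos (hE.freq_pos m) (pow_pos (E.σ_pos m) 2)
  set H := ∑ l, |E.coef l| with hH
  have hHn : 0 ≤ H := Finset.sum_nonneg fun _ _ => abs_nonneg _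
  set B := H / c + 1 / c with hB
  have hBn : 0 ≤ B := by positivity
  set P := E.signalPrecision with hP
  set R : Fin K → ℝ := fun k => ∑ l, |P k l| with hR
  have hRn : ∀ k, 0 ≤ R k := fun k => Finset.sum_nonneg fun _ _ => abs_nonneg _
  -- One summand for each of the four bounds; the sum over `k` gives a constant uniform in the
  -- source.
  set D : Fin K → ℝ := fun k => B + R k * B / |E.coef k| + B / E.σ k ^ 2 + R k * B with hD
  have hDn : ∀ k, 0 ≤ D k := fun k => by have := hRn k; simp only [hD]; positivity
  refine ⟨∑ k, D k + 1, by have := Finset.sum_nonneg fun k (_ : k ∈ Finset.univ) => hDn k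
                           linarith, fun q y hy hq k => ?_⟩
  have hd : ∀ l, c * y ≤ q l / E.σ l ^ 2 := by
    intro l
    have h1 := hm l (Finset.mem_univ l)
    have h2 := hq l
    rw [le_div_iff₀ (hE.freq_pos l)] at h2
    calc c * y ≤ E.freq l / E.σ l ^ 2 * y := mul_le_mul_of_nonneg_right h1 hy.le
      _ = y * E.freq l / E.σ l ^ 2 := by ring
      _ ≤ q l / E.σ l ^ 2 := by gcongr
  have hmulVec : ∀ g : Fin K → ℝ, (∀ l, |g l| ≤ B / y) → |(P *ᵥ g) k| ≤ R k * B / y := by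
    intro g hg
    rw [mulVec, dotProduct, mul_div_assoc, hR, Finset.sum_mul]
    refine (Finset.abs_sum_le_sum_abs _ _).trans (Finset.sum_le_sum fun l _ => ?_)
    rw [abs_mul]
    exact mul_le_mul_of_nonneg_left (hg l) (abs_nonneg _)
  have hw : ∀ l, |E.loading q l| ≤ B / y := fun l => by
    have h1 := abs_le_of_diagonal_add_posSemidef E.posSemidef_signalPrecision
      (fun k => E.loading_equation hE.1 q k) (mul_pos hcpos hy) hd l
    refine h1.trans ?_
    rw [← hH, hB, ← div_div]
    gcongr
    have : 0 ≤ 1 / c := by positivity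
    linarith
  have hv : ∀ l, |E.signalCov q k l| ≤ B / y := fun l => by
    have h1 := abs_le_of_diagonal_add_posSemidef E.posSemidef_signalPrecision
      (fun l => E.signalCov_equation hE.1 q k l) (mul_pos hcpos hy) hd l
    refine h1.trans ?_
    have h2 : ∑ l : Fin K, |(if l = k then (1 : ℝ) else 0)| = 1 := by
      simp [apply_ite abs]
    rw [h2, hB, ← div_div]
    gcongr
    have : 0 ≤ H / c := by positivity
    linarith
  have hle : ∀ x, x ≤ D k → x / y ≤ (∑ k, D k + 1) / y := by
    intro x hx
    have h1 := Finset.single_le_sum (f := D) (fun l _ => hDn l) (Finset.mem_univ k)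
    gcongr
    linarith
  have hRk := hRn k
  have t1 : 0 ≤ R k * B / |E.coef k| := by positivity
  have t2 : 0 ≤ B / E.σ k ^ 2 := by positivity
  have t3 : 0 ≤ R k * B := by positivity
  refine ⟨(hw k).trans (hle _ (by simp only [hD]; linarith)), ?_, ?_,
    (hmulVec _ hv).trans (hle _ (by simp only [hD]; linarith))⟩
  · rw [loadingCorr, abs_div]
    have h1 := hmulVec _ hw
    calc |(P *ᵥ E.loading q) k| / |E.coef k| ≤ (R k * B / y) / |E.coef k| := by gcongr
      _ = (R k * B / |E.coef k|) / y := by ring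
      _ ≤ _ := hle _ (by simp only [hD]; linarith)
  · rw [varCorr, ← signalCov_self]
    have h1 := (le_abs_self _).trans (hv k)
    calc E.signalCov q k k / E.σ k ^ 2 ≤ (B / y) / E.σ k ^ 2 := by gcongr
      _ = (B / E.σ k ^ 2) / y := by ring
      _ ≤ _ := hle _ (by simp only [hD]; linarith)

/-- Pairing the loading equation with the loadings exhibits the posterior variance, which is at most
the prior one, as a sum of nonnegative terms, this one among them up to `σ k ^ 2`. No lower bound on
the counts of other sources is needed. -/
theorem NonRedundant.count_mul_loading_sq_le (hE : E.NonRedundant) (q : Fin K → ℕ) (k : Fin K) :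
    q k * E.loading q k ^ 2 ≤ E.σ k ^ 2 * E.postCov 0 0 0 := by
  have h1 : ∑ l, (q l : ℝ) / E.σ l ^ 2 * E.loading q l ^ 2 +
      ∑ l, E.loading q l * (E.signalPrecision *ᵥ E.loading q) l = E.postCov q 0 0 := by
    rw [E.postCov_zero_zero_eq hE.1, ← Finset.sum_add_distrib]
    refine Finset.sum_congr rfl fun l _ => ?_
    rw [← E.loading_equation hE.1 q l]; ring
  have h2 : 0 ≤ ∑ l, E.loading q l * (E.signalPrecision *ᵥ E.loading q) l := by
    simpa [dotProduct] using
      E.posSemidef_signalPrecision.dotProduct_mulVec_nonneg (E.loading q)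
  have h3 : (q k : ℝ) / E.σ k ^ 2 * E.loading q k ^ 2 ≤
      ∑ l, (q l : ℝ) / E.σ l ^ 2 * E.loading q l ^ 2 :=
    Finset.single_le_sum (f := fun l => (q l : ℝ) / E.σ l ^ 2 * E.loading q l ^ 2)
      (fun l _ => by positivity) (Finset.mem_univ k)
  have h4 := E.postCov_antitone (zero_le : (0 : Fin K → ℕ) ≤ q)
  have hσ := pow_pos (E.σ_pos k) 2
  have h5 : (q k : ℝ) / E.σ k ^ 2 * E.loading q k ^ 2 ≤ E.postCov 0 0 0 := by linarith
  rw [div_mul_eq_mul_div, div_le_iff₀ hσ] at h5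
  linarith

theorem marginal_le (q : Fin K → ℕ) (k : Fin K) :
    E.marginal q k ≤ E.loading q k ^ 2 / E.σ k ^ 2 := by
  have := pow_pos (E.σ_pos k) 2
  have h := E.signalVar_nonneg q k
  unfold marginal obsVar
  gcongr
  linarith

/-- A much more often observed source has a smaller marginal value. -/
theorem NonRedundant.exists_marginal_lt (hE : E.NonRedundant) :
    ∃ M > 0, ∀ C : ℝ, ∃ Y > 0, ∀ (q : Fin K → ℕ) (i j : Fin K),
      (∀ k, q j / E.freq j - C ≤ q k / E.freq k) → Y ≤ q j / E.freq j →
      q j / E.freq j + M ≤ q i / E.freq i → E.marginal q i < E.marginal q j := by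
  obtain ⟨A, hA, hcorr⟩ := hE.exists_corr_le
  -- The corrections are at most `x = 2 * A / y ≤ 1 / 2`, and it suffices that `(1 + x) ^ 2 * y < (1
  -- - x) * z`. The left side is at most `y + 5 * A`, and the right side at least `y + 6 * A + 1 /
  -- 2` once `z ≥ y + 16 * A + 1`.
  refine ⟨16 * A + 1, by positivity, fun C => ⟨4 * A + 2 * |C| + 1, by positivity,
    fun q i j hq hY hij => ?_⟩⟩
  have hCa := le_abs_self C
  have hCn := abs_nonneg C
  set y := (q j : ℝ) / E.freq j with hy
  set z := (q i : ℝ) / E.freq i with hz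
  have hypos : 0 < y := by linarith
  have hcorr' : ∀ k, |E.loadingCorr q k| ≤ 2 * A / y ∧ E.varCorr q k ≤ 2 * A / y := by
    intro k
    obtain ⟨-, h1, h2, -⟩ := hcorr q (y / 2) (by positivity)
      (fun k => le_trans (by linarith) (hq k)) k
    have h3 : A / (y / 2) = 2 * A / y := by field_simp
    rw [h3] at h1 h2
    exact ⟨h1, h2⟩
  set x := 2 * A / y with hx
  have hxy : x * y = 2 * A := by rw [hx]; field_simp
  have hx0 : 0 < x := by positivity
  have hx1 : x ≤ 1 / 2 := by
    rw [hx, div_le_iff₀ hypos]; linarith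
  have hzpos : 0 < z := by linarith
  have mi := hE.marginal_mul q i
  have mj := hE.marginal_mul q j
  rw [← hz] at mi
  rw [← hy] at mj
  obtain ⟨pi, -⟩ := hcorr' i
  obtain ⟨pj, uj⟩ := hcorr' j
  have ui := varCorr_nonneg (E := E) q i
  have uj0 := varCorr_nonneg (E := E) q j
  rw [abs_le] at pi pj
  have hF := hE.freqScale_pos
  set F := E.freqScale
  have b1 : E.marginal q i * z ^ 2 ≤ F ^ 2 * (1 + x) ^ 2 := by
    have h0 : 0 ≤ E.marginal q i := div_nonneg (sq_nonneg _) (E.obsVar_pos q i).le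
    have h1 : (1 - E.loadingCorr q i) ^ 2 ≤ (1 + x) ^ 2 := by
      apply pow_le_pow_left₀ <;> linarith
    calc E.marginal q i * z ^ 2 ≤ E.marginal q i * (z ^ 2 * (1 + E.varCorr q i)) := by
          gcongr
          nlinarith [sq_nonneg z]
      _ = F ^ 2 * (1 - E.loadingCorr q i) ^ 2 := mi
      _ ≤ _ := by gcongr
  have b2 : F ^ 2 * (1 - x) ^ 2 ≤ E.marginal q j * (y ^ 2 * (1 + x)) := by
    have h0 : 0 ≤ E.marginal q j := div_nonneg (sq_nonneg _) (E.obsVar_pos q j).le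
    have h1 : (1 - x) ^ 2 ≤ (1 - E.loadingCorr q j) ^ 2 := by
      apply pow_le_pow_left₀ <;> linarith
    calc F ^ 2 * (1 - x) ^ 2 ≤ F ^ 2 * (1 - E.loadingCorr q j) ^ 2 := by gcongr
      _ = E.marginal q j * (y ^ 2 * (1 + E.varCorr q j)) := mj.symm
      _ ≤ _ := by gcongr
  have b3 : (1 + x) ^ 2 * y < (1 - x) * z := by
    have h1 : (1 - x) * (y + (16 * A + 1)) ≤ (1 - x) * z := by
      apply mul_le_mul_of_nonneg_left hij; linarith
    nlinarith
  have b4 : ((1 + x) ^ 2 * y) ^ 2 < ((1 - x) * z) ^ 2 := by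
    apply pow_lt_pow_left₀ b3 (by positivity) (by norm_num)
  by_contra! hcon
  have h1 : E.marginal q j * (z ^ 2 * (y ^ 2 * (1 + x))) ≤
      F ^ 2 * (1 + x) ^ 2 * (y ^ 2 * (1 + x)) := by
    calc E.marginal q j * (z ^ 2 * (y ^ 2 * (1 + x)))
        ≤ E.marginal q i * (z ^ 2 * (y ^ 2 * (1 + x))) := by gcongr
      _ = E.marginal q i * z ^ 2 * (y ^ 2 * (1 + x)) := by ring
      _ ≤ _ := by gcongr
  have h2 : F ^ 2 * (1 - x) ^ 2 * z ^ 2 ≤ E.marginal q j * (y ^ 2 * (1 + x)) * z ^ 2 := by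
    gcongr
  have h3 : F ^ 2 * ((1 - x) * z) ^ 2 ≤ F ^ 2 * ((1 + x) ^ 2 * y) ^ 2 := by
    calc F ^ 2 * ((1 - x) * z) ^ 2 = F ^ 2 * (1 - x) ^ 2 * z ^ 2 := by ring
      _ ≤ F ^ 2 * (1 + x) ^ 2 * (y ^ 2 * (1 + x)) := by linarith
      _ = F ^ 2 * y ^ 2 * (1 + x) ^ 3 := by ring
      _ ≤ F ^ 2 * y ^ 2 * (1 + x) ^ 4 := by
          gcongr <;> linarith
      _ = _ := by ring
  have h4 := le_of_mul_le_mul_left h3 (by positivity)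
  linarith

end Environment

/-! ### Second-order asymptotics of marginal values near balanced divisions. -/

namespace Environment

open Matrix

variable {K : ℕ} [NeZero K] {E : Environment K}

/-- The limit of the loading corrections, multiplied by the level. -/
def corrLimit (E : Environment K) (k : Fin K) : ℝ :=
  (E.signalPrecision *ᵥ fun l => E.σ l ^ 2 * E.coef l / E.freq l) k / E.coef k

/-- The offsets of the ranks. -/
def offset (E : Environment K) (k : Fin K) : ℝ := 1 / 2 + E.freq k * E.corrLimit k

/-- Divisions which are within `M` of the balanced division of level `y`, as `y` tends to
infinity. -/
def balanced (E : Environment K) (M : ℝ) : Filter ((Fin K → ℕ) × ℝ) :=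
  comap Prod.snd atTop ⊓ 𝓟 {x | ∀ k, |x.1 k / E.freq k - x.2| ≤ M}

theorem tendsto_level (M : ℝ) : Tendsto Prod.snd (E.balanced M) atTop :=
  tendsto_comap.mono_left inf_le_left

theorem eventually_balanced (M : ℝ) :
    ∀ᶠ x in E.balanced M, ∀ k, |x.1 k / E.freq k - x.2| ≤ M :=
  mem_inf_of_right (mem_principal_self _)

theorem tendsto_const_div_level (M C : ℝ) : Tendsto (fun x => C / x.2) (E.balanced M) (𝓝 0) :=
  tendsto_const_nhds.div_atTop (tendsto_level M)

theorem tendsto_ratio (M : ℝ) (k : Fin K) :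
    Tendsto (fun x => x.1 k / E.freq k / x.2) (E.balanced M) (𝓝 1) := by
  have h : Tendsto (fun x => x.1 k / E.freq k / x.2 - 1) (E.balanced M) (𝓝 0) := by
    refine squeeze_zero_norm' ?_ (tendsto_const_div_level M M)
    filter_upwards [eventually_balanced M, (tendsto_level M).eventually_gt_atTop 0] with x h1 h2
    rw [Real.norm_eq_abs, div_sub_one h2.ne', abs_div, abs_of_pos h2]
    gcongr
    exact h1 k
  simpa using h.add_const 1

theorem NonRedundant.eventually_corr_le (hE : E.NonRedundant) (M : ℝ) :
    ∃ A, ∀ᶠ x in E.balanced M, ∀ k, |E.loadingCorr x.1 k| ≤ A / x.2 ∧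
      |(E.signalPrecision *ᵥ E.signalCov x.1 k) k| ≤ A / x.2 := by
  obtain ⟨A, hA, h⟩ := hE.exists_corr_le
  refine ⟨2 * A, ?_⟩
  filter_upwards [eventually_balanced M, (tendsto_level M).eventually_gt_atTop (2 * |M|)]
    with x h1 h2 k
  have h0 : 0 < x.2 := by have := abs_nonneg M; linarith
  have h3 := h x.1 (x.2 / 2) (by positivity) (fun k => by
    have := (abs_le.1 (h1 k)).1
    have := le_abs_self M
    linarith) k
  have h4 : A / (x.2 / 2) = 2 * A / x.2 := by field_simp
  rw [h4] at h3
  exact ⟨h3.2.1, h3.2.2.2⟩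

theorem NonRedundant.tendsto_loadingCorr (hE : E.NonRedundant) (M : ℝ) (k : Fin K) :
    Tendsto (fun x => E.loadingCorr x.1 k) (E.balanced M) (𝓝 0) := by
  obtain ⟨A, hA⟩ := hE.eventually_corr_le M
  exact squeeze_zero_norm' (hA.mono fun x h => (h k).1) (tendsto_const_div_level M A)

theorem tendsto_ratio_inv (M : ℝ) (k : Fin K) :
    Tendsto (fun x => (x.1 k / E.freq k / x.2)⁻¹) (E.balanced M) (𝓝 1) := by
  simpa using (tendsto_ratio (E := E) M k).inv₀ one_ne_zero

theorem NonRedundant.eventually_count_pos (hE : E.NonRedundant) (M : ℝ) (k : Fin K) :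
    ∀ᶠ x in E.balanced M, (0 : ℝ) < x.1 k := by
  filter_upwards [eventually_balanced M, (tendsto_level M).eventually_gt_atTop M] with x h1 h2
  have h3 := (abs_le.1 (h1 k)).1
  have h4 : 0 < x.1 k / E.freq k := by linarith
  have := hE.freq_pos k
  exact (div_pos_iff_of_pos_right this).1 h4

theorem NonRedundant.tendsto_level_mul_loading (hE : E.NonRedundant) (M : ℝ) (k : Fin K) :
    Tendsto (fun x => x.2 * E.loading x.1 k) (E.balanced M)
      (𝓝 (E.σ k ^ 2 * E.coef k / E.freq k)) := by
  have h1 := (tendsto_ratio_inv (E := E) M k).mul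
    (((hE.tendsto_loadingCorr M k).const_sub 1).const_mul (E.σ k ^ 2 * E.coef k / E.freq k))
  rw [sub_zero, mul_one, one_mul] at h1
  refine h1.congr' ?_
  filter_upwards [hE.eventually_count_pos M k, (tendsto_level M).eventually_gt_atTop 0]
    with x h2 h3
  have h4 := hE.count_mul_loading x.1 k
  have h5 := hE.freq_pos k
  rw [div_mul_eq_mul_div, ← h4]
  field_simp

theorem NonRedundant.tendsto_level_mul_loadingCorr (hE : E.NonRedundant) (M : ℝ) (k : Fin K) :
    Tendsto (fun x => x.2 * E.loadingCorr x.1 k) (E.balanced M) (𝓝 (E.corrLimit k)) := by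
  have h : Tendsto (fun x => (∑ l, E.signalPrecision k l * (x.2 * E.loading x.1 l)) / E.coef k)
      (E.balanced M) (𝓝 (E.corrLimit k)) :=
    (tendsto_finsetSum _ fun l _ => (hE.tendsto_level_mul_loading M l).const_mul _).div_const _
  refine h.congr fun x => ?_
  rw [loadingCorr, mulVec, dotProduct, mul_div_assoc', Finset.mul_sum]
  congr 1
  exact Finset.sum_congr rfl fun l _ => by ring

/-- The influence of the prior on the variance of signal `k` is of smaller order: `q k / σ k ^ 2`
times this variance tends to `1`. -/
theorem NonRedundant.tendsto_level_mul_varCorr (hE : E.NonRedundant) (M : ℝ) (k : Fin K) :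
    Tendsto (fun x => x.2 * E.varCorr x.1 k) (E.balanced M) (𝓝 (1 / E.freq k)) := by
  obtain ⟨A, hA⟩ := hE.eventually_corr_le M
  have h0 : Tendsto (fun x => (E.signalPrecision *ᵥ E.signalCov x.1 k) k) (E.balanced M) (𝓝 0) :=
    squeeze_zero_norm' (hA.mono fun x h => (h k).2) (tendsto_const_div_level M A)
  have h1 := (tendsto_ratio_inv (E := E) M k).mul ((h0.const_sub 1).const_mul (1 / E.freq k))
  rw [sub_zero, mul_one, one_mul] at h1
  refine h1.congr' ?_
  filter_upwards [hE.eventually_count_pos M k, (tendsto_level M).eventually_gt_atTop 0]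
    with x h2 h3
  have h4 := E.signalCov_equation hE.1 x.1 k k
  rw [if_pos rfl, signalCov_self] at h4
  have h5 := hE.freq_pos k
  have h6 := E.σ_pos k
  have h7 : 1 - (E.signalPrecision *ᵥ E.signalCov x.1 k) k =
      x.1 k / E.σ k ^ 2 * E.signalVar x.1 k := by linarith [h4]
  rw [h7, varCorr]
  field_simp

/-- The reciprocal of the marginal value of source `k`, suitably normalized. -/
def invMarginal (E : Environment K) (q : Fin K → ℕ) (k : Fin K) : ℝ :=
  (q k / E.freq k) ^ 2 * (1 + E.varCorr q k) / (1 - E.loadingCorr q k) ^ 2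

theorem tendsto_obsRank (M : ℝ) (k : Fin K) :
    Tendsto (fun x => obsRank E.freq E.offset k (x.1 k) / x.2) (E.balanced M) (𝓝 1) := by
  have h := (tendsto_ratio (E := E) M k).add
    (tendsto_const_div_level (E := E) M (E.offset k / E.freq k))
  rw [add_zero] at h
  refine h.congr fun x => ?_
  rw [obsRank]; ring

/-- With `u = varCorr` and `p = loadingCorr`, the factor `(1 + u) / (1 - p) ^ 2` is `1 + u + 2 * p`
to first order. Multiplied by the squared level, it contributes `y * (1 / λ k + 2 * corrLimit k)`,
which is the cross term `2 * y * offset k / λ k` of the squared rank. This dictates `offset`. -/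
theorem NonRedundant.tendsto_invMarginal_sub (hE : E.NonRedundant) (M : ℝ) (k : Fin K) :
    Tendsto (fun x => (E.invMarginal x.1 k - obsRank E.freq E.offset k (x.1 k) ^ 2) / x.2)
      (E.balanced M) (𝓝 0) := by
  have hl := hE.freq_pos k
  set b := E.offset k / E.freq k with hb
  have hb' : b = 1 / 2 * (1 / E.freq k) + E.corrLimit k := by
    rw [hb, offset]; field_simp
  have h1 := tendsto_ratio (E := E) M k
  have h2 := hE.tendsto_loadingCorr M k
  have h3 := hE.tendsto_level_mul_loadingCorr M k
  have h4 := hE.tendsto_level_mul_varCorr M k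
  have h5 := (((h4.add (h3.const_mul 2)).sub (h3.mul h2)).div ((h2.const_sub 1).pow 2)
    (by norm_num))
  have h6 := (((h1.pow 2).mul h5).sub (h1.const_mul (2 * b))).sub
    (tendsto_const_div_level (E := E) M (b ^ 2))
  have h7 : (1 : ℝ) ^ 2 * ((1 / E.freq k + 2 * E.corrLimit k - E.corrLimit k * 0) / (1 - 0) ^ 2) -
      2 * b * 1 - 0 = 0 := by rw [hb']; ring
  rw [h7] at h6
  refine h6.congr' ?_
  filter_upwards [(tendsto_level M).eventually_gt_atTop 0,
    h2.eventually (eventually_ne_nhds (zero_ne_one))] with x h8 h9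
  have h10 : 1 - E.loadingCorr x.1 k ≠ 0 := sub_ne_zero.2 h9.symm
  have h11 : obsRank E.freq E.offset k (x.1 k) = x.1 k / E.freq k + b := by
    rw [obsRank, hb]; ring
  rw [h11, invMarginal, Pi.div_apply]
  field_simp
  ring

/-- Ranks exceed `y / 2`, so a difference of `ε` between ranks makes one of at least `ε * y` between
their squares, more than two errors below `ε * y / 4`. -/
theorem NonRedundant.eventually_marginal_lt (hE : E.NonRedundant) (M : ℝ) {ε : ℝ} (hε : 0 < ε) :
    ∀ᶠ x in E.balanced M, ∀ i j,
      obsRank E.freq E.offset j (x.1 j) + ε ≤ obsRank E.freq E.offset i (x.1 i) →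
      E.marginal x.1 i < E.marginal x.1 j := by
  have h1 : ∀ᶠ x in E.balanced M, ∀ k, 1 / 2 < obsRank E.freq E.offset k (x.1 k) / x.2 :=
    eventually_all.2 fun k => (tendsto_obsRank (E := E) M k).eventually (lt_mem_nhds (by norm_num))
  have h2 : ∀ᶠ x in E.balanced M, ∀ k, |(E.invMarginal x.1 k -
      obsRank E.freq E.offset k (x.1 k) ^ 2) / x.2| < ε / 4 :=
    eventually_all.2 fun k => by
      have := (hE.tendsto_invMarginal_sub M k).abs
      rw [abs_zero] at this
      exact this.eventually (gt_mem_nhds (by positivity))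
  have h3 : ∀ᶠ x in E.balanced M, ∀ k, E.loadingCorr x.1 k ≠ 1 :=
    eventually_all.2 fun k =>
      (hE.tendsto_loadingCorr M k).eventually (eventually_ne_nhds (zero_ne_one))
  have h4 : ∀ᶠ x in E.balanced M, ∀ k, (0 : ℝ) < x.1 k :=
    eventually_all.2 fun k => hE.eventually_count_pos M k
  filter_upwards [h1, h2, h3, h4, (tendsto_level M).eventually_gt_atTop 0]
    with x h1 h2 h3 h4 h5 i j hij
  have hmul : ∀ k, E.marginal x.1 k * E.invMarginal x.1 k = E.freqScale ^ 2 := by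
    intro k
    have h6 := hE.marginal_mul x.1 k
    have h7 : (1 - E.loadingCorr x.1 k) ^ 2 ≠ 0 := pow_ne_zero _ (sub_ne_zero.2 (h3 k).symm)
    rw [invMarginal, mul_div_assoc', h6]
    exact mul_div_cancel_right₀ _ h7
  have hpos : ∀ k, 0 < E.invMarginal x.1 k := by
    intro k
    have h6 := varCorr_nonneg (E := E) x.1 k
    have h7 := h4 k
    have h8 := hE.freq_pos k
    have h9 : 0 < (1 - E.loadingCorr x.1 k) ^ 2 := by
      have := sub_ne_zero.2 (h3 k).symm
      positivity
    unfold invMarginal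
    positivity
  have hlt : E.invMarginal x.1 j < E.invMarginal x.1 i := by
    have e1 := (abs_lt.1 (h2 i)).1
    have e2 := (abs_lt.1 (h2 j)).2
    rw [lt_div_iff₀ h5] at e1
    rw [div_lt_iff₀ h5] at e2
    have e3 := h1 i
    have e4 := h1 j
    rw [lt_div_iff₀ h5] at e3 e4
    nlinarith
  have hFs := hE.freqScale_pos
  have hm : E.marginal x.1 i = E.freqScale ^ 2 / E.invMarginal x.1 i := by
    rw [eq_div_iff (hpos i).ne', hmul]
  have hm' : E.marginal x.1 j = E.freqScale ^ 2 / E.invMarginal x.1 j := by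
    rw [eq_div_iff (hpos j).ne', hmul]
  rw [hm, hm']
  exact div_lt_div_of_pos_left (by positivity) (hpos j) hlt

/-- Near a balanced division, the order of the marginal values is the order of the ranks, up to
a small error. -/
theorem NonRedundant.exists_balanced_marginal_lt (hE : E.NonRedundant) (M : ℝ) {ε : ℝ}
    (hε : 0 < ε) : ∃ Y, ∀ (q : Fin K → ℕ) (y : ℝ), Y ≤ y → (∀ k, |q k / E.freq k - y| ≤ M) →
      ∀ i j, obsRank E.freq E.offset j (q j) + ε ≤ obsRank E.freq E.offset i (q i) →
      E.marginal q i < E.marginal q j := by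
  have h := hE.eventually_marginal_lt M hε
  rw [balanced, eventually_inf_principal, eventually_comap] at h
  obtain ⟨Y, hY⟩ := eventually_atTop.1 h
  exact ⟨Y, fun q y hy hq => hY y hy (q, y) rfl hq⟩

end Environment

/-! ### Good times and the replacement of divisions. -/

section

variable {ι : Type*} [Fintype ι] [LinearOrder ι] [Nonempty ι] {a b : ι → ℝ}

/-- The first observation of a source not belonging to the greedy division of `t` observations has
rank at least `t`, up to a constant. -/
theorem exists_le_obsRank_greedy (ha : ∀ k, 0 < a k) (hsum : ∑ k, a k = 1) :
    ∃ C : ℝ, ∀ t k, t ≤ obsRank a b k (greedy (lexRank a b) t k) + C := by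
  set D := ∑ k, |b k| / a k with hD
  have hD' : ∀ k, |b k| / a k ≤ D := fun k =>
    Finset.single_le_sum (f := fun k => |b k| / a k)
      (fun l _ => div_nonneg (abs_nonneg _) (ha l).le) (Finset.mem_univ k)
  refine ⟨D + ∑ l, (1 + |b l|), fun t k => ?_⟩
  set r := obsRank a b k (greedy (lexRank a b) t k) with hr
  have hr0 : 0 ≤ r + D := by
    have h1 : -(|b k| / a k) ≤ r := by
      rw [hr, obsRank, ← neg_div]
      have := ha k
      have := neg_abs_le (b k)
      gcongr
      have : (0 : ℝ) ≤ greedy (lexRank a b) t k := by positivity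
      linarith
    linarith [hD' k]
  -- The last included observation of every source `l` has rank at most `r`. Summed over `l`, with
  -- frequencies adding up to one, this bounds `t`.
  have h : ∀ l, (greedy (lexRank a b) t l : ℝ) ≤ a l * (r + D) + (1 + |b l|) := by
    intro l
    have hal := ha l
    rcases Nat.eq_zero_or_pos (greedy (lexRank a b) t l) with h0 | h0
    · rw [h0]; push_cast; positivity
    · have h1 := obsRank_le_of_lexRank_le (score_le_of_lt_greedy (lexRank_strictMono ha)
        (Nat.sub_lt h0 one_pos) k)
      rw [← hr, obsRank, div_le_iff₀ hal, Nat.cast_pred h0] at h1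
      have h2 : 0 ≤ D := (div_nonneg (abs_nonneg _) hal.le).trans (hD' l)
      have h3 := mul_nonneg hal.le h2
      have h4 := neg_abs_le (b l)
      linarith
  have h1 := Finset.sum_le_sum fun l (_ : l ∈ Finset.univ) => h l
  rw [Finset.sum_add_distrib, ← Finset.sum_mul, hsum, one_mul, ← Nat.cast_sum, sum_greedy] at h1
  linarith

theorem eventually_le_greedy (ha : ∀ k, 0 < a k) (hsum : ∑ k, a k = 1) (R : ℝ) :
    ∃ T, ∀ t ≥ T, ∀ k, R ≤ greedy (lexRank a b) t k := by
  obtain ⟨C, hC⟩ := exists_le_obsRank_greedy (b := b) ha hsum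
  have h : ∀ᶠ t : ℕ in atTop, ∀ k, (R + b k) / a k + C ≤ t :=
    eventually_all.2 fun k => tendsto_natCast_atTop_atTop.eventually_ge_atTop _
  obtain ⟨T, hT⟩ := eventually_atTop.1 h
  refine ⟨T, fun t ht k => ?_⟩
  have h1 := (hT t ht k).trans (hC t k)
  rw [add_le_add_iff_right, obsRank, div_le_div_iff_of_pos_right (ha k)] at h1
  linarith

end

namespace Environment

variable {K : ℕ} [NeZero K] {E : Environment K}

theorem NonRedundant.freq_le_one (hE : E.NonRedundant) (k : Fin K) : E.freq k ≤ 1 := by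
  rw [← hE.sum_freq]
  exact Finset.single_le_sum (fun l _ => (hE.freq_pos l).le) (Finset.mem_univ k)

theorem postCov_add_single_eq_sub (q : Fin K → ℕ) (k : Fin K) :
    E.postCov (q + Pi.single k 1) 0 0 = E.postCov q 0 0 - E.marginal q k :=
  E.postCov_add_single_zero q k

/-- At late times with a gap, an observation of the source of least rank is more valuable than an
observation not belonging to the greedy division. -/
theorem NonRedundant.exists_isGoodTime (hE : E.NonRedundant) (hpos : E.PositiveMarginalValue)
    {ε : ℝ} (hε : 0 < ε) (B : ℕ) : ∃ T, ∀ t ≥ T, HasGap E.freq E.offset ε t →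
      IsGoodTime (lexRank E.freq E.offset) (fun q => E.postCov q 0 0) B t := by
  have ha := hE.freq_pos
  obtain ⟨C, hC⟩ := exists_le_obsRank_greedy (b := E.offset) ha hE.sum_freq
  obtain ⟨M, hM, hM'⟩ := hE.exists_marginal_lt
  set D := ∑ k, |E.offset k| / E.freq k with hD
  have hD' : ∀ k, |E.offset k / E.freq k| ≤ D := fun k => by
    rw [abs_div, abs_of_pos (ha k)]
    exact Finset.single_le_sum (f := fun k => |E.offset k| / E.freq k)
      (fun l _ => div_nonneg (abs_nonneg _) (ha l).le) (Finset.mem_univ k)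
  have hrank : ∀ k m, obsRank E.freq E.offset k m = m / E.freq k + E.offset k / E.freq k :=
    fun k m => add_div _ _ _
  obtain ⟨Y₁, hY₁, hfar⟩ := hM' (2 * D)
  -- `W` will bound the frequency-weighted excess of any rank over the least one when the levels of
  -- `i` and `j` differ by less than `M`; `L` is the resulting distance from a balanced division.
  set W := C + B + ∑ k, E.offset k + M + 2 * D with hW
  set L := |W| * ∑ k, 1 / E.freq k + 2 * D with hL
  obtain ⟨Y₂, hnear⟩ := hE.exists_balanced_marginal_lt L hε
  set B₁ := ⌈max Y₁ Y₂⌉₊ with hB₁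
  obtain ⟨δ, hδ, hδ'⟩ := hpos.exists_le_sub_of_le B₁
  obtain ⟨T, hT⟩ := eventually_le_greedy (b := E.offset) ha hE.sum_freq (E.postCov 0 0 0 / δ + 1)
  refine ⟨T, fun t ht hgap q i hq hi hj => ?_⟩
  set j := minScore (lexRank E.freq E.offset) q with hjdef
  simp only [postCov_add_single_eq_sub]
  refine sub_lt_sub_left ?_ _
  have hmin : ∀ k, obsRank E.freq E.offset j (q j) ≤ obsRank E.freq E.offset k (q k) := fun k =>
    obsRank_le_of_lexRank_le (minScore_le _ q k)
  have hji : obsRank E.freq E.offset j (q j) + ε ≤ obsRank E.freq E.offset i (q i) :=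
    hgap i j _ _ hi hj
  -- Three cases. If `j` was observed rarely, its marginal value is at least `δ`, while that of `i`,
  -- observed often at late times, is smaller. If `j` was observed often and `i` much more often,
  -- `hfar` applies. Otherwise the division is nearly balanced and the ranks decide.
  rcases le_or_gt (q j) B₁ with h1 | h1
  · have h2 := hδ' q j h1
    rw [postCov_add_single_eq_sub, sub_sub_cancel] at h2
    refine lt_of_lt_of_le ?_ h2
    refine (E.marginal_le q i).trans_lt ?_
    have h3 := hE.count_mul_loading_sq_le q i
    have h4 : E.postCov 0 0 0 / δ + 1 ≤ q i :=
      (hT t ht i).trans (by exact_mod_cast hi)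
    have h5 := E.postCov_zero_zero_pos 0
    have h6 : 0 < E.postCov 0 0 0 / δ := by positivity
    have h7 : E.postCov 0 0 0 < δ * q i := by
      have : E.postCov 0 0 0 / δ < q i := by linarith
      rwa [div_lt_iff₀' hδ] at this
    have h8 := pow_pos (E.σ_pos i) 2
    rw [div_lt_iff₀ h8]
    have h9 : (0 : ℝ) < q i := by linarith
    have h10 : q i * E.loading q i ^ 2 < q i * (δ * E.σ i ^ 2) := by
      refine h3.trans_lt ?_
      nlinarith
    exact lt_of_mul_lt_mul_left h10 h9.le
  · have hY : max Y₁ Y₂ ≤ q j / E.freq j := by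
      have h2 : max Y₁ Y₂ ≤ q j := (Nat.le_ceil _).trans (by exact_mod_cast h1.le)
      refine h2.trans ?_
      rw [le_div_iff₀ (ha j)]
      exact mul_le_of_le_one_right (by positivity) (hE.freq_le_one j)
    have hQ : ∀ k, q j / E.freq j - 2 * D ≤ q k / E.freq k := by
      intro k
      have h2 := hmin k
      rw [hrank, hrank] at h2
      have h3 := (abs_le.1 (hD' j)).1
      have h4 := (abs_le.1 (hD' k)).2
      linarith
    rcases le_or_gt (q j / E.freq j + M) (q i / E.freq i) with h2 | h2
    · exact hfar q i j hQ ((le_max_left _ _).trans hY) h2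
    · refine hnear q (q j / E.freq j) ((le_max_right _ _).trans hY) (fun k => ?_) i j hji
      have h3 : (t : ℝ) ≤ obsRank E.freq E.offset j (q j) + M + 2 * D + C := by
        have e1 := hC t i
        have e2 : obsRank E.freq E.offset i (greedy (lexRank E.freq E.offset) t i) ≤
            obsRank E.freq E.offset i (q i) := (obsRank_strictMono ha i).monotone hi
        have e3 := hrank i (q i)
        have e4 := hrank j (q j)
        have e5 := (abs_le.1 (hD' j)).1
        have e6 := (abs_le.1 (hD' i)).2
        linarith
      -- No rank is below that of `j`. The weighted sum of all differences is the number of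
      -- observations, less than `t + B`, plus the offsets, minus the rank of `j`; so each term is
      -- bounded.
      have h4 : E.freq k * (obsRank E.freq E.offset k (q k) - obsRank E.freq E.offset j (q j)) ≤
          W := by
        have e1 : E.freq k * (obsRank E.freq E.offset k (q k) - obsRank E.freq E.offset j (q j)) ≤
            ∑ l, E.freq l *
              (obsRank E.freq E.offset l (q l) - obsRank E.freq E.offset j (q j)) :=
          Finset.single_le_sum (f := fun l => E.freq l *
              (obsRank E.freq E.offset l (q l) - obsRank E.freq E.offset j (q j)))
            (fun l _ => mul_nonneg (ha l).le (sub_nonneg.2 (hmin l))) (Finset.mem_univ k)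
        have e2 : ∀ l, E.freq l * obsRank E.freq E.offset l (q l) = q l + E.offset l := fun l =>
          mul_div_cancel₀ _ (ha l).ne'
        simp only [mul_sub, e2] at e1
        rw [Finset.sum_sub_distrib, Finset.sum_add_distrib, ← Finset.sum_mul, hE.sum_freq,
          one_mul, ← Nat.cast_sum] at e1
        have e3 : ((∑ l, q l : ℕ) : ℝ) < t + B := by exact_mod_cast hq
        rw [mul_sub, e2]
        linarith
      have h5 : obsRank E.freq E.offset k (q k) - obsRank E.freq E.offset j (q j) ≤
          |W| * ∑ l, 1 / E.freq l := by
        have e1 : 1 / E.freq k ≤ ∑ l, 1 / E.freq l :=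
          Finset.single_le_sum (f := fun l => 1 / E.freq l)
            (fun l _ => (one_div_pos.2 (ha l)).le) (Finset.mem_univ k)
        refine le_trans ?_ (mul_le_mul_of_nonneg_left e1 (abs_nonneg W))
        rw [mul_one_div, le_div_iff₀' (ha k)]
        exact h4.trans (le_abs_self W)
      have h6 := hmin k
      rw [hrank, hrank] at h5 h6
      have h7 := abs_le.1 (hD' j)
      have h8 := abs_le.1 (hD' k)
      have h9 : 0 ≤ |W| * ∑ l, 1 / E.freq l :=
        mul_nonneg (abs_nonneg _) (Finset.sum_nonneg fun l _ => (one_div_pos.2 (ha l)).le)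
      rw [abs_le]
      constructor <;> linarith

/-- The greedy divisions are uniquely optimal at a set of times of density `1`. Moreover, every
division can be replaced by a better one, step by step, which at these times is the greedy
division. -/
theorem NonRedundant.exists_division_reduction (hE : E.NonRedundant)
    (hpos : E.PositiveMarginalValue)
    (hirr : ∀ i j : Fin K, i ≠ j → Irrational (E.freq i / E.freq j)) :
    ∃ (A : Set ℕ) (n : ℕ → Fin K → ℕ) (G : ℕ → (Fin K → ℕ) → Fin K → ℕ),
      HasNaturalDensity A 1 ∧ (∀ t ∈ A, ∀ q : Fin K → ℕ, E.IsTOptimal t q ↔ q = n t) ∧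
      (∀ q, G 0 q = 0) ∧
      (∀ r q, ∑ k, q k = r → E.postCov (G r q) 0 0 ≤ E.postCov q 0 0) ∧
      (∀ r q k, ∃ j, G (r + 1) (q + Pi.single k 1) = G r q + Pi.single j 1) ∧
      ∀ t ∈ A, ∀ q, G t q = n t := by
  set score := lexRank E.freq E.offset with hscore
  have hmono : ∀ k, StrictMono (score k) := lexRank_strictMono hE.freq_pos
  have hinj : ∀ k l m m', score k m = score l m' → k = l := lexRank_injective _ _
  -- The number of pairs of sources fixes `B` before `Q` varies: bounded gaps need only `Q = c`,
  -- density one needs every `Q`.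
  set c := Fintype.card (Fin K × Fin K) with hc
  set B := c + 1 with hB
  have hcov : ∀ Q : ℕ, ∃ (T : ℕ) (S : Fin K × Fin K → Set ℕ), (∀ i, IsSeparatedBy Q (S i)) ∧
      ∀ t, T ≤ t → ¬ IsGoodTime score (fun q => E.postCov q 0 0) B t → ∃ i, t ∈ S i := by
    intro Q
    obtain ⟨ε, hε, S, hS, hS'⟩ := exists_gap_cover (b := E.offset) hE.freq_pos hirr Q
    obtain ⟨T, hT⟩ := hE.exists_isGoodTime hpos hε B
    exact ⟨max 1 T, S, hS, fun t ht hbad => hS' t ((le_max_left _ _).trans ht)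
      fun hgap => hbad (hT t ((le_max_right _ _).trans ht) hgap)⟩
  obtain ⟨T₀, S₀, hS₀, hcov₀⟩ := hcov c
  -- Time `0` anchors the replacement at the empty division. Early times are left out so that each
  -- positive time of `A` is followed by another within `B`.
  set A : Set ℕ := {t | t = 0 ∨ max 1 T₀ ≤ t ∧ IsGoodTime score (fun q => E.postCov q 0 0) B t}
    with hA
  have hAcov : ∀ Q : ℕ, ∃ (T : ℕ) (S : Fin K × Fin K → Set ℕ), (∀ i, IsSeparatedBy Q (S i)) ∧
      ∀ t, T ≤ t → t ∉ A → ∃ i, t ∈ S i := by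
    intro Q
    obtain ⟨T, S, hS, hS'⟩ := hcov Q
    refine ⟨max T (max 1 T₀), S, hS, fun t ht hbad => hS' t ((le_max_left _ _).trans ht)
      fun hgood => hbad (Or.inr ⟨(le_max_right _ _).trans ht, hgood⟩)⟩
  have hgood : ∀ t ∈ A, IsGoodTime score (fun q => E.postCov q 0 0) B t := by
    rintro t (rfl | ⟨-, ht⟩)
    · intro q i _ _ h
      simp [greedy] at h
    · exact ht
  have hnext : ∀ t, max 1 T₀ ≤ t → ∃ t' ∈ A, t < t' ∧ t' ≤ t + B := by
    intro t ht
    refine exists_mem_of_cover (T := max 1 T₀) hS₀ (fun s hs hbad => hcov₀ s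
      ((le_max_right _ _).trans hs) fun hgood => hbad (Or.inr ⟨hs, hgood⟩)) ht
  obtain ⟨G, hG1, hG2, hG3⟩ := exists_reduction hmono hinj (A := A) (B := B)
    (f := fun q => E.postCov q 0 0) (Or.inl rfl)
    (by
      obtain ⟨t', h1, h2, -⟩ := hnext _ le_rfl
      exact ⟨t', h1, by omega⟩) hgood
    (by
      rintro t (h | h) h0
      · exact absurd h h0
      · exact hnext t h.1)
  refine ⟨A, greedy score, G, hasNaturalDensity_one_of_cover hAcov, fun t ht q => ?_,
    fun q => hG3 0 (Or.inl rfl) q, hG1, hG2, hG3⟩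
  have hlt : ∀ q : Fin K → ℕ, ∑ k, q k = t → q ≠ greedy score t →
      E.posteriorVariance (greedy score t) < E.posteriorVariance q := by
    intro q hq hne
    rw [posteriorVariance_eq, posteriorVariance_eq]
    exact (hgood t ht).greedy_lt hmono hinj hq hne
  constructor
  · rintro ⟨h1, h2⟩
    by_contra hne
    exact (hlt q h1 hne).not_ge (h2 _ (sum_greedy score t))
  · rintro rfl
    refine ⟨sum_greedy score t, fun p hp => ?_⟩
    by_cases hne : p = greedy score t
    · rw [hne]
    · exact (hlt p hp hne).le

end Environment

/-! ### Gaussian innovations and randomization. -/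

section Products

variable {α β γ δ : Type*} [MeasurableSpace α] [MeasurableSpace β] [MeasurableSpace γ]
  [MeasurableSpace δ]

theorem measurePreserving_prodProdProdComm (a : Measure α) (b : Measure β) (c : Measure γ)
    (d : Measure δ) [SFinite a] [SFinite b] [SFinite c] [SFinite d] :
    MeasurePreserving (fun p : (α × β) × γ × δ => ((p.1.1, p.2.1), (p.1.2, p.2.2)))
      ((a.prod b).prod (c.prod d)) ((a.prod c).prod (b.prod d)) := by
  refine ⟨by fun_prop, Measure.ext_of_lintegral _ fun f hf => ?_⟩
  rw [lintegral_map hf (by fun_prop), lintegral_prod _ (by fun_prop), lintegral_prod _ (by fun_prop),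
    lintegral_prod _ (by fun_prop), lintegral_prod _ (by fun_prop)]
  refine lintegral_congr fun x => ?_
  have h1 : ∀ y, ∫⁻ p : γ × δ, f ((x, p.1), (y, p.2)) ∂(c.prod d) =
      ∫⁻ z, ∫⁻ w, f ((x, z), (y, w)) ∂d ∂c := fun y => lintegral_prod _ (by fun_prop)
  have h2 : ∀ z, ∫⁻ p : β × δ, f ((x, z), p) ∂(b.prod d) =
      ∫⁻ y, ∫⁻ w, f ((x, z), (y, w)) ∂d ∂b := fun z => lintegral_prod _ (by fun_prop)
  simp only [h1, h2]
  exact lintegral_lintegral_swap (by fun_prop)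

end Products

section Gaussian

theorem charFunDual_gaussianReal_zero (v : NNReal) (L : StrongDual ℝ ℝ) :
    charFunDual (gaussianReal 0 v) L = Complex.exp (-(v * (L 1 : ℂ) ^ 2 / 2)) := by
  have h := charFun_gaussianReal (μ := 0) (v := v) (L 1)
  rw [charFun_eq_charFunDual_toDualMap] at h
  have hL : InnerProductSpace.toDualMap ℝ ℝ (L 1) = L := by
    ext; simp
  rw [hL] at h
  rw [h]
  congr 1
  push_cast
  ring

theorem charFunDual_multivariateGaussian_zero {ι : Type*} [Fintype ι] [DecidableEq ι]
    {S : Matrix ι ι ℝ} (hS : S.PosSemidef) (u : EuclideanSpace ℝ ι) :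
    charFunDual (multivariateGaussian 0 S) (InnerProductSpace.toDualMap ℝ _ u) =
      Complex.exp (-((u ⬝ᵥ S.mulVec u : ℝ) / 2 : ℂ)) := by
  rw [← charFun_eq_charFunDual_toDualMap, charFun_multivariateGaussian hS]
  simp

open scoped RealInnerProductSpace in
/-- The innovation of a linear observation of a Gaussian vector is independent of the remaining
error of the vector. -/
theorem measurePreserving_innovation {ι : Type*} [Fintype ι] [DecidableEq ι]
    {S S' : Matrix ι ι ℝ} (hS : S.PosSemidef) (hS' : S'.PosSemidef) (c b : EuclideanSpace ℝ ι)
    {s σ : ℝ} (hs : s ≠ 0) (hsσ : s ^ 2 = σ ^ 2 + c ⬝ᵥ S.mulVec c) (hb : S.mulVec c = s • b.ofLp)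
    (hSS' : S' = S - Matrix.vecMulVec b b) :
    MeasurePreserving
      (fun p : EuclideanSpace ℝ ι × ℝ => (s⁻¹ * (⟪c, p.1⟫ + p.2),
        p.1 - (s⁻¹ * (⟪c, p.1⟫ + p.2)) • b))
      ((multivariateGaussian 0 S).prod (gaussianReal 0 (Real.toNNReal (σ ^ 2))))
      ((gaussianReal 0 1).prod (multivariateGaussian 0 S')) := by
  set Z : EuclideanSpace ℝ ι × ℝ →L[ℝ] ℝ := s⁻¹ • ((innerSL ℝ c).comp
    (ContinuousLinearMap.fst ℝ _ _) + ContinuousLinearMap.snd ℝ _ _) with hZ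
  set T : EuclideanSpace ℝ ι × ℝ →L[ℝ] ℝ × EuclideanSpace ℝ ι :=
    Z.prod (ContinuousLinearMap.fst ℝ _ _ - Z.smulRight b) with hT
  have hTfun : (fun p : EuclideanSpace ℝ ι × ℝ => (s⁻¹ * (⟪c, p.1⟫ + p.2),
      p.1 - (s⁻¹ * (⟪c, p.1⟫ + p.2)) • b)) = T := by
    ext p <;> simp [hT, hZ, mul_add]
  rw [hTfun]
  refine ⟨T.continuous.measurable, Measure.ext_of_charFunDual ?_⟩
  ext L
  rw [charFunDual_map, charFunDual_prod, charFunDual_prod]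
  obtain ⟨u, hu⟩ := (InnerProductSpace.toDual ℝ (EuclideanSpace ℝ ι)).surjective
    (L.comp (ContinuousLinearMap.inr ℝ _ _))
  have hu' : L.comp (ContinuousLinearMap.inr ℝ _ _) = InnerProductSpace.toDualMap ℝ _ u := hu.symm
  set a := (L.comp (ContinuousLinearMap.inl ℝ _ _)) 1 with ha
  have hL : ∀ z x, L (z, x) = a * z + ⟪u, x⟫ := by
    intro z x
    have h1 : L (z, x) = L (z, 0) + L (0, x) := by rw [← map_add]; simp
    have h2 : L (z, 0) = z * L (1, 0) := by
      rw [← smul_eq_mul, ← map_smul]; simp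
    have h3 : L (0, x) = (L.comp (ContinuousLinearMap.inr ℝ _ _)) x := rfl
    rw [h1, h2, h3, hu', ha, mul_comm]
    rfl
  -- The functional `L` has coefficients `a` and `u`; pulled back by the map, it has coefficients `u
  -- + τ • c` on the vector and `τ` on the error. The claim becomes the equality `key` of two
  -- quadratic forms.
  set τ := s⁻¹ * (a - ⟪u, b⟫) with hτ
  have h1 : (L.comp T).comp (ContinuousLinearMap.inl ℝ _ _) =
      InnerProductSpace.toDualMap ℝ _ (u + τ • c) := by
    ext x
    simp only [ContinuousLinearMap.comp_apply, ContinuousLinearMap.inl_apply, hT,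
      ContinuousLinearMap.prod_apply, hL, InnerProductSpace.toDualMap_apply_apply]
    simp [hZ, inner_sub_right, inner_smul_right, inner_add_left, inner_smul_left]
    ring
  have h2 : ((L.comp T).comp (ContinuousLinearMap.inr ℝ _ _)) 1 = τ := by
    simp only [ContinuousLinearMap.comp_apply, ContinuousLinearMap.inr_apply, hT,
      ContinuousLinearMap.prod_apply, hL]
    simp [hZ, inner_smul_right]
    ring
  rw [h1, hu', charFunDual_multivariateGaussian_zero hS, charFunDual_multivariateGaussian_zero hS',
    charFunDual_gaussianReal_zero, charFunDual_gaussianReal_zero, h2, ← ha, ← Complex.exp_add,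
    ← Complex.exp_add, Real.coe_toNNReal _ (sq_nonneg σ)]
  congr 1
  have hub : ⟪u, b⟫ = u.ofLp ⬝ᵥ b.ofLp := by
    simp [PiLp.inner_apply, dotProduct, mul_comm]
  have hsymm : ∀ x y : ι → ℝ, x ⬝ᵥ S.mulVec y = y ⬝ᵥ S.mulVec x := by
    intro x y
    have : S.transpose = S := hS.isHermitian
    rw [Matrix.dotProduct_mulVec, ← Matrix.mulVec_transpose, this, dotProduct_comm]
  have key : (u + τ • c).ofLp ⬝ᵥ S.mulVec (u + τ • c).ofLp + σ ^ 2 * τ ^ 2 =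
      a ^ 2 + u.ofLp ⬝ᵥ S'.mulVec u.ofLp := by
    have e1 : u.ofLp ⬝ᵥ S'.mulVec u.ofLp = u.ofLp ⬝ᵥ S.mulVec u.ofLp - ⟪u, b⟫ ^ 2 := by
      rw [hSS', Matrix.sub_mulVec, dotProduct_sub, Matrix.vecMulVec_mulVec, hub]
      simp only [dotProduct_smul, MulOpposite.smul_eq_mul_unop, MulOpposite.unop_op]
      rw [dotProduct_comm b.ofLp]; ring
    have e2 : u.ofLp ⬝ᵥ S.mulVec c.ofLp = s * ⟪u, b⟫ := by
      rw [hb, dotProduct_smul, hub, smul_eq_mul]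
    have e3 : c.ofLp ⬝ᵥ S.mulVec c.ofLp = s ^ 2 - σ ^ 2 := by linarith
    have e4 : s * τ = a - ⟪u, b⟫ := by rw [hτ]; field_simp
    rw [WithLp.ofLp_add, WithLp.ofLp_smul, Matrix.mulVec_add, Matrix.mulVec_smul, add_dotProduct,
      dotProduct_add, dotProduct_add, smul_dotProduct, smul_dotProduct, dotProduct_smul,
      dotProduct_smul, hsymm c u, e1, e2, e3]
    simp only [smul_eq_mul]
    linear_combination (2 * ⟪u, b⟫ + s * τ + (a - ⟪u, b⟫)) * e4
  have key' := congrArg (fun x : ℝ => (x : ℂ)) key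
  push_cast at key' ⊢
  linear_combination (-1 / 2) * key'

/-- A decomposition of a sum of independent Gaussian variables, with the help of an independent
randomization. -/
theorem measurePreserving_randomize {r r' κ b S : ℝ} (hr : 0 ≤ r) (hr' : 0 ≤ r') (hS : 0 < S)
    (h1 : r + b ^ 2 = S) (h2 : κ ^ 2 + r' = S) :
    MeasurePreserving
      (fun p : (ℝ × ℝ) × ℝ => (κ / S * (p.1.1 + b * p.2) + √(r' / S) * p.1.2,
        (p.1.1 + b * p.2) - κ * (κ / S * (p.1.1 + b * p.2) + √(r' / S) * p.1.2)))
      (((gaussianReal 0 (Real.toNNReal r)).prod (gaussianReal 0 1)).prod (gaussianReal 0 1))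
      ((gaussianReal 0 1).prod (gaussianReal 0 (Real.toNNReal r'))) := by
  -- `U = R + b * Z` has variance `S`. The coefficients give `z` variance `κ ^ 2 / S + r' / S = 1`
  -- and covariance `κ` with `U`, so `U - κ * z` is uncorrelated with `z` and has variance `S - κ ^
  -- 2 = r'`.
  set ρ := √(r' / S) with hρ
  have hρ2 : ρ ^ 2 = r' / S := Real.sq_sqrt (div_nonneg hr' hS.le)
  set R : (ℝ × ℝ) × ℝ →L[ℝ] ℝ := (ContinuousLinearMap.fst ℝ _ _).comp
    (ContinuousLinearMap.fst ℝ _ _) with hR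
  set w : (ℝ × ℝ) × ℝ →L[ℝ] ℝ := (ContinuousLinearMap.snd ℝ _ _).comp
    (ContinuousLinearMap.fst ℝ _ _) with hw
  set U : (ℝ × ℝ) × ℝ →L[ℝ] ℝ := R + b • ContinuousLinearMap.snd ℝ _ _ with hU
  set z : (ℝ × ℝ) × ℝ →L[ℝ] ℝ := (κ / S) • U + ρ • w with hz
  set T : (ℝ × ℝ) × ℝ →L[ℝ] ℝ × ℝ := z.prod (U - κ • z) with hT
  have hTfun : (fun p : (ℝ × ℝ) × ℝ => (κ / S * (p.1.1 + b * p.2) + ρ * p.1.2,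
      (p.1.1 + b * p.2) - κ * (κ / S * (p.1.1 + b * p.2) + ρ * p.1.2))) = T := by
    ext p <;> simp [hT, hz, hU, hR, hw, mul_add]
  rw [hTfun]
  refine ⟨T.continuous.measurable, Measure.ext_of_charFunDual ?_⟩
  ext L
  rw [charFunDual_map, charFunDual_prod, charFunDual_prod, charFunDual_prod]
  simp only [charFunDual_gaussianReal_zero]
  rw [← Complex.exp_add, ← Complex.exp_add, ← Complex.exp_add, Real.coe_toNNReal _ hr,
    Real.coe_toNNReal _ hr']
  set a := L (1, 0) with ha
  set p := L (0, 1) with hp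
  have hL : ∀ x y, L (x, y) = a * x + p * y := by
    intro x y
    have e1 : L (x, y) = x • L (1, 0) + y • L (0, 1) := by
      rw [← map_smul, ← map_smul, ← map_add]; simp
    rw [e1, ha, hp, smul_eq_mul, smul_eq_mul]; ring
  set τ := a - p * κ with hτ
  have hLT : ∀ x y v, L (T ((x, y), v)) = (p + τ * (κ / S)) * (x + b * v) + τ * ρ * y := by
    intro x y v
    have : T ((x, y), v) = (κ / S * (x + b * v) + ρ * y,
        (x + b * v) - κ * (κ / S * (x + b * v) + ρ * y)) := (congrFun hTfun ((x, y), v)).symm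
    rw [this, hL]; ring
  have g1 : (((L.comp T).comp (ContinuousLinearMap.inl ℝ _ _)).comp
      (ContinuousLinearMap.inl ℝ _ _)) 1 = p + τ * (κ / S) := by
    change L (T ((1, 0), 0)) = _
    rw [hLT]; ring
  have g2 : (((L.comp T).comp (ContinuousLinearMap.inl ℝ _ _)).comp
      (ContinuousLinearMap.inr ℝ _ _)) 1 = τ * ρ := by
    change L (T ((0, 1), 0)) = _
    rw [hLT]; ring
  have g3 : ((L.comp T).comp (ContinuousLinearMap.inr ℝ _ _)) 1 = (p + τ * (κ / S)) * b := by
    change L (T ((0, 0), 1)) = _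
    rw [hLT]; ring
  have g4 : (L.comp (ContinuousLinearMap.inl ℝ _ _)) 1 = a := rfl
  have g5 : (L.comp (ContinuousLinearMap.inr ℝ _ _)) 1 = p := rfl
  rw [g1, g2, g3, g4, g5]
  have key : r * (p + τ * (κ / S)) ^ 2 + (τ * ρ) ^ 2 + ((p + τ * (κ / S)) * b) ^ 2 =
      a ^ 2 + r' * p ^ 2 := by
    have e1 : r' = S - κ ^ 2 := by linarith
    have e2 : r = S - b ^ 2 := by linarith
    rw [mul_pow τ, hρ2, e1, e2, hτ]
    field_simp
    ring
  have key' := congrArg (fun x : ℝ => (x : ℂ)) key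
  congr 1
  push_cast at key' ⊢
  linear_combination (-1 / 2) * key'

open scoped RealInnerProductSpace in
-- One period of the simulation: the actual observation yields the innovation `Z` and a new
-- estimation error independent of it. Then `Z`, the old difference of posterior means and the
-- randomization yield the simulated innovation `z` and the new difference.
theorem lintegral_gaussian_step {ι : Type*} [Fintype ι] [DecidableEq ι]
    {S S' : Matrix ι ι ℝ} (hS : S.PosSemidef) (hS' : S'.PosSemidef) (c b : EuclideanSpace ℝ ι)
    {s σ : ℝ} (hs : s ≠ 0) (hsσ : s ^ 2 = σ ^ 2 + c ⬝ᵥ S.mulVec c) (hb : S.mulVec c = s • b.ofLp)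
    (hSS' : S' = S - Matrix.vecMulVec b b) {r r' κ β v : ℝ} (hr : 0 ≤ r) (hr' : 0 ≤ r')
    (hv : 0 < v) (h1 : r + β ^ 2 = v) (h2 : κ ^ 2 + r' = v)
    {g : ℝ × ℝ × EuclideanSpace ℝ ι → ENNReal} (hg : Measurable g) :
    ∫⁻ p : (ℝ × EuclideanSpace ℝ ι) × ℝ × ℝ,
        (fun Z : ℝ => (fun U : ℝ => (fun z : ℝ => g (z, U - κ * z, p.1.2 - Z • b))
          (κ / v * U + √(r' / v) * p.2.2)) (p.1.1 + β * Z)) (s⁻¹ * (⟪c, p.1.2⟫ + p.2.1))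
        ∂(((gaussianReal 0 (Real.toNNReal r)).prod (multivariateGaussian 0 S)).prod
          ((gaussianReal 0 (Real.toNNReal (σ ^ 2))).prod (gaussianReal 0 1))) =
      ∫⁻ z, ∫⁻ p, g (z, p)
        ∂((gaussianReal 0 (Real.toNNReal r')).prod (multivariateGaussian 0 S'))
        ∂(gaussianReal 0 1) := by
  have m1 := (MeasurePreserving.id ((gaussianReal 0 (Real.toNNReal r)).prod
    (multivariateGaussian 0 S))).prod (Measure.measurePreserving_swap
      (μ := gaussianReal 0 (Real.toNNReal (σ ^ 2))) (ν := gaussianReal 0 1))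
  have m2 := measurePreserving_prodProdProdComm (gaussianReal 0 (Real.toNNReal r))
    (multivariateGaussian 0 S) (gaussianReal 0 1) (gaussianReal 0 (Real.toNNReal (σ ^ 2)))
  have m3 := (MeasurePreserving.id ((gaussianReal 0 (Real.toNNReal r)).prod
    (gaussianReal 0 1))).prod (measurePreserving_innovation hS hS' c b hs hsσ hb hSS')
  have m4 := (measurePreserving_prodAssoc ((gaussianReal 0 (Real.toNNReal r)).prod
    (gaussianReal 0 1)) (gaussianReal 0 1) (multivariateGaussian 0 S')).symm
  have m5 := (measurePreserving_randomize hr hr' hv h1 h2).prod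
    (MeasurePreserving.id (multivariateGaussian 0 S'))
  have m6 := measurePreserving_prodAssoc (gaussianReal 0 1) (gaussianReal 0 (Real.toNNReal r'))
    (multivariateGaussian 0 S')
  have m := m6.comp (m5.comp (m4.comp (m3.comp (m2.comp m1))))
  rw [← lintegral_prod _ hg.aemeasurable, ← m.lintegral_comp hg]
  rfl

end Gaussian

/-! ### The simulating strategy. -/

theorem measurable_finInit (t : ℕ) :
    Measurable (fun x : Fin (t + 1) → ℝ => (Fin.init x : Fin t → ℝ)) :=
  measurable_pi_lambda _ fun _ => measurable_pi_apply _

theorem measurable_finSnoc (t : ℕ) :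
    Measurable (fun p : (Fin t → ℝ) × ℝ => (Fin.snoc p.1 p.2 : Fin (t + 1) → ℝ)) := by
  refine measurable_pi_lambda _ fun i => ?_
  induction i using Fin.lastCases with
  | last => simpa using measurable_snd
  | cast i => simpa [Function.comp_def] using (measurable_pi_apply i).comp measurable_fst

namespace Environment

variable {K : ℕ} (E : Environment K)

/-- The observation of source `j` without its error, if the state is `m`. -/
def fit (j : Fin K) (m : EuclideanSpace ℝ (Fin K)) : ℝ := ∑ i, E.C j i * m i

/-- The standard deviation of an observation of source `j`. -/
def scale (q : Fin K → ℕ) (j : Fin K) : ℝ := √(E.obsVar q j)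

/-- The change of the posterior mean caused by a standardized observation of source `j`. -/
def kalmanGain (q : Fin K → ℕ) (j : Fin K) : EuclideanSpace ℝ (Fin K) :=
  WithLp.toLp 2 ((E.scale q j)⁻¹ • (E.postCov q).mulVec (E.C j))

theorem scale_pos (q : Fin K → ℕ) (j : Fin K) : 0 < E.scale q j :=
  Real.sqrt_pos.2 (E.obsVar_pos q j)

theorem scale_sq (q : Fin K → ℕ) (j : Fin K) : E.scale q j ^ 2 = E.obsVar q j :=
  Real.sq_sqrt (E.obsVar_pos q j).le

theorem mulVec_eq_kalmanGain (q : Fin K → ℕ) (j : Fin K) :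
    (E.postCov q).mulVec (E.C j) = E.scale q j • (E.kalmanGain q j).ofLp := by
  rw [kalmanGain, smul_smul, mul_inv_cancel₀ (E.scale_pos q j).ne', one_smul]

theorem postCov_add_single_eq_kalmanGain (q : Fin K → ℕ) (j : Fin K) :
    E.postCov (q + Pi.single j 1) =
      E.postCov q - Matrix.vecMulVec (E.kalmanGain q j).ofLp (E.kalmanGain q j).ofLp := by
  rw [postCov_add_single, mulVec_eq_kalmanGain, Matrix.smul_vecMulVec, Matrix.vecMulVec_smul, smul_smul,
    smul_smul, ← scale_sq]
  have := (E.scale_pos q j).ne'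
  have h : 1 / E.scale q j ^ 2 * (E.scale q j * E.scale q j) = 1 := by field_simp
  rw [mul_assoc, h, one_smul]

variable [NeZero K]

theorem kalmanGain_zero_sq (q : Fin K → ℕ) (j : Fin K) :
    E.kalmanGain q j 0 ^ 2 = E.postCov q 0 0 - E.postCov (q + Pi.single j 1) 0 0 := by
  rw [postCov_add_single_eq_kalmanGain, Matrix.sub_apply, Matrix.vecMulVec_apply]
  ring

variable {E} in
theorem PositiveMarginalValue.kalmanGain_zero_ne_zero (h : E.PositiveMarginalValue) (q : Fin K → ℕ)
    (j : Fin K) : E.kalmanGain q j 0 ≠ 0 :=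
  mul_ne_zero (inv_ne_zero (E.scale_pos q j).ne') (h.loading_ne_zero q j)

open scoped RealInnerProductSpace in
theorem inner_eq_fit (j : Fin K) (m : EuclideanSpace ℝ (Fin K)) :
    ⟪WithLp.toLp 2 (E.C j), m⟫ = E.fit j m := by
  simp [PiLp.inner_apply, fit, mul_comm]

/-- A rule that replaces the division of `t` observations by one with lower posterior variance, and
that can be carried out step by step. -/
structure IsReduction (G : ℕ → (Fin K → ℕ) → Fin K → ℕ) : Prop where
  zero : G 0 0 = 0
  le : ∀ t q, ∑ k, q k = t → E.postCov (G t q) 0 0 ≤ E.postCov q 0 0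
  step : ∀ t q k, ∃ j, G (t + 1) (q + Pi.single k 1) = G t q + Pi.single j 1

theorem isReduction_id : E.IsReduction fun _ q => q :=
  ⟨rfl, fun _ _ _ => le_rfl, fun _ _ k => ⟨k, rfl⟩⟩

open Classical in
/-- The source to be observed instead of source `k`. -/
def nextSource (G : ℕ → (Fin K → ℕ) → Fin K → ℕ) (t : ℕ) (q : Fin K → ℕ) (k : Fin K) : Fin K :=
  -- For a reduction the default value is never taken.
  if h : ∃ j, G (t + 1) (q + Pi.single k 1) = G t q + Pi.single j 1 then h.choose else k

variable {E} in
theorem IsReduction.nextSource_spec {G : ℕ → (Fin K → ℕ) → Fin K → ℕ} (h : E.IsReduction G)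
    (t : ℕ) (q : Fin K → ℕ) (k : Fin K) :
    G (t + 1) (q + Pi.single k 1) = G t q + Pi.single (nextSource G t q k) 1 := by
  rw [nextSource, dif_pos (h.step t q k)]
  exact (h.step t q k).choose_spec

theorem nextSource_id (t : ℕ) (q : Fin K → ℕ) (k : Fin K) :
    nextSource (fun _ q => q) t q k = k := by
  have h : ∃ j, (fun (_ : ℕ) (q : Fin K → ℕ) => q) (t + 1) (q + Pi.single k 1) =
      (fun (_ : ℕ) (q : Fin K → ℕ) => q) t q + Pi.single j 1 := ⟨k, rfl⟩
  have h1 : nextSource (fun _ q => q) t q k = h.choose := by rw [nextSource, dif_pos h]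
  have h2 := h.choose_spec
  rw [← h1] at h2
  have h3 := congrFun (add_left_cancel h2) k
  by_contra hne
  rw [Pi.single_eq_same, Pi.single_eq_of_ne (Ne.symm hne)] at h3
  exact one_ne_zero h3

variable (G : ℕ → (Fin K → ℕ) → Fin K → ℕ)

/-- The reduction of the posterior variance by the replacement of a division. -/
def slack (t : ℕ) (q : Fin K → ℕ) : ℝ := E.postCov q 0 0 - E.postCov (G t q) 0 0

/-- The standardized observation, if the source observed instead of source `k` yields `y` and the
posterior mean is `m`. -/
def innovation (t : ℕ) (q : Fin K → ℕ) (k : Fin K) (m : EuclideanSpace ℝ (Fin K)) (y : ℝ) : ℝ :=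
  (E.scale (G t q) (nextSource G t q k))⁻¹ * (y - E.fit (nextSource G t q k) m)

/-- The standardized observation of source `k` which is simulated, if `Z` is the standardized
observation actually made, `R` is the difference of the two posterior means of the payoff-relevant
state, and `w` is an independent randomization. -/
def simulated (t : ℕ) (q : Fin K → ℕ) (k : Fin K) (R Z w : ℝ) : ℝ :=
  E.kalmanGain q k 0 / (E.kalmanGain q k 0 ^ 2 + E.slack G (t + 1) (q + Pi.single k 1)) *
      (R + E.kalmanGain (G t q) (nextSource G t q k) 0 * Z) +
    √(E.slack G (t + 1) (q + Pi.single k 1) /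
      (E.kalmanGain q k 0 ^ 2 + E.slack G (t + 1) (q + Pi.single k 1))) * w

/-- Without replacement both slacks vanish, and the formula becomes `κ / κ ^ 2 * (κ * Z)`. -/
theorem simulated_id {t : ℕ} {q : Fin K → ℕ} {k : Fin K} (h : E.kalmanGain q k 0 ≠ 0) (Z w : ℝ) :
    E.simulated (fun _ q => q) t q k 0 Z w = Z := by
  simp only [simulated, slack, sub_self, zero_div, Real.sqrt_zero, zero_mul, add_zero, zero_add,
    nextSource_id]
  field_simp

end Environment

namespace Strategy

open Environment

variable {K : ℕ} [NeZero K] {𝒜 : ℕ → Type*} [∀ t, MeasurableSpace (𝒜 t)]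
  (s : Strategy K 𝒜) (E : Environment K) (μ : EuclideanSpace ℝ (Fin K))
  (G : ℕ → (Fin K → ℕ) → Fin K → ℕ)

/-- The division, as a function of the realizations observed. -/
def count : ∀ t : ℕ, (Fin t → ℝ) → Fin K → ℕ
  | 0, _ => 0
  | t + 1, x => count t (Fin.init x) + Pi.single (s.source t (Fin.init x)) 1

/-- The posterior mean, as a function of the realizations observed. -/
def mean : ∀ t : ℕ, (Fin t → ℝ) → EuclideanSpace ℝ (Fin K)
  | 0, _ => μ
  | t + 1, x => mean t (Fin.init x) +
      ((E.scale (s.count t (Fin.init x)) (s.source t (Fin.init x)))⁻¹ *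
        (x (Fin.last t) - E.fit (s.source t (Fin.init x)) (mean t (Fin.init x)))) •
      E.kalmanGain (s.count t (Fin.init x)) (s.source t (Fin.init x))

theorem count_snoc (t : ℕ) (x : Fin t → ℝ) (y : ℝ) :
    s.count (t + 1) (Fin.snoc x y : Fin (t + 1) → ℝ) =
      s.count t x + Pi.single (s.source t x) 1 := by
  simp [count]

theorem mean_snoc (t : ℕ) (x : Fin t → ℝ) (z : ℝ) :
    s.mean E μ (t + 1) (Fin.snoc x (E.fit (s.source t x) (s.mean E μ t x) +
      E.scale (s.count t x) (s.source t x) * z) : Fin (t + 1) → ℝ) =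
      s.mean E μ t x + z • E.kalmanGain (s.count t x) (s.source t x) := by
  have := (E.scale_pos (s.count t x) (s.source t x)).ne'
  simp only [mean, Fin.init_snoc, Fin.snoc_last, add_sub_cancel_left]
  rw [inv_mul_cancel_left₀ this]

theorem sum_count (t : ℕ) (x : Fin t → ℝ) : ∑ k, s.count t x k = t := by
  induction t with
  | zero => simp [count]
  | succ t ih => rw [count, sum_add_single, ih]

theorem measurable_count (t : ℕ) : Measurable (s.count t) := by
  induction t with
  | zero => exact measurable_const
  | succ t ih =>
    have h1 : Measurable fun x : Fin (t + 1) → ℝ =>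
        (s.count t (Fin.init x), s.source t (Fin.init x)) :=
      (ih.comp (measurable_finInit t)).prodMk ((s.measurable_source t).comp (measurable_finInit t))
    exact (measurable_of_countable fun p : (Fin K → ℕ) × Fin K => p.1 + Pi.single p.2 1).comp h1

theorem _root_.Environment.measurable_fit :
    Measurable fun p : Fin K × EuclideanSpace ℝ (Fin K) => E.fit p.1 p.2 :=
  measurable_from_prod_countable_right fun k => by
    unfold Environment.fit; fun_prop

theorem measurable_mean (t : ℕ) : Measurable (s.mean E μ t) := by
  induction t with
  | zero => exact measurable_const
  | succ t ih =>
    have hi := measurable_finInit t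
    have h1 : Measurable fun x : Fin (t + 1) → ℝ =>
        (s.count t (Fin.init x), s.source t (Fin.init x)) :=
      ((s.measurable_count t).comp hi).prodMk ((s.measurable_source t).comp hi)
    have h2 : Measurable fun x : Fin (t + 1) → ℝ =>
        E.fit (s.source t (Fin.init x)) (s.mean E μ t (Fin.init x)) :=
      E.measurable_fit.comp (((s.measurable_source t).comp hi).prodMk (ih.comp hi))
    have h3 := (measurable_of_countable fun p : (Fin K → ℕ) × Fin K => E.scale p.1 p.2).comp h1
    have h4 := (measurable_of_countable fun p : (Fin K → ℕ) × Fin K => E.kalmanGain p.1 p.2).comp h1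
    exact (ih.comp hi).add ((h3.inv.mul ((measurable_pi_apply _).sub h2)).smul h4)

/-- Divisions and sources form a countable set, so an arbitrary dependence on them, through `G` as
well, is measurable. -/
theorem _root_.Environment.measurable_innovation (t : ℕ) :
    Measurable fun a : ((Fin K → ℕ) × Fin K) × EuclideanSpace ℝ (Fin K) × ℝ =>
      E.innovation G t a.1.1 a.1.2 a.2.1 a.2.2 :=
  measurable_from_prod_countable_right fun p => by
    unfold innovation Environment.fit; fun_prop

theorem _root_.Environment.measurable_simulated (t : ℕ) :
    Measurable fun a : ((Fin K → ℕ) × Fin K) × ℝ × ℝ × ℝ =>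
      E.simulated G t a.1.1 a.1.2 a.2.1 a.2.2.1 a.2.2.2 :=
  measurable_from_prod_countable_right fun p => by
    have h (c₁ c₂ c₃ : ℝ) :
        Measurable fun a : ℝ × ℝ × ℝ => c₁ * (a.1 + c₂ * a.2.1) + c₃ * a.2.2 := by fun_prop
    exact h (E.kalmanGain p.1 p.2 0 / (E.kalmanGain p.1 p.2 0 ^ 2 +
        E.slack G (t + 1) (p.1 + Pi.single p.2 1)))
      (E.kalmanGain (G t p.1) (nextSource G t p.1 p.2) 0)
      (√(E.slack G (t + 1) (p.1 + Pi.single p.2 1) /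
        (E.kalmanGain p.1 p.2 0 ^ 2 + E.slack G (t + 1) (p.1 + Pi.single p.2 1))))

/-- One step of the simulation of the strategy: if the simulated realizations and the actual
posterior mean are `p`, then the new observation is `y` and the randomization is `w`. -/
def mimicStep (t : ℕ) (p : (Fin t → ℝ) × EuclideanSpace ℝ (Fin K)) (y w : ℝ) :
    (Fin (t + 1) → ℝ) × EuclideanSpace ℝ (Fin K) :=
  (Fin.snoc (α := fun _ => ℝ) p.1 (E.fit (s.source t p.1) (s.mean E μ t p.1) +
      E.scale (s.count t p.1) (s.source t p.1) *
        E.simulated G t (s.count t p.1) (s.source t p.1) (p.2 0 - s.mean E μ t p.1 0)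
          (E.innovation G t (s.count t p.1) (s.source t p.1) p.2 y) w),
    p.2 + E.innovation G t (s.count t p.1) (s.source t p.1) p.2 y •
      E.kalmanGain (G t (s.count t p.1)) (nextSource G t (s.count t p.1) (s.source t p.1)))

theorem measurable_mimicStep (t : ℕ) :
    Measurable fun a : ((Fin t → ℝ) × EuclideanSpace ℝ (Fin K)) × ℝ × ℝ =>
      s.mimicStep E μ G t a.1 a.2.1 a.2.2 := by
  have e : Measurable fun a : ((Fin t → ℝ) × EuclideanSpace ℝ (Fin K)) × ℝ × ℝ => a.1.1 :=
    measurable_fst.fst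
  have hq := (s.measurable_count t).comp e
  have hk := (s.measurable_source t).comp e
  have hm := (s.measurable_mean E μ t).comp e
  have hp : Measurable fun a : ((Fin t → ℝ) × EuclideanSpace ℝ (Fin K)) × ℝ × ℝ => a.1.2 :=
    measurable_fst.snd
  have hqk := hq.prodMk hk
  have hZ := (E.measurable_innovation G t).comp (hqk.prodMk (hp.prodMk measurable_snd.fst))
  have hc : Measurable fun x : EuclideanSpace ℝ (Fin K) => x 0 := by fun_prop
  have hR := (hc.comp hp).sub (hc.comp hm)
  have hz := (E.measurable_simulated G t).comp (hqk.prodMk (hR.prodMk (hZ.prodMk measurable_snd.snd)))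
  have hscale := (measurable_of_countable fun p : (Fin K → ℕ) × Fin K =>
    E.scale p.1 p.2).comp hqk
  have hgain := (measurable_of_countable fun p : (Fin K → ℕ) × Fin K =>
    E.kalmanGain (G t p.1) (nextSource G t p.1 p.2)).comp hqk
  have hfit := E.measurable_fit.comp (hk.prodMk hm)
  exact ((measurable_finSnoc t).comp (e.prodMk (hfit.add (hscale.mul hz)))).prodMk
    (hp.add (hZ.smul hgain))

/-- The simulated realizations and the actual posterior mean, as functions of the randomizations
`w` and the actual realizations. -/
def mimic (w : ℕ → ℝ) : ∀ t : ℕ, (Fin t → ℝ) → (Fin t → ℝ) × EuclideanSpace ℝ (Fin K)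
  | 0, _ => (Fin.elim0, μ)
  | t + 1, y => s.mimicStep E μ G t (mimic w t (Fin.init y)) (y (Fin.last t)) (w t)

theorem measurable_mimic (w : ℕ → ℝ) (t : ℕ) : Measurable (s.mimic E μ G w t) := by
  induction t with
  | zero => exact measurable_const
  | succ t ih =>
    exact (s.measurable_mimicStep E μ G t).comp ((ih.comp (measurable_finInit t)).prodMk
      ((measurable_pi_apply _).prodMk measurable_const))

/-- The strategy that carries out the replaced divisions, while simulating the realizations of the
given strategy and taking its actions. -/
def mimicStrategy (w : ℕ → ℝ) : Strategy K 𝒜 where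
  source t y := nextSource G t (s.count t (s.mimic E μ G w t y).1)
    (s.source t (s.mimic E μ G w t y).1)
  measurable_source t :=
    (measurable_of_countable fun p : (Fin K → ℕ) × Fin K => nextSource G t p.1 p.2).comp
      (((s.measurable_count t).comp (s.measurable_mimic E μ G w t).fst).prodMk
        ((s.measurable_source t).comp (s.measurable_mimic E μ G w t).fst))
  action t y := s.action t (s.mimic E μ G w (t + 1) y).1
  measurable_action t := (s.measurable_action t).comp (s.measurable_mimic E μ G w (t + 1)).fst

/-- The simulated realizations and the actual posterior mean, at a sample point. -/
def mimicState (t : ℕ) (ω : Sample K) (w : ℕ → ℝ) : (Fin t → ℝ) × EuclideanSpace ℝ (Fin K) :=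
  s.mimic E μ G w t ((s.mimicStrategy E μ G w).history E ω t)

theorem mimicState_zero (ω : Sample K) (w : ℕ → ℝ) :
    s.mimicState E μ G 0 ω w = (Fin.elim0, μ) := rfl

/-- The source observed by the simulating strategy. -/
def mimicSource (t : ℕ) (x : Fin t → ℝ) : Fin K := nextSource G t (s.count t x) (s.source t x)

theorem measurable_mimicSource (t : ℕ) : Measurable (s.mimicSource G t) :=
  (measurable_of_countable fun p : (Fin K → ℕ) × Fin K => nextSource G t p.1 p.2).comp
    ((s.measurable_count t).prodMk (s.measurable_source t))

theorem _root_.Environment.measurable_signal_source {α : Type*} [MeasurableSpace α] {t : ℕ}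
    {f : α → Fin K} (hf : Measurable f) :
    Measurable fun a : α × Sample K => E.signal (f a.1) t a.2 :=
  (measurable_from_prod_countable_right (f := fun a : Fin K × Sample K => E.signal a.1 t a.2)
    fun k => E.measurable_signal k t).comp ((hf.comp measurable_fst).prodMk measurable_snd)

theorem mimicState_succ (t : ℕ) (ω : Sample K) (w : ℕ → ℝ) :
    s.mimicState E μ G (t + 1) ω w = s.mimicStep E μ G t (s.mimicState E μ G t ω w)
      (E.signal (s.mimicSource G t (s.mimicState E μ G t ω w).1) t ω) (w t) := by
  rw [mimicState, history, mimic, Fin.init_snoc, Fin.snoc_last]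
  rfl

theorem measurable_comp_step {α β γ δ : Type*} [MeasurableSpace α] [MeasurableSpace β]
    [MeasurableSpace γ] [MeasurableSpace δ] {f : α × β → ℝ → ℝ → γ} {g : α → δ → ℝ}
    (hf : Measurable fun a : (α × β) × ℝ × ℝ => f a.1 a.2.1 a.2.2)
    (hg : Measurable fun a : α × δ => g a.1 a.2) (t : ℕ) {X : δ × (ℕ → ℝ) → α × β}
    (hX : Measurable X) : Measurable fun p => f (X p) (g (X p).1 p.1) (p.2 t) :=
  hf.comp (hX.prodMk ((hg.comp (hX.fst.prodMk measurable_fst)).prodMk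
    ((measurable_pi_apply t).comp measurable_snd)))

theorem measurable_mimicState (t : ℕ) :
    Measurable fun p : Sample K × (ℕ → ℝ) => s.mimicState E μ G t p.1 p.2 := by
  induction t with
  | zero => exact measurable_const
  | succ t ih =>
    simp only [mimicState_succ]
    have hf := s.measurable_mimicStep E μ G t
    have hg := E.measurable_signal_source (t := t) (s.measurable_mimicSource G t)
    exact measurable_comp_step (f := s.mimicStep E μ G t)
      (g := fun x ω => E.signal (s.mimicSource G t x) t ω)
      (X := fun p => s.mimicState E μ G t p.1 p.2) hf hg t ih

/-- The state at time `t` does not depend on the later errors. -/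
theorem mimicState_congr (t : ℕ) {ω ω' : Sample K} {w w' : ℕ → ℝ} (h0 : ω.1 = ω'.1)
    (h1 : ∀ n < t, ∀ k, ω.2 (k, n) = ω'.2 (k, n)) (h2 : ∀ n < t, w n = w' n) :
    s.mimicState E μ G t ω w = s.mimicState E μ G t ω' w' := by
  induction t with
  | zero => rfl
  | succ t ih =>
    rw [mimicState_succ, mimicState_succ, ih (fun n hn => h1 n (by omega))
      (fun n hn => h2 n (by omega)), h2 t (by omega)]
    simp only [signal]
    rw [h0, h1 t (by omega)]

theorem division_eq_count (ω : Sample K) (t : ℕ) :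
    s.division E ω t = s.count t (s.history E ω t) := by
  induction t with
  | zero => ext k; simp [division, count]
  | succ t ih =>
    rw [history, count_snoc, ← ih]
    ext k
    rw [division, Finset.range_add_one, Finset.filter_insert, Pi.add_apply, division]
    by_cases h : s.source t (s.history E ω t) = k
    · subst h
      rw [if_pos rfl, Finset.card_insert_of_notMem (by simp), Pi.single_eq_same]
    · rw [if_neg h, Pi.single_eq_of_ne (Ne.symm h), add_zero]

theorem division_succ (ω : Sample K) (t : ℕ) :
    s.division E ω (t + 1) =
      s.division E ω t + Pi.single (s.source t (s.history E ω t)) 1 := by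
  rw [division_eq_count, division_eq_count, history, count_snoc]

theorem mimicState_succ_count (t : ℕ) (ω : Sample K) (w : ℕ → ℝ) :
    s.count (t + 1) (s.mimicState E μ G (t + 1) ω w).1 =
      s.count t (s.mimicState E μ G t ω w).1 +
        Pi.single (s.source t (s.mimicState E μ G t ω w).1) 1 := by
  rw [mimicState_succ]
  exact s.count_snoc _ _ _

variable {E G} in
/-- The division of the simulating strategy is the replaced division. -/
theorem division_mimicStrategy (hG : E.IsReduction G) (ω : Sample K) (w : ℕ → ℝ) (t : ℕ) :
    (s.mimicStrategy E μ G w).division E ω t =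
      G t (s.count t (s.mimicState E μ G t ω w).1) := by
  induction t with
  | zero => rw [division_eq_count]; exact hG.zero.symm
  | succ t ih =>
    rw [division_succ, ih, mimicState_succ_count, hG.nextSource_spec]
    rfl

variable {E} in
/-- Without a replacement of divisions, the simulation reproduces the strategy. -/
theorem mimicState_id (hpos : E.PositiveMarginalValue) (t : ℕ) (ω : Sample K) (w : ℕ → ℝ) :
    s.mimicState E μ (fun _ q => q) t ω w =
      (s.history E ω t, s.mean E μ t (s.history E ω t)) := by
  induction t with
  | zero => exact Prod.ext (Subsingleton.elim _ _) rfl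
  | succ t ih =>
    rw [mimicState_succ, ih, mimicSource]
    simp only [mimicStep, nextSource_id, sub_self,
      E.simulated_id (hpos.kalmanGain_zero_ne_zero _ _)]
    have h := (E.scale_pos (s.count t (s.history E ω t)) (s.source t (s.history E ω t))).ne'
    rw [innovation, nextSource_id, mul_inv_cancel_left₀ h, add_sub_cancel]
    refine Prod.ext rfl ?_
    simp only [mean, history, Fin.init_snoc, Fin.snoc_last]

end Strategy

/-! ### The joint law of the simulated realizations and the state. -/

section Independence

theorem indepFun_prodMk_prod {Ω Ω' α β γ δ : Type*} [MeasurableSpace Ω] [MeasurableSpace Ω']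
    [MeasurableSpace α] [MeasurableSpace β] [MeasurableSpace γ] [MeasurableSpace δ]
    {P : Measure Ω} {Q : Measure Ω'} [IsProbabilityMeasure P] [IsProbabilityMeasure Q]
    {f : Ω → α} {g : Ω → β} {f' : Ω' → γ} {g' : Ω' → δ} (hf : Measurable f) (hg : Measurable g)
    (hf' : Measurable f') (hg' : Measurable g') (h : IndepFun f g P) (h' : IndepFun f' g' Q) :
    IndepFun (fun p : Ω × Ω' => (f p.1, f' p.2)) (fun p => (g p.1, g' p.2)) (P.prod Q) := by
  have := Measure.isProbabilityMeasure_map (μ := P) hf.aemeasurable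
  have := Measure.isProbabilityMeasure_map (μ := P) hg.aemeasurable
  have := Measure.isProbabilityMeasure_map (μ := Q) hf'.aemeasurable
  have := Measure.isProbabilityMeasure_map (μ := Q) hg'.aemeasurable
  rw [indepFun_iff_map_prod_eq_prod_map_map hf.aemeasurable hg.aemeasurable] at h
  rw [indepFun_iff_map_prod_eq_prod_map_map hf'.aemeasurable hg'.aemeasurable] at h'
  rw [indepFun_iff_map_prod_eq_prod_map_map (by fun_prop) (by fun_prop)]
  have h1 := measurePreserving_prodProdProdComm (P.map f) (P.map g) (Q.map f') (Q.map g')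
  rw [← h, ← h', Measure.map_prod_map _ _ (by fun_prop) (by fun_prop)] at h1
  have h2 := h1.map_eq
  rw [Measure.map_map (by fun_prop) (by fun_prop)] at h2
  rw [Measure.map_prod_map P Q hf hf'] at h2
  rw [Measure.map_prod_map P Q hg hg'] at h2
  exact h2

/-- Under an infinite product measure, the coordinates in two disjoint finite sets are
independent. -/
theorem indepFun_restrict_infinitePi {ι : Type*} {P : ι → Measure ℝ}
    [∀ i, IsProbabilityMeasure (P i)] {S T : Finset ι} (h : Disjoint S T) :
    IndepFun (fun (x : ι → ℝ) (i : S) => x i) (fun x (i : T) => x i) (Measure.infinitePi P) :=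
  (iIndepFun_infinitePi (P := P) (X := fun _ x => x) fun _ => measurable_id).indepFun_finset S T h
    fun i => measurable_pi_apply i

end Independence

namespace Strategy

open Environment

variable {K : ℕ} [NeZero K] {𝒜 : ℕ → Type*} [∀ t, MeasurableSpace (𝒜 t)]
  (s : Strategy K 𝒜) (E : Environment K) (μ : EuclideanSpace ℝ (Fin K))
  (G : ℕ → (Fin K → ℕ) → Fin K → ℕ)

/-- The law of a sample point together with independent randomizations. -/
def _root_.Environment.extLaw : Measure (Sample K × (ℕ → ℝ)) :=
  (E.law μ).prod (Measure.infinitePi fun _ : ℕ => gaussianReal 0 1)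

instance : IsProbabilityMeasure (E.extLaw μ) := by
  unfold extLaw; infer_instance

/-- The errors and the randomization of period `t`. -/
def _root_.Environment.periodNoise (t : ℕ) (p : Sample K × (ℕ → ℝ)) : (Fin K → ℝ) × ℝ :=
  (fun k => p.1.2 (k, t), p.2 t)

theorem _root_.Environment.measurable_periodNoise (t : ℕ) :
    Measurable (periodNoise (K := K) t) := by
  unfold periodNoise; fun_prop

/-- Whatever the source, period `t` uses its potential observation number `t`, so the noise is
fresh. The state at `t` is a function of the state vector and finitely many earlier coordinates,
extended by zero. -/
theorem indepFun_mimicState (t : ℕ) :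
    IndepFun (fun p : Sample K × (ℕ → ℝ) => (s.mimicState E μ G t p.1 p.2, p.1.1))
      (periodNoise t) (E.extLaw μ) := by
  classical
  set S : Finset (Fin K × ℕ) := Finset.univ ×ˢ Finset.range t with hS
  set T : Finset (Fin K × ℕ) := Finset.univ ×ˢ {t} with hT
  have hST : Disjoint S T := by
    rw [Finset.disjoint_left]
    rintro ⟨k, n⟩ h1 h2
    simp [hS, hT] at h1 h2
    omega
  have hST' : Disjoint (Finset.range t) {t} := by simp
  have h1 := indepFun_prodMk_prod (P := multivariateGaussian μ E.V)
    (f := id) (g := fun _ => ()) measurable_id measurable_const (by fun_prop) (by fun_prop)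
    (indepFun_const_right _ _) (indepFun_restrict_infinitePi (P := fun p : Fin K × ℕ =>
      gaussianReal 0 (Real.toNNReal (E.σ p.1 ^ 2))) hST)
  have h2 := indepFun_prodMk_prod (by fun_prop) (by fun_prop) (by fun_prop) (by fun_prop)
    h1 (indepFun_restrict_infinitePi (P := fun _ : ℕ => gaussianReal 0 1) hST')
  have hext1 : Measurable fun (x : S → ℝ) (p : Fin K × ℕ) => if h : p ∈ S then x ⟨p, h⟩ else 0 := by
    refine measurable_pi_lambda _ fun p => ?_
    split_ifs <;> fun_prop
  have hext2 : Measurable fun (x : Finset.range t → ℝ) (n : ℕ) =>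
      if h : n ∈ Finset.range t then x ⟨n, h⟩ else 0 := by
    refine measurable_pi_lambda _ fun p => ?_
    split_ifs <;> fun_prop
  have hφ : Measurable fun a : (EuclideanSpace ℝ (Fin K) × (S → ℝ)) × (Finset.range t → ℝ) =>
      (s.mimicState E μ G t (a.1.1, fun p => if h : p ∈ S then a.1.2 ⟨p, h⟩ else 0)
        (fun n => if h : n ∈ Finset.range t then a.2 ⟨n, h⟩ else 0), a.1.1) :=
    ((s.measurable_mimicState E μ G t).comp ((measurable_fst.fst.prodMk
      (hext1.comp measurable_fst.snd)).prodMk (hext2.comp measurable_snd))).prodMk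
      measurable_fst.fst
  have hψ : Measurable fun a : (Unit × (T → ℝ)) × (({t} : Finset ℕ) → ℝ) =>
      ((fun k => a.1.2 ⟨(k, t), by simp [hT]⟩, a.2 ⟨t, by simp⟩) : (Fin K → ℝ) × ℝ) := by
    fun_prop
  have h3 := h2.comp hφ hψ
  convert h3 using 1
  · funext p
    refine Prod.ext (s.mimicState_congr E μ G t rfl (fun n hn k => ?_) fun n hn => ?_) rfl
    · have : (k, n) ∈ S := by simp [hS, hn]
      simp [this]
    · simp [hn]
  · rfl
  · rfl

/-- The law of the two components of the estimation error, if the division `q` is replaced. -/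
def _root_.Environment.residualLaw (t : ℕ) (q : Fin K → ℕ) :
    Measure (ℝ × EuclideanSpace ℝ (Fin K)) :=
  (gaussianReal 0 (Real.toNNReal (E.slack G t q))).prod
    (multivariateGaussian 0 (E.postCov (G t q)))

instance (t : ℕ) (q : Fin K → ℕ) : IsProbabilityMeasure (E.residualLaw G t q) := by
  unfold residualLaw; infer_instance

/-- The residual laws as a kernel. -/
def residualKernel (t : ℕ) : Kernel (Fin t → ℝ) (ℝ × EuclideanSpace ℝ (Fin K)) :=
  (Kernel.ofFunOfCountable (E.residualLaw G t)).comap (s.count t) (s.measurable_count t)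

theorem residualKernel_apply (t : ℕ) (x : Fin t → ℝ) :
    s.residualKernel E G t x = E.residualLaw G t (s.count t x) := rfl

instance (t : ℕ) : IsMarkovKernel (s.residualKernel E G t) :=
  ⟨fun x => by rw [residualKernel_apply]; infer_instance⟩

/-- The realizations after period `t`, if the standardized observation of this period is `z`. -/
def extend (t : ℕ) (x : Fin t → ℝ) (z : ℝ) : Fin (t + 1) → ℝ :=
  Fin.snoc (α := fun _ => ℝ) x (E.fit (s.source t x) (s.mean E μ t x) +
    E.scale (s.count t x) (s.source t x) * z)

theorem measurable_extend (t : ℕ) :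
    Measurable fun p : (Fin t → ℝ) × ℝ => s.extend E μ t p.1 p.2 := by
  have h1 := E.measurable_fit.comp ((s.measurable_source t).prodMk (s.measurable_mean E μ t))
  have h2 := (measurable_of_countable fun p : (Fin K → ℕ) × Fin K => E.scale p.1 p.2).comp
    ((s.measurable_count t).prodMk (s.measurable_source t))
  exact (measurable_finSnoc t).comp (measurable_fst.prodMk
    ((h1.comp measurable_fst).add ((h2.comp measurable_fst).mul measurable_snd)))

theorem count_extend (t : ℕ) (x : Fin t → ℝ) (z : ℝ) :
    s.count (t + 1) (s.extend E μ t x z) = s.count t x + Pi.single (s.source t x) 1 :=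
  s.count_snoc t x _

/-- The law of the first `t` realizations. -/
def realizationLaw : ∀ t : ℕ, Measure (Fin t → ℝ)
  | 0 => Measure.dirac Fin.elim0
  | t + 1 => ((realizationLaw t).prod (gaussianReal 0 1)).map fun p => s.extend E μ t p.1 p.2

instance (t : ℕ) : IsProbabilityMeasure (s.realizationLaw E μ t) := by
  induction t with
  | zero => unfold realizationLaw; infer_instance
  | succ t ih =>
    unfold realizationLaw
    exact Measure.isProbabilityMeasure_map (s.measurable_extend E μ t).aemeasurable

/-- The simulated realizations, the difference of the posterior means of the payoff-relevant state,
and the actual estimation error. -/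
def mimicError (t : ℕ) (p : Sample K × (ℕ → ℝ)) :
    (Fin t → ℝ) × ℝ × EuclideanSpace ℝ (Fin K) :=
  ((s.mimicState E μ G t p.1 p.2).1,
    (s.mimicState E μ G t p.1 p.2).2 0 - s.mean E μ t (s.mimicState E μ G t p.1 p.2).1 0,
    p.1.1 - (s.mimicState E μ G t p.1 p.2).2)

/-- `mimicError` as a function of the state. -/
def errorOf (t : ℕ)
    (a : ((Fin t → ℝ) × EuclideanSpace ℝ (Fin K)) × EuclideanSpace ℝ (Fin K)) :
    (Fin t → ℝ) × ℝ × EuclideanSpace ℝ (Fin K) :=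
  (a.1.1, a.1.2 0 - s.mean E μ t a.1.1 0, a.2 - a.1.2)

theorem measurable_errorOf (t : ℕ) : Measurable (s.errorOf E μ t) := by
  have hc : Measurable fun x : EuclideanSpace ℝ (Fin K) => x 0 := by fun_prop
  exact measurable_fst.fst.prodMk (((hc.comp measurable_fst.snd).sub
    (hc.comp ((s.measurable_mean E μ t).comp measurable_fst.fst))).prodMk
    (measurable_snd.sub measurable_fst.snd))

theorem measurable_mimicError (t : ℕ) : Measurable (s.mimicError E μ G t) :=
  (s.measurable_errorOf E μ t).comp ((s.measurable_mimicState E μ G t).prodMk measurable_fst.fst)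

/-- The change of `mimicError` in one period. -/
def errorStep (t : ℕ) (a : (Fin t → ℝ) × ℝ × EuclideanSpace ℝ (Fin K))
    (n : (Fin K → ℝ) × ℝ) : (Fin (t + 1) → ℝ) × ℝ × EuclideanSpace ℝ (Fin K) :=
  -- The nested abstractions follow the integrand of `lintegral_gaussian_step`, so that the two
  -- agree by unfolding.
  (fun Z : ℝ => (fun z : ℝ => (s.extend E μ t a.1 z,
      (a.2.1 + E.kalmanGain (G t (s.count t a.1)) (s.mimicSource G t a.1) 0 * Z) -
        E.kalmanGain (s.count t a.1) (s.source t a.1) 0 * z,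
      a.2.2 - Z • E.kalmanGain (G t (s.count t a.1)) (s.mimicSource G t a.1)))
    (E.simulated G t (s.count t a.1) (s.source t a.1) a.2.1 Z n.2))
  ((E.scale (G t (s.count t a.1)) (s.mimicSource G t a.1))⁻¹ *
    (E.fit (s.mimicSource G t a.1) a.2.2 + n.1 (s.mimicSource G t a.1)))

theorem measurable_errorStep (t : ℕ) :
    Measurable fun p : ((Fin t → ℝ) × ℝ × EuclideanSpace ℝ (Fin K)) × (Fin K → ℝ) × ℝ =>
      s.errorStep E μ G t p.1 p.2 := by
  have hx : Measurable fun p : ((Fin t → ℝ) × ℝ × EuclideanSpace ℝ (Fin K)) × (Fin K → ℝ) × ℝ =>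
      p.1.1 := measurable_fst.fst
  have hR : Measurable fun p : ((Fin t → ℝ) × ℝ × EuclideanSpace ℝ (Fin K)) × (Fin K → ℝ) × ℝ =>
      p.1.2.1 := measurable_fst.snd.fst
  have hD : Measurable fun p : ((Fin t → ℝ) × ℝ × EuclideanSpace ℝ (Fin K)) × (Fin K → ℝ) × ℝ =>
      p.1.2.2 := measurable_fst.snd.snd
  have hq := (s.measurable_count t).comp hx
  have hk := (s.measurable_source t).comp hx
  have hj := (s.measurable_mimicSource G t).comp hx
  have he : Measurable fun a : Fin K × (Fin K → ℝ) => a.2 a.1 :=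
    measurable_from_prod_countable_right fun k => measurable_pi_apply k
  have hscale := (measurable_of_countable fun p : (Fin K → ℕ) × Fin K =>
    (E.scale (G t p.1) p.2)⁻¹).comp (hq.prodMk hj)
  have hZ := hscale.mul ((E.measurable_fit.comp (hj.prodMk hD)).add
    (he.comp (hj.prodMk measurable_snd.fst)))
  have hz := (E.measurable_simulated G t).comp
    ((hq.prodMk hk).prodMk (hR.prodMk (hZ.prodMk measurable_snd.snd)))
  have hb := (measurable_of_countable fun p : (Fin K → ℕ) × Fin K =>
    E.kalmanGain (G t p.1) p.2).comp (hq.prodMk hj)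
  have hb0 := (measurable_of_countable fun p : (Fin K → ℕ) × Fin K =>
    E.kalmanGain (G t p.1) p.2 0).comp (hq.prodMk hj)
  have hκ := (measurable_of_countable fun p : (Fin K → ℕ) × Fin K =>
    E.kalmanGain p.1 p.2 0).comp (hq.prodMk hk)
  exact ((s.measurable_extend E μ t).comp (hx.prodMk hz)).prodMk
    (((hR.add (hb0.mul hZ)).sub (hκ.mul hz)).prodMk (hD.sub (hZ.smul hb)))

/-- The state vector and the actual posterior mean enter the innovation only through their
difference, so the error evolves by itself, driven by the noise of the period. -/
theorem mimicError_succ (t : ℕ) (p : Sample K × (ℕ → ℝ)) :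
    s.mimicError E μ G (t + 1) p =
      s.errorStep E μ G t (s.mimicError E μ G t p) (periodNoise t p) := by
  rcases hst : s.mimicState E μ G t p.1 p.2 with ⟨x, m⟩
  have hZ : (E.scale (G t (s.count t x)) (s.mimicSource G t x))⁻¹ *
      (E.fit (s.mimicSource G t x) (p.1.1 - m) + p.1.2 (s.mimicSource G t x, t)) =
      E.innovation G t (s.count t x) (s.source t x) m
        (E.signal (s.mimicSource G t x) t p.1) := by
    rw [innovation, signal, fit, fit]
    simp only [PiLp.sub_apply, mul_sub, Finset.sum_sub_distrib]
    rw [mimicSource]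
    ring
  rw [mimicError, mimicError, mimicState_succ, hst, errorStep]
  simp only [mimicStep, periodNoise]
  rw [hZ, mean_snoc]
  refine Prod.ext rfl (Prod.ext ?_ ?_)
  · simp only [PiLp.add_apply, PiLp.smul_apply, smul_eq_mul, mimicSource]
    ring
  · simp only [mimicSource]
    rw [sub_add_eq_sub_sub]

end Strategy

namespace Strategy

open Environment

variable {K : ℕ} [NeZero K] {𝒜 : ℕ → Type*} [∀ t, MeasurableSpace (𝒜 t)]
  (s : Strategy K 𝒜) {E : Environment K} (μ : EuclideanSpace ℝ (Fin K))
  {G : ℕ → (Fin K → ℕ) → Fin K → ℕ}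

theorem _root_.Environment.measurePreserving_noise (t : ℕ) (j : Fin K) :
    MeasurePreserving (fun n : (Fin K → ℝ) × ℝ => (n.1 j, n.2)) ((E.extLaw μ).map (periodNoise t))
      ((gaussianReal 0 (Real.toNNReal (E.σ j ^ 2))).prod (gaussianReal 0 1)) := by
  refine ⟨by fun_prop, ?_⟩
  rw [Measure.map_map (by fun_prop) (measurable_periodNoise t)]
  have h := ((measurePreserving_eval_infinitePi (fun p : Fin K × ℕ =>
    gaussianReal 0 (Real.toNNReal (E.σ p.1 ^ 2))) (j, t)).comp (measurePreserving_snd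
      (μ := multivariateGaussian μ E.V))).prod
    (measurePreserving_eval_infinitePi (fun _ : ℕ => gaussianReal 0 1) t)
  exact h.map_eq

theorem lintegral_errorStep (hpos : E.PositiveMarginalValue) (hG : E.IsReduction G) (t : ℕ)
    (x : Fin t → ℝ) {f : (Fin (t + 1) → ℝ) × ℝ × EuclideanSpace ℝ (Fin K) → ENNReal}
    (hf : Measurable f) :
    ∫⁻ c, ∫⁻ n, f (s.errorStep E μ G t (x, c) n) ∂((E.extLaw μ).map (periodNoise t))
        ∂(E.residualLaw G t (s.count t x)) =
      ∫⁻ z, ∫⁻ c, f (s.extend E μ t x z, c)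
        ∂(E.residualLaw G (t + 1) (s.count t x + Pi.single (s.source t x) 1))
        ∂(gaussianReal 0 1) := by
  have hP : IsProbabilityMeasure ((E.extLaw μ).map (periodNoise t)) :=
    Measure.isProbabilityMeasure_map (measurable_periodNoise t).aemeasurable
  have hm := (s.measurable_errorStep E μ G t).comp (f := fun p : (ℝ × EuclideanSpace ℝ (Fin K)) ×
    (Fin K → ℝ) × ℝ => ((x, p.1), p.2)) (by fun_prop)
  have hprod := lintegral_prod _ ((hf.comp hm).aemeasurable (μ := (E.residualLaw G t
    (s.count t x)).prod ((E.extLaw μ).map (periodNoise t))))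
  refine hprod.symm.trans ?_
  set q := s.count t x with hq
  set k := s.source t x with hk
  set j := nextSource G t q k with hj
  have hG1 : G (t + 1) (q + Pi.single k 1) = G t q + Pi.single j 1 := hG.nextSource_spec t q k
  have hsum : ∑ i, q i = t := s.sum_count t x
  have hg : Measurable fun c : ℝ × ℝ × EuclideanSpace ℝ (Fin K) =>
      f (s.extend E μ t x c.1, c.2) :=
    hf.comp (((s.measurable_extend E μ t).comp (measurable_const.prodMk measurable_fst)).prodMk
      measurable_snd)
  -- The slacks serve as variances; this is where a replacement must not raise the posterior
  -- variance.
  have hr : 0 ≤ E.slack G t q := sub_nonneg.2 (hG.le t q hsum)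
  have hr' : 0 ≤ E.slack G (t + 1) (q + Pi.single k 1) :=
    sub_nonneg.2 (hG.le _ _ (by rw [sum_add_single, hsum]))
  have hκ := hpos.kalmanGain_zero_ne_zero q k
  have key := lintegral_gaussian_step (E.posDef_postCov (G t q)).posSemidef
    (E.posDef_postCov (G t q + Pi.single j 1)).posSemidef (WithLp.toLp 2 (E.C j))
    (E.kalmanGain (G t q) j) (E.scale_pos (G t q) j).ne' (σ := E.σ j)
    (by rw [scale_sq]; rfl) (E.mulVec_eq_kalmanGain (G t q) j)
    (E.postCov_add_single_eq_kalmanGain (G t q) j) hr hr'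
    (κ := E.kalmanGain q k 0) (β := E.kalmanGain (G t q) j 0)
    (v := E.kalmanGain q k 0 ^ 2 + E.slack G (t + 1) (q + Pi.single k 1)) (by positivity)
    -- Both sides are the decrease of the variance from `q` to `G t q + Pi.single j 1`.
    (by rw [kalmanGain_zero_sq, kalmanGain_zero_sq, slack, slack, hG1]; ring) rfl hg
  simp only [inner_eq_fit] at key
  unfold residualLaw
  rw [hG1, ← key, ← ((MeasurePreserving.id _).prod
    (measurePreserving_noise μ t j)).lintegral_comp]
  · rfl
  · have h : Measurable fun p : (ℝ × EuclideanSpace ℝ (Fin K)) × ℝ × ℝ =>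
        (E.scale (G t q) j)⁻¹ * (E.fit j p.1.2 + p.2.1) := by
      unfold Environment.fit; fun_prop
    have hU := measurable_fst.fst.add (h.const_mul (E.kalmanGain (G t q) j 0))
    have hz := (hU.const_mul (E.kalmanGain q k 0 / (E.kalmanGain q k 0 ^ 2 +
      E.slack G (t + 1) (q + Pi.single k 1)))).add (measurable_snd.snd.const_mul
        √(E.slack G (t + 1) (q + Pi.single k 1) / (E.kalmanGain q k 0 ^ 2 +
          E.slack G (t + 1) (q + Pi.single k 1))))
    exact hg.comp (hz.prodMk ((hU.sub (hz.const_mul _)).prodMk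
      (measurable_fst.snd.sub (h.smul_const _))))

/-- The invariant of the simulation: given the simulated realizations, the difference of the
posterior means and the actual estimation error are independent centered Gaussians whose variances
depend only on the simulated division. It persists because the noise of each period is independent
of the past. -/
theorem map_mimicError (hpos : E.PositiveMarginalValue) (hG : E.IsReduction G) (t : ℕ) :
    (E.extLaw μ).map (s.mimicError E μ G t) =
      s.realizationLaw E μ t ⊗ₘ s.residualKernel E G t := by
  induction t with
  | zero =>
    refine Measure.ext_of_lintegral _ fun f hf => ?_
    rw [lintegral_map hf (s.measurable_mimicError E μ G 0), Measure.lintegral_compProd hf,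
      realizationLaw, lintegral_dirac' _ hf.lintegral_kernel_prod_right', residualKernel_apply,
      residualLaw]
    have h0 : s.count 0 Fin.elim0 = 0 := rfl
    rw [h0, slack, hG.zero, sub_self, Real.toNNReal_zero, gaussianReal_zero_var, postCov_zero,
      lintegral_prod _ (by fun_prop), lintegral_dirac' _ (by fun_prop)]
    have h1 : MeasurePreserving (fun p : Sample K × (ℕ → ℝ) => p.1.1 - μ) (E.extLaw μ)
        (multivariateGaussian 0 E.V) := by
      refine MeasurePreserving.comp (g := fun x => x - μ) (f := fun p : Sample K × (ℕ → ℝ) => p.1.1) ?_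
        (measurePreserving_fst.comp measurePreserving_fst)
      refine ⟨by fun_prop, ?_⟩
      unfold multivariateGaussian
      rw [Measure.map_map (by fun_prop) (by fun_prop)]
      congr 1
      ext x
      simp
    rw [← h1.lintegral_comp (by fun_prop)]
    refine lintegral_congr fun p => ?_
    rw [mimicError, mimicState_zero]
    simp only [mean, sub_self]
  | succ t ih =>
    have hM := s.measurable_mimicError E μ G t
    have hN := measurable_periodNoise (K := K) t
    have hP : IsProbabilityMeasure ((E.extLaw μ).map (periodNoise t)) :=
      Measure.isProbabilityMeasure_map hN.aemeasurable
    have hind : IndepFun (s.mimicError E μ G t) (periodNoise t) (E.extLaw μ) :=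
      (s.indepFun_mimicState E μ G t).comp (s.measurable_errorOf E μ t) measurable_id
    rw [indepFun_iff_map_prod_eq_prod_map_map hM.aemeasurable hN.aemeasurable, ih] at hind
    have hS := s.measurable_errorStep E μ G t
    refine Measure.ext_of_lintegral _ fun f hf => ?_
    rw [lintegral_map hf (s.measurable_mimicError E μ G (t + 1))]
    simp only [mimicError_succ]
    have e1 : ∫⁻ p, f (s.errorStep E μ G t (s.mimicError E μ G t p) (periodNoise t p))
        ∂(E.extLaw μ) = ∫⁻ a, f (s.errorStep E μ G t a.1 a.2)
          ∂((E.extLaw μ).map fun p => (s.mimicError E μ G t p, periodNoise t p)) :=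
      (lintegral_map (hf.comp hS) (hM.prodMk hN)).symm
    have hfS : Measurable fun a : ((Fin t → ℝ) × ℝ × EuclideanSpace ℝ (Fin K)) ×
        (Fin K → ℝ) × ℝ => f (s.errorStep E μ G t a.1 a.2) := hf.comp hS
    rw [e1, hind, lintegral_prod _ hfS.aemeasurable,
      Measure.lintegral_compProd hfS.lintegral_prod_right',
      Measure.lintegral_compProd hf, realizationLaw,
      lintegral_map hf.lintegral_kernel_prod_right' (s.measurable_extend E μ t),
      lintegral_prod _ (Measurable.aemeasurable ?_)]
    · simp only [residualKernel_apply, count_extend]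
      exact lintegral_congr fun x => s.lintegral_errorStep μ hpos hG t x hf
    · exact hf.lintegral_kernel_prod_right'.comp (s.measurable_extend E μ t)

/-- The slack and the variance after the replacement add up to the variance before it, so `G` drops
out. -/
theorem _root_.Environment.measurePreserving_residual (hG : E.IsReduction G) {t : ℕ}
    {q : Fin K → ℕ} (hq : ∑ k, q k = t) :
    MeasurePreserving (fun c : ℝ × EuclideanSpace ℝ (Fin K) => c.1 + c.2 0) (E.residualLaw G t q)
      (gaussianReal 0 (Real.toNNReal (E.postCov q 0 0))) := by
  have hr : 0 ≤ E.slack G t q := sub_nonneg.2 (hG.le t q hq)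
  have h1 := (MeasurePreserving.id (gaussianReal 0 (Real.toNNReal (E.slack G t q)))).prod
    (measurePreserving_eval_multivariateGaussian (μ := 0)
      (E.posDef_postCov (G t q)).posSemidef (i := 0))
  have h2 : MeasurePreserving (fun p : ℝ × ℝ => p.1 + p.2)
      ((gaussianReal 0 (Real.toNNReal (E.slack G t q))).prod
        (gaussianReal 0 (Real.toNNReal (E.postCov (G t q) 0 0))))
      (gaussianReal 0 (Real.toNNReal (E.postCov q 0 0))) := by
    refine ⟨by fun_prop, ?_⟩
    have h3 := gaussianReal_conv_gaussianReal (m₁ := 0) (m₂ := 0)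
      (v₁ := Real.toNNReal (E.slack G t q)) (v₂ := Real.toNNReal (E.postCov (G t q) 0 0))
    rw [← Real.toNNReal_add hr (E.postCov_zero_zero_pos _).le, slack, sub_add_cancel,
      add_zero] at h3
    exact h3
  exact h2.comp h1

/-- The joint law of the simulated realizations and the payoff-relevant state does not depend on
how the divisions are replaced. -/
theorem lintegral_mimicState (hpos : E.PositiveMarginalValue) (hG : E.IsReduction G) (t : ℕ)
    {f : (Fin t → ℝ) × ℝ → ENNReal} (hf : Measurable f) :
    ∫⁻ p, f ((s.mimicState E μ G t p.1 p.2).1, p.1.1 0) ∂(E.extLaw μ) =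
      ∫⁻ x, ∫⁻ u, f (x, s.mean E μ t x 0 + u)
        ∂(gaussianReal 0 (Real.toNNReal (E.postCov (s.count t x) 0 0)))
        ∂(s.realizationLaw E μ t) := by
  have hc : Measurable fun x : EuclideanSpace ℝ (Fin K) => x 0 := by fun_prop
  have hmean := hc.comp (s.measurable_mean E μ t)
  have hg : Measurable fun a : (Fin t → ℝ) × ℝ × EuclideanSpace ℝ (Fin K) =>
      f (a.1, s.mean E μ t a.1 0 + (a.2.1 + a.2.2 0)) :=
    hf.comp (measurable_fst.prodMk ((hmean.comp measurable_fst).add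
      (measurable_snd.fst.add (hc.comp measurable_snd.snd))))
  have h1 : ∀ p : Sample K × (ℕ → ℝ), f ((s.mimicState E μ G t p.1 p.2).1, p.1.1 0) =
      (fun a : (Fin t → ℝ) × ℝ × EuclideanSpace ℝ (Fin K) =>
        f (a.1, s.mean E μ t a.1 0 + (a.2.1 + a.2.2 0))) (s.mimicError E μ G t p) := by
    intro p
    simp only [mimicError, PiLp.sub_apply]
    congr 2
    ring
  simp only [h1]
  rw [← lintegral_map hg (s.measurable_mimicError E μ G t), s.map_mimicError μ hpos hG t,
    Measure.lintegral_compProd hg]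
  refine lintegral_congr fun x => ?_
  rw [residualKernel_apply, ← (measurePreserving_residual hG (s.sum_count t x)).lintegral_comp]
  exact hf.comp (measurable_const.prodMk (measurable_const.add measurable_id))

end Strategy

/-! ### From finite histories to optimal strategies. -/

section Sequences

/-- The first `t` terms of a sequence, and the second component. -/
def initialSegment (t : ℕ) (x : (ℕ → ℝ) × ℝ) : (Fin t → ℝ) × ℝ := (fun i => x.1 i, x.2)

theorem measurable_initialSegment (t : ℕ) : Measurable (initialSegment t) := by
  unfold initialSegment; fun_prop

/-- A measure on sequences, with a further component, is determined by the laws of the initial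
segments. -/
theorem ext_of_map_initialSegment {P Q : Measure ((ℕ → ℝ) × ℝ)} [IsProbabilityMeasure P]
    [IsProbabilityMeasure Q] (h : ∀ t, P.map (initialSegment t) = Q.map (initialSegment t)) :
    P = Q := by
  set m : ℕ → MeasurableSpace ((ℕ → ℝ) × ℝ) := fun t =>
    MeasurableSpace.comap (initialSegment t) inferInstance with hm
  have hmono : Monotone m := by
    intro t t' htt'
    have : initialSegment t = (fun a : (Fin t' → ℝ) × ℝ =>
        ((fun i : Fin t => a.1 (Fin.castLE htt' i)), a.2)) ∘ initialSegment t' := rfl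
    simp only [hm]
    rw [this, ← MeasurableSpace.comap_comp]
    exact MeasurableSpace.comap_mono (Measurable.comap_le (by fun_prop))
  have hsup : (inferInstance : MeasurableSpace ((ℕ → ℝ) × ℝ)) = ⨆ t, m t := by
    refine le_antisymm ?_ (iSup_le fun t => (measurable_initialSegment t).comap_le)
    have hle : ∀ t, m t ≤ ⨆ t, m t := fun t => le_iSup m t
    have h1 : ∀ t, Measurable[⨆ t, m t] (initialSegment t) := fun t =>
      measurable_iff_comap_le.2 (hle t)
    refine sup_le (measurable_iff_comap_le.1 ((@measurable_pi_iff _ _ _ (⨆ t, m t) _ _).2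
      fun n => ?_))
      (measurable_iff_comap_le.1 ?_)
    · exact Measurable.comp (f := initialSegment (n + 1))
        (g := fun a : (Fin (n + 1) → ℝ) × ℝ => a.1 (Fin.last n)) (by fun_prop) (h1 (n + 1))
    · exact Measurable.comp (f := initialSegment 0) (g := Prod.snd) measurable_snd (h1 0)
  have hgen : (inferInstance : MeasurableSpace ((ℕ → ℝ) × ℝ)) =
      MeasurableSpace.generateFrom (⋃ t, {s | MeasurableSet[m t] s}) :=
    hsup.trans (MeasurableSpace.generateFrom_iUnion_measurableSet m).symm
  -- Events determined by initial segments form an increasing union of σ-algebras, hence a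
  -- generating π-system.
  refine ext_of_generate_finite _ hgen (isPiSystem_iUnion_of_monotone _
    (fun t => (m t).isPiSystem_measurableSet) fun t t' htt' s hs => hmono htt' s hs) ?_ (by simp)
  rintro s ⟨_, ⟨t, rfl⟩, hs⟩
  obtain ⟨s', hs', rfl⟩ := hs
  rw [← Measure.map_apply (measurable_initialSegment t) hs', h t,
    Measure.map_apply (measurable_initialSegment t) hs']

end Sequences

namespace Strategy

open Environment

variable {K : ℕ} [NeZero K] {𝒜 : ℕ → Type*} [∀ t, MeasurableSpace (𝒜 t)]
  (s : Strategy K 𝒜)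

section

variable (E : Environment K) (μ : EuclideanSpace ℝ (Fin K)) (G : ℕ → (Fin K → ℕ) → Fin K → ℕ)

/-- The sequence of all simulated realizations, and the payoff-relevant state. -/
def mimicPath (p : Sample K × (ℕ → ℝ)) : (ℕ → ℝ) × ℝ :=
  (fun n => (s.mimicState E μ G (n + 1) p.1 p.2).1 (Fin.last n), p.1.1 0)

theorem measurable_mimicPath : Measurable (s.mimicPath E μ G) :=
  (measurable_pi_lambda _ fun n => (measurable_pi_apply (Fin.last n)).comp
    (s.measurable_mimicState E μ G (n + 1)).fst).prodMk
    ((by fun_prop : Measurable fun x : EuclideanSpace ℝ (Fin K) => x 0).comp measurable_fst.fst)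

theorem initialSegment_mimicPath (t : ℕ) (p : Sample K × (ℕ → ℝ)) :
    initialSegment t (s.mimicPath E μ G p) = ((s.mimicState E μ G t p.1 p.2).1, p.1.1 0) := by
  refine Prod.ext ?_ rfl
  induction t with
  | zero => exact Subsingleton.elim _ _
  | succ t ih =>
    funext i
    induction i using Fin.lastCases with
    | last => rfl
    | cast i =>
      rw [mimicState_succ]
      simp only [mimicStep, Fin.snoc_castSucc]
      rw [← ih]
      rfl

/-- The payoff, as a function of the realizations and the payoff-relevant state. -/
def pathPayoff (U : (∀ t, 𝒜 t) → ℝ → ℝ) (x : (ℕ → ℝ) × ℝ) : ℝ :=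
  U (fun t => s.action t (initialSegment (t + 1) x).1) x.2

theorem measurable_pathPayoff {U : (∀ t, 𝒜 t) → ℝ → ℝ} (hU : Measurable (Function.uncurry U)) :
    Measurable (s.pathPayoff U) :=
  hU.comp ((measurable_pi_lambda _ fun t => (s.measurable_action t).comp
    (measurable_initialSegment (t + 1)).fst).prodMk measurable_snd)

theorem payoff_mimicStrategy (U : (∀ t, 𝒜 t) → ℝ → ℝ) (p : Sample K × (ℕ → ℝ)) :
    (s.mimicStrategy E μ G p.2).payoff E U p.1 = s.pathPayoff U (s.mimicPath E μ G p) := by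
  simp only [pathPayoff, initialSegment_mimicPath]
  rfl

end

variable {E : Environment K} (μ : EuclideanSpace ℝ (Fin K)) {G : ℕ → (Fin K → ℕ) → Fin K → ℕ}

/-- The original strategy is the simulation with the trivial replacement, so comparing it with
another simulation amounts to comparing two replacement rules. -/
theorem payoff_eq_pathPayoff (hpos : E.PositiveMarginalValue) (U : (∀ t, 𝒜 t) → ℝ → ℝ)
    (p : Sample K × (ℕ → ℝ)) :
    s.payoff E U p.1 = s.pathPayoff U (s.mimicPath E μ (fun _ q => q) p) := by
  simp only [pathPayoff, initialSegment_mimicPath, s.mimicState_id μ hpos]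
  rfl

theorem map_mimicPath_eq (hpos : E.PositiveMarginalValue) (hG : E.IsReduction G) :
    (E.extLaw μ).map (s.mimicPath E μ G) =
      (E.extLaw μ).map (s.mimicPath E μ fun _ q => q) := by
  have := Measure.isProbabilityMeasure_map (μ := E.extLaw μ)
    (s.measurable_mimicPath E μ G).aemeasurable
  have := Measure.isProbabilityMeasure_map (μ := E.extLaw μ)
    (s.measurable_mimicPath E μ fun _ q => q).aemeasurable
  refine ext_of_map_initialSegment fun t => ?_
  refine Measure.ext_of_lintegral _ fun f hf => ?_
  have hi := measurable_initialSegment t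
  have hfi : Measurable fun x => f (initialSegment t x) := hf.comp hi
  rw [lintegral_map hf hi, lintegral_map hfi (s.measurable_mimicPath E μ G),
    lintegral_map hf hi, lintegral_map hfi (s.measurable_mimicPath E μ fun _ q => q)]
  simp only [initialSegment_mimicPath]
  rw [s.lintegral_mimicState μ hpos hG t hf, s.lintegral_mimicState μ hpos E.isReduction_id t hf]

theorem expectedPayoff_eq_integral {U : (∀ t, 𝒜 t) → ℝ → ℝ}
    (h : Integrable (s.payoff E U) (E.law μ)) :
    s.expectedPayoff E μ U = ((∫ ω, s.payoff E U ω ∂(E.law μ) : ℝ) : EReal) := by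
  have h1 := h.lintegral_lt_top.ne
  have h2 := h.neg.lintegral_lt_top.ne
  simp only [Pi.neg_apply] at h2
  rw [expectedPayoff, integral_eq_lintegral_pos_part_sub_lintegral_neg_part h, EReal.coe_sub]
  generalize ∫⁻ ω, ENNReal.ofReal (s.payoff E U ω) ∂(E.law μ) = a at h1 ⊢
  generalize ∫⁻ ω, ENNReal.ofReal (-s.payoff E U ω) ∂(E.law μ) = b at h2 ⊢
  lift a to NNReal using h1
  lift b to NNReal using h2
  rfl

/-- For almost all randomizations, the strategy simulating an optimal strategy is optimal. -/
theorem exists_isOptimal_mimicStrategy (hpos : E.PositiveMarginalValue) (hG : E.IsReduction G)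
    {U : (∀ t, 𝒜 t) → ℝ → ℝ} (hU : Measurable (Function.uncurry U)) (hs : s.IsOptimal E μ U) :
    ∃ w, (s.mimicStrategy E μ G w).IsOptimal E μ U := by
  have hΦ := s.measurable_pathPayoff hU
  have hX := s.measurable_mimicPath E μ G
  have hX' := s.measurable_mimicPath E μ fun _ q => q
  set W : Measure (ℕ → ℝ) := Measure.infinitePi fun _ : ℕ => gaussianReal 0 1 with hW
  have h1 : Integrable (fun p => s.pathPayoff U (s.mimicPath E μ (fun _ q => q) p))
      (E.extLaw μ) := by
    simp only [← s.payoff_eq_pathPayoff μ hpos]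
    exact hs.1.comp_fst W
  have h2 : Integrable (fun p => s.pathPayoff U (s.mimicPath E μ G p)) (E.extLaw μ) := by
    refine Integrable.comp_measurable (g := s.pathPayoff U) ?_ hX
    rw [s.map_mimicPath_eq μ hpos hG]
    exact (integrable_map_measure hΦ.aestronglyMeasurable hX'.aemeasurable).2 h1
  have h3 : ∫ p, s.pathPayoff U (s.mimicPath E μ G p) ∂(E.extLaw μ) =
      ∫ ω, s.payoff E U ω ∂(E.law μ) := by
    rw [← integral_map hX.aemeasurable hΦ.aestronglyMeasurable, s.map_mimicPath_eq μ hpos hG,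
      integral_map hX'.aemeasurable hΦ.aestronglyMeasurable]
    simp only [← s.payoff_eq_pathPayoff μ hpos]
    rw [extLaw, integral_fun_fst]
    simp
  simp only [← payoff_mimicStrategy] at h2 h3
  have h4 : ∀ᵐ w ∂W, Integrable ((s.mimicStrategy E μ G w).payoff E U) (E.law μ) :=
    h2.prod_left_ae
  set I : (ℕ → ℝ) → ℝ := fun w => ∫ ω, (s.mimicStrategy E μ G w).payoff E U ω ∂(E.law μ) with hI
  have h5 : Integrable I W := h2.integral_prod_right
  have h6 : ∫ w, I w ∂W = ∫ ω, s.payoff E U ω ∂(E.law μ) := by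
    rw [← h3, extLaw, integral_prod_symm _ h2]
  -- The payoffs `I w` average to the optimal payoff and almost surely do not exceed it, so almost
  -- all of them equal it.
  have h7 : ∀ᵐ w ∂W, 0 ≤ ∫ ω, s.payoff E U ω ∂(E.law μ) - I w := by
    filter_upwards [h4] with w hw
    have := hs.2 (s.mimicStrategy E μ G w)
    rw [expectedPayoff_eq_integral _ μ hw, expectedPayoff_eq_integral _ μ hs.1,
      EReal.coe_le_coe_iff] at this
    exact sub_nonneg.2 this
  have h8 : ∀ᵐ w ∂W, ∫ ω, s.payoff E U ω ∂(E.law μ) - I w = 0 := by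
    refine (integral_eq_zero_iff_of_nonneg_ae h7 ((integrable_const _).sub h5)).1 ?_
    rw [integral_sub (integrable_const _) h5, h6]
    simp
  obtain ⟨w, hw, hw'⟩ := (h4.and h8).exists
  refine ⟨w, hw, fun s' => (hs.2 s').trans_eq ?_⟩
  rw [expectedPayoff_eq_integral _ μ hw, expectedPayoff_eq_integral _ μ hs.1]
  exact congrArg _ (sub_eq_zero.1 hw')

end Strategy

end

theorem proposition2 {K : ℕ} [NeZero K] (E : Environment K)
    (hE : E.NonRedundant) (hpos : E.PositiveMarginalValue)
    (hirr : ∀ i j : Fin K, i ≠ j → Irrational (E.freq i / E.freq j)) :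
    ∃ (A : Set ℕ) (n : ℕ → Fin K → ℕ), HasNaturalDensity A 1 ∧
      (∀ t ∈ A, ∀ q : Fin K → ℕ, E.IsTOptimal t q ↔ q = n t) ∧
      ∀ (μ : EuclideanSpace ℝ (Fin K)) (𝒜 : ℕ → Type*) [∀ t, MeasurableSpace (𝒜 t)]
        (U : (∀ t, 𝒜 t) → ℝ → ℝ), Measurable (Function.uncurry U) →
        (∃ s : Strategy K 𝒜, s.IsOptimal E μ U) →
        ∃ s : Strategy K 𝒜, s.IsOptimal E μ U ∧
          ∀ t ∈ A, ∀ᵐ ω ∂(E.law μ), s.division E ω t = n t := by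
  obtain ⟨A, n, G, hA, hn, h0, hle, hstep, hGA⟩ := hE.exists_division_reduction hpos hirr
  have hG : E.IsReduction G := ⟨h0 0, hle, hstep⟩
  refine ⟨A, n, hA, hn, fun μ 𝒜 _ U hU ⟨s, hs⟩ => ?_⟩
  obtain ⟨w, hw⟩ := s.exists_isOptimal_mimicStrategy μ hpos hG hU hs
  refine ⟨s.mimicStrategy E μ G w, hw, fun t ht => ae_of_all _ fun ω => ?_⟩
  rw [s.division_mimicStrategy μ hG, hGA t ht]
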